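/- For $n\ge 1$ and $r>1$ let $B_c(0,r)$ be the open Euclidean ball of radius $r$ centered at $0$ in $\mathbb C^n$, let $B(0,1)$ be the open Euclidean unit ball of $\mathbb R^n\subset\mathbb C^n$, and let $\mathcal O_r$ be the set of holomorphic functions on $B_c(0,r)$. For $f\in\mathcal O_r$ the Chebyshev degree $d_f(r)$ is the infimum of all $d>0$ such that $$\sup_I|f|\le\left(\frac{4|I|}{|\omega|}\right)^{d}\sup_\omega|f|$$ for every interval $I\subset B_c(0,1)$ of a real straight line in $\mathbb C^n=\mathbb R^{2n}$ and every measurable $\omega\subset I$ of positive length, where $|\cdot|$ of subsets of a line is one-dimensional Lebesgue measure. Let $\widetilde d_f(r)$ be the smallest integer $\ge d_f(r)$. There are constants $c(k,s)$, depending only on the integers $k\ge 0$ and $s\ge 1$, such that for all $n\ge1$, $r>1$ and $f\in\mathcal O_r$ at least one such $d$ exists (so $d_f(r)<\infty$), and for every convex body $V\subset B(0,1)$ (a convex set with non-empty interior) and every integer $s\ge1$, $$\left(\frac1{|V|}\int_V|f(x)|^s\,dx\right)^{1/s}\le c\bigl(\widetilde d_f(r),s\bigr)\,\frac1{|V|}\int_V|f(x)|\,dx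 ,$$ where $|V|$ is the $n$-dimensional Lebesgue measure of $V$. In particular the constant does not depend on the dimension $n$. -/

import Mathlib

open MeasureTheory

/-- `d` is admissible in the Chebyshev-type inequality for `f` on the open complex Euclidean unit
ball: `sup_I |f| ≤ (4 |I| / |ω|) ^ d * sup_ω |f|` for every interval `I` of a real straight line,
`I` contained in the ball, and every measurable subset `ω` of `I` of positive length.
The real line through `x` in the direction of the unit vector `v` is parametrized by arc length
`t ↦ x + t • v`; `I` and `ω` are the images of `J` and `W`, so that their lengths are the
Lebesgue measures of `J` and `W`. -/
def IsChebyshevExponent {n : ℕ} (f : EuclideanSpace ℂ (Fin n) → ℂ) (d : ℝ) : Prop :=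
  ∀ x ∈ Metric.ball (0 : EuclideanSpace ℂ (Fin n)) 1,
  ∀ v : EuclideanSpace ℂ (Fin n), ‖v‖ = 1 →
  ∀ J W : Set ℝ, J.OrdConnected →
    (∀ t ∈ J, x + t • v ∈ Metric.ball (0 : EuclideanSpace ℂ (Fin n)) 1) →
    W ⊆ J → MeasurableSet W → 0 < volume W →
    sSup ((fun t : ℝ => ‖f (x + t • v)‖) '' J) ≤
      (4 * volume.real J / volume.real W) ^ d * sSup ((fun t : ℝ => ‖f (x + t • v)‖) '' W)

/-- The set of all positive admissible exponents. -/
def chebyshevExponents {n : ℕ} (f : EuclideanSpace ℂ (Fin n) → ℂ) : Set ℝ :=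
  {d : ℝ | 0 < d ∧ IsChebyshevExponent f d}

/-- The Chebyshev degree of `f`: the best (that is, the least) exponent. -/
noncomputable def chebyshevDegree {n : ℕ} (f : EuclideanSpace ℂ (Fin n) → ℂ) : ℝ :=
  sInf (chebyshevExponents f)

/-- The smallest integer that is at least the (nonnegative) Chebyshev degree. -/
noncomputable def chebyshevDegreeCeil {n : ℕ} (f : EuclideanSpace ℂ (Fin n) → ℂ) : ℕ :=
  ⌈chebyshevDegree f⌉₊

/-- The inclusion of `ℝⁿ` into `ℂⁿ`. -/
noncomputable def realToComplex {n : ℕ} (x : EuclideanSpace ℝ (Fin n)) :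
    EuclideanSpace ℂ (Fin n) :=
  WithLp.toLp 2 (fun i => (x i : ℂ))

/-! There are two separate claims: the set of Chebyshev exponents is nonempty, and an exponent `K`
gives a reverse Hölder inequality whose constant depends on `K` and `s` only.

Reverse Hölder. If `|f x| > l * (8 * j) ^ K`, the Chebyshev inequality on the segment from `y` to
`x` shows that `|f| ≤ l` holds on at most the fraction `1 / (2 * j)` of it
(`IsChebyshevExponent.volume_segment_le`). Let `U` be the body, `O` the set where `|f| > l * (8 * j)
^ K` and `G` the set where `|f| > l`. Carry `U` into `O` by a map whose straight-line interpolation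
has density at most `(|U| / |O|) ^ s` at time `s`. Up to time `1 / j` each trajectory spends at
least half of its time in `G`, so Fubini gives `|U| / 2 ≤ (|U| / |O|) ^ (1 / j) * |G|`. With `l`
four times the mean of `|f|`, Markov gives `|G| ≤ |U| / 4`, hence `|O| ≤ 2 ^ (-j) * |U|`. Summing
over `j` bounds the `s`-th moment, as thresholds grow polynomially and measures decay geometrically.
No dimension enters because the density bound sees only the ratio of volumes. The transport is built
for finite unions of boxes by proportional cuts, as in the Hadwiger–Ohmann proof of Brunn–Minkowski
(`IsBoxFamily.hasTransport`); open sets are approximated from inside.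

Finiteness of the degree. Near a point `x₀`, the Taylor coefficients of `z ↦ f (x₀ + y + z • v)` are
holomorphic in `(y, v)`. A bounded infinite family of holomorphic maps is dominated near a point by
finitely many of its members (`exists_finite_dominating`), a quantitative form of the Noetherian
property, proved by Weierstrass division and induction on dimension. So finitely many coefficients
control all of them, and Cauchy estimates on a disk of radius `l` lose only a fixed power of `1 / l`
when passing to a disk of fixed radius; compactness makes this uniform (`exists_uniform_growth`). On
a short interval, Newton interpolation at separated points of `ω` then has a remainder small enough
to be absorbed, which is a Remez inequality; long intervals are reached by a chain of disks
(`exists_line_remez`). Since `4 * |I| / |ω| ≥ 4`, the multiplicative constant is swallowed by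
raising the exponent. -/

/-- A half-open coordinate box. -/
def IsHalfOpenBox {ι : Type*} (A : Set (ι → ℝ)) : Prop :=
  ∃ l u : ι → ℝ, A = Set.pi Set.univ (fun i => Set.Ico (l i) (u i))

/-- A finite family of nonempty pairwise disjoint half-open boxes. -/
structure IsBoxFamily {ι : Type*} (S : Finset (Set (ι → ℝ))) : Prop where
  box : ∀ A ∈ S, IsHalfOpenBox A
  nonempty : ∀ A ∈ S, A.Nonempty
  disjoint : ∀ A ∈ S, ∀ B ∈ S, A ≠ B → Disjoint A B

/-- `T` carries `A` into `B` in such a way that, along the straight-line interpolation, the image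
of Lebesgue measure on `A` has density at most `(|A| / |B|) ^ s` at time `s`. -/
def HasTransport {ι : Type*} [Fintype ι] (A B : Set (ι → ℝ)) : Prop :=
  ∃ T : (ι → ℝ) → (ι → ℝ), Measurable T ∧ (∀ y ∈ A, T y ∈ B) ∧
    ∀ s ∈ Set.Icc (0 : ℝ) 1, ∀ G : Set (ι → ℝ), MeasurableSet G →
      volume (A ∩ {y | (1 - s) • y + s • T y ∈ G}) ≤
        ENNReal.ofReal ((volume.real A / volume.real B) ^ s) * volume G

lemma measurableSet_coord_lt {ι : Type*} (i : ι) (a : ℝ) : MeasurableSet {y : ι → ℝ | y i < a} :=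
  measurableSet_lt (measurable_pi_apply i) measurable_const

/-! ### Transport between boxes with controlled interpolated density -/

section Transport

variable {ι : Type*} [Fintype ι]

/-- At time `s` the two halves move into opposite sides of the hyperplane at height `(1 - s) * a + s
* b`, so their images do not overlap and the two measure bounds add up. Equal volume ratios make the
two density bounds the same. -/
lemma HasTransport.combine {A B : Set (ι → ℝ)} (i : ι) (a b : ℝ)
    (h1 : HasTransport (A ∩ {y | y i < a}) (B ∩ {y | y i < b}))
    (h2 : HasTransport (A ∩ {y | y i < a}ᶜ) (B ∩ {y | y i < b}ᶜ))
    (r1 : volume.real (A ∩ {y | y i < a}) / volume.real (B ∩ {y | y i < b}) =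
      volume.real A / volume.real B)
    (r2 : volume.real (A ∩ {y | y i < a}ᶜ) / volume.real (B ∩ {y | y i < b}ᶜ) =
      volume.real A / volume.real B) : HasTransport A B := by
  classical
  obtain ⟨T1, m1, t1, e1⟩ := h1
  obtain ⟨T2, m2, t2, e2⟩ := h2
  rw [r1] at e1
  rw [r2] at e2
  have hH := measurableSet_coord_lt i a
  refine ⟨Set.piecewise {y | y i < a} T1 T2, m1.piecewise hH m2, ?_, ?_⟩
  · intro y hy
    by_cases hya : y i < a
    · rw [Set.piecewise_eq_of_mem _ _ _ (by exact hya)]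
      exact (t1 y ⟨hy, hya⟩).1
    · rw [Set.piecewise_eq_of_notMem _ _ _ (by exact hya)]
      exact (t2 y ⟨hy, hya⟩).1
  · intro s hs G hG
    have hK := measurableSet_coord_lt i ((1 - s) * a + s * b)
    rw [← measure_inter_add_sdiff G hK, mul_add,
      ← measure_inter_add_sdiff (A ∩ _) hH]
    refine add_le_add ((measure_mono ?_).trans (e1 s hs _ (hG.inter hK)))
      ((measure_mono ?_).trans (e2 s hs _ (hG.diff hK)))
    · rintro y ⟨⟨hyA, hyG⟩, hya⟩
      rw [Set.mem_ofPred_eq, Set.piecewise_eq_of_mem _ _ _ hya] at hyG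
      refine ⟨⟨hyA, hya⟩, hyG, ?_⟩
      have hb : T1 y i < b := (t1 y ⟨hyA, hya⟩).2
      have hya' : y i < a := hya
      show (1 - s) * y i + s * T1 y i < (1 - s) * a + s * b
      rcases hs.1.eq_or_lt with h0 | h0
      · subst h0; simpa using hya'
      · have := mul_lt_mul_of_pos_left hb h0
        have := mul_le_mul_of_nonneg_left hya'.le (sub_nonneg.2 hs.2)
        linarith
    · rintro y ⟨⟨hyA, hyG⟩, hya⟩
      rw [Set.mem_ofPred_eq, Set.piecewise_eq_of_notMem _ _ _ hya] at hyG
      refine ⟨⟨hyA, hya⟩, hyG, ?_⟩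
      have hb : ¬ T2 y i < b := (t2 y ⟨hyA, hya⟩).2
      have hya' : ¬ y i < a := hya
      show ¬ (1 - s) * y i + s * T2 y i < (1 - s) * a + s * b
      push Not at hb hya' ⊢
      have := mul_le_mul_of_nonneg_left hb hs.1
      have := mul_le_mul_of_nonneg_left hya' (sub_nonneg.2 hs.2)
      linarith

/-- The diagonal affine map works: with side ratios `r i`, the interpolation at time `s` has
Jacobian `∏ i, ((1 - s) + s * r i)`, and weighted AM-GM bounds each factor below by `r i ^ s`. -/
lemma HasTransport.of_boxes {A B : Set (ι → ℝ)} (hA : IsHalfOpenBox A) (hB : IsHalfOpenBox B)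
    (hA0 : A.Nonempty) (hB0 : B.Nonempty) : HasTransport A B := by
  classical
  obtain ⟨l, u, rfl⟩ := hA
  obtain ⟨l', u', rfl⟩ := hB
  obtain ⟨p, hp⟩ := hA0
  obtain ⟨q, hq⟩ := hB0
  have hlu : ∀ i, 0 < u i - l i := fun i => by
    have := hp i trivial; simp only [Set.mem_Ico] at this; linarith
  have hlu' : ∀ i, 0 < u' i - l' i := fun i => by
    have := hq i trivial; simp only [Set.mem_Ico] at this; linarith
  set r : ι → ℝ := fun i => (u' i - l' i) / (u i - l i) with hr
  have hr0 : ∀ i, 0 < r i := fun i => div_pos (hlu' i) (hlu i)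
  have vol : ∀ l u : ι → ℝ, (∀ i, 0 < u i - l i) →
      volume.real (Set.pi Set.univ (fun i => Set.Ico (l i) (u i))) = ∏ i, (u i - l i) := by
    intro l u h
    rw [measureReal_def, Real.volume_pi_Ico_toReal (fun i => by have := h i; linarith)]
  refine ⟨fun y i => l' i + (y i - l i) * r i, by fun_prop, ?_, ?_⟩
  · intro y hy i _
    have hyi := hy i trivial
    simp only [Set.mem_Ico] at hyi ⊢
    have h1 : 0 ≤ (y i - l i) * r i := mul_nonneg (by linarith) (hr0 i).le
    have h2 : (y i - l i) * r i < (u i - l i) * r i :=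
      mul_lt_mul_of_pos_right (by linarith) (hr0 i)
    have h3 : (u i - l i) * r i = u' i - l' i := by
      rw [hr]; field_simp [(hlu i).ne']
    constructor <;> linarith
  · intro s hs G hG
    set α : ι → ℝ := fun i => (1 - s) + s * r i with hα
    have hα0 : ∀ i, 0 < α i := fun i => by
      rcases hs.1.eq_or_lt with h0 | h0
      · simp [hα, ← h0]
      · have := mul_pos h0 (hr0 i); have := hs.2; simp only [hα]; linarith
    have hdet : LinearMap.det (Matrix.toLin' (Matrix.diagonal α)) = ∏ i, α i := by
      rw [LinearMap.det_toLin', Matrix.det_diagonal]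
    have hpos : 0 < ∏ i, α i := Finset.prod_pos fun i _ => hα0 i
    have key : {y : ι → ℝ | (1 - s) • y + s • (fun i => l' i + (y i - l i) * r i) ∈ G} =
        Matrix.toLin' (Matrix.diagonal α) ⁻¹'
          ((fun z => z + fun i => s * (l' i - l i * r i)) ⁻¹' G) := by
      ext y
      simp only [Set.mem_ofPred_eq, Set.mem_preimage]
      have : (1 - s) • y + s • (fun i => l' i + (y i - l i) * r i) =
          Matrix.toLin' (Matrix.diagonal α) y + fun i => s * (l' i - l i * r i) := by
        ext i
        simp [Matrix.mulVec_diagonal, hα]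
        ring
      rw [this]
    rw [vol l u hlu, vol l' u' hlu']
    refine (measure_mono Set.inter_subset_right).trans ?_
    rw [key, Measure.addHaar_preimage_linearMap _ (by rw [hdet]; exact hpos.ne'),
      measure_preimage_add_right, hdet]
    gcongr
    rw [abs_of_pos (inv_pos.2 hpos), ← Finset.prod_div_distrib,
      ← Real.finsetProd_rpow _ _ (fun i _ => (div_pos (hlu i) (hlu' i)).le), ← Finset.prod_inv_distrib]
    refine Finset.prod_le_prod (fun i _ => (inv_pos.2 (hα0 i)).le) fun i _ => ?_
    have h1 : (r i) ^ s ≤ α i := by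
      have := Real.geom_mean_le_arith_mean2_weighted (sub_nonneg.2 hs.2) hs.1 zero_le_one
        (hr0 i).le (by ring)
      simpa [hα] using this
    have h2 : ((u i - l i) / (u' i - l' i)) ^ s = ((r i) ^ s)⁻¹ := by
      rw [← Real.inv_rpow (hr0 i).le, hr]; simp
    rw [h2]
    exact inv_anti₀ (Real.rpow_pos_of_pos (hr0 i) s) h1

end Transport

/-! ### Cutting box families: the Hadwiger–Ohmann induction -/

section Cut

variable {ι : Type*}

open Classical in
/-- The family of the nonempty traces on `H` of the members of `S`. -/
noncomputable def cutFamily (S : Finset (Set (ι → ℝ))) (H : Set (ι → ℝ)) :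
    Finset (Set (ι → ℝ)) :=
  (S.image (fun A => A ∩ H)).filter Set.Nonempty

lemma mem_cutFamily {S : Finset (Set (ι → ℝ))} {H A : Set (ι → ℝ)} :
    A ∈ cutFamily S H ↔ (∃ B ∈ S, B ∩ H = A) ∧ A.Nonempty := by
  classical
  simp [cutFamily]

lemma sUnion_cutFamily (S : Finset (Set (ι → ℝ))) (H : Set (ι → ℝ)) :
    ⋃₀ (cutFamily S H : Set (Set (ι → ℝ))) = ⋃₀ (S : Set (Set (ι → ℝ))) ∩ H := by
  ext x
  simp only [Set.mem_sUnion, Finset.mem_coe, mem_cutFamily, Set.mem_inter_iff]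
  constructor
  · rintro ⟨_, ⟨⟨B, hB, rfl⟩, -⟩, hx⟩
    exact ⟨⟨B, hB, hx.1⟩, hx.2⟩
  · rintro ⟨⟨B, hB, hx⟩, hxH⟩
    exact ⟨B ∩ H, ⟨⟨B, hB, rfl⟩, ⟨x, hx, hxH⟩⟩, hx, hxH⟩

lemma card_cutFamily_le (S : Finset (Set (ι → ℝ))) (H : Set (ι → ℝ)) :
    (cutFamily S H).card ≤ S.card := by
  classical
  exact (Finset.card_filter_le _ _).trans Finset.card_image_le

lemma card_cutFamily_lt {S : Finset (Set (ι → ℝ))} {H A : Set (ι → ℝ)} (hA : A ∈ S)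
    (h : A ∩ H = ∅) : (cutFamily S H).card < S.card := by
  classical
  have : cutFamily S H ⊆ (S.erase A).image (fun A => A ∩ H) := by
    intro C hC
    obtain ⟨⟨B, hB, rfl⟩, hne⟩ := mem_cutFamily.1 hC
    refine Finset.mem_image.2 ⟨B, Finset.mem_erase.2 ⟨?_, hB⟩, rfl⟩
    rintro rfl
    rw [h] at hne
    exact Set.not_nonempty_empty hne
  exact (Finset.card_le_card this).trans_lt
    (Finset.card_image_le.trans_lt (Finset.card_erase_lt_of_mem hA))

lemma IsBoxFamily.cut {S : Finset (Set (ι → ℝ))} (hS : IsBoxFamily S) {H : Set (ι → ℝ)}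
    (hH : ∀ A, IsHalfOpenBox A → IsHalfOpenBox (A ∩ H)) : IsBoxFamily (cutFamily S H) where
  box := by
    intro A hA
    obtain ⟨⟨B, hB, rfl⟩, -⟩ := mem_cutFamily.1 hA
    exact hH B (hS.box B hB)
  nonempty := fun A hA => (mem_cutFamily.1 hA).2
  disjoint := by
    intro A hA B hB hne
    obtain ⟨⟨A', hA', rfl⟩, -⟩ := mem_cutFamily.1 hA
    obtain ⟨⟨B', hB', rfl⟩, -⟩ := mem_cutFamily.1 hB
    have : A' ≠ B' := by rintro rfl; exact hne rfl
    exact (hS.disjoint A' hA' B' hB' this).mono Set.inter_subset_left Set.inter_subset_left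

lemma IsHalfOpenBox.inter_lt {A : Set (ι → ℝ)} (hA : IsHalfOpenBox A) (i : ι) (a : ℝ) :
    IsHalfOpenBox (A ∩ {y | y i < a}) := by
  classical
  obtain ⟨l, u, rfl⟩ := hA
  refine ⟨l, Function.update u i (min (u i) a), ?_⟩
  ext y
  simp only [Set.mem_inter_iff, Set.mem_pi, Set.mem_univ, true_imp_iff, Set.mem_Ico,
    Set.mem_ofPred_eq]
  constructor
  · rintro ⟨h, ha⟩ j
    by_cases hj : j = i
    · subst hj; simp [h j, ha]
    · simp [hj, h j]
  · intro h
    refine ⟨fun j => ?_, ?_⟩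
    · by_cases hj : j = i
      · subst hj; have := h j; simp at this; exact ⟨this.1, this.2.1⟩
      · have := h j; simpa [hj] using this
    · have := h i; simp at this; exact this.2.2

lemma IsHalfOpenBox.inter_ge {A : Set (ι → ℝ)} (hA : IsHalfOpenBox A) (i : ι) (a : ℝ) :
    IsHalfOpenBox (A ∩ {y | y i < a}ᶜ) := by
  classical
  obtain ⟨l, u, rfl⟩ := hA
  refine ⟨Function.update l i (max (l i) a), u, ?_⟩
  ext y
  simp only [Set.mem_inter_iff, Set.mem_pi, Set.mem_univ, true_imp_iff, Set.mem_Ico,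
    Set.mem_ofPred_eq, Set.mem_compl_iff, not_lt]
  constructor
  · rintro ⟨h, ha⟩ j
    by_cases hj : j = i
    · subst hj; simp [h j, ha]
    · simp [hj, h j]
  · intro h
    refine ⟨fun j => ?_, ?_⟩
    · by_cases hj : j = i
      · subst hj; have := h j; simp at this; exact ⟨this.1.1, this.2⟩
      · have := h j; simpa [hj] using this
    · have := h i; simp at this; exact this.1.2

/-- If no coordinate separates the boxes, their sides overlap in every coordinate, and the
coordinatewise maximum of the two lower corners lies in both. -/
lemma IsHalfOpenBox.exists_separating {A B : Set (ι → ℝ)} (hA : IsHalfOpenBox A)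
    (hB : IsHalfOpenBox B) (hA0 : A.Nonempty) (hB0 : B.Nonempty) (hd : Disjoint A B) :
    ∃ i a, (A ⊆ {y | y i < a} ∧ B ⊆ {y | y i < a}ᶜ) ∨
      (B ⊆ {y | y i < a} ∧ A ⊆ {y | y i < a}ᶜ) := by
  obtain ⟨l, u, rfl⟩ := hA
  obtain ⟨l', u', rfl⟩ := hB
  obtain ⟨p, hp⟩ := hA0
  obtain ⟨q, hq⟩ := hB0
  by_contra hcon
  push Not at hcon
  refine Set.not_disjoint_iff.2 ⟨fun i => max (l i) (l' i), fun i _ => ?_, fun i _ => ?_⟩ hd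
  all_goals
    have hpi := hp i trivial
    have hqi := hq i trivial
    simp only [Set.mem_Ico] at hpi hqi
    have h1 : l' i < u i := by
      by_contra h
      refine (hcon i (u i)).1 (fun y hy => (hy i trivial).2) (fun y hy => ?_)
      have := (hy i trivial).1
      simp only [Set.mem_compl_iff, Set.mem_ofPred_eq]; linarith
    have h2 : l i < u' i := by
      by_contra h
      refine (hcon i (u' i)).2 (fun y hy => (hy i trivial).2) (fun y hy => ?_)
      have := (hy i trivial).1
      simp only [Set.mem_compl_iff, Set.mem_ofPred_eq]; linarith
    simp only [Set.mem_Ico, le_max_iff, max_lt_iff, le_refl, true_or, or_true, true_and]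
    constructor <;> linarith

variable [Fintype ι]

lemma IsHalfOpenBox.measurableSet {A : Set (ι → ℝ)} (hA : IsHalfOpenBox A) : MeasurableSet A := by
  obtain ⟨l, u, rfl⟩ := hA
  exact MeasurableSet.univ_pi fun i => measurableSet_Ico

lemma IsHalfOpenBox.volume_lt_top {A : Set (ι → ℝ)} (hA : IsHalfOpenBox A) : volume A < ⊤ := by
  obtain ⟨l, u, rfl⟩ := hA
  rw [Real.volume_pi_Ico]
  exact ENNReal.prod_lt_top fun i _ => ENNReal.ofReal_lt_top

lemma IsHalfOpenBox.volume_pos {A : Set (ι → ℝ)} (hA : IsHalfOpenBox A) (h : A.Nonempty) :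
    0 < volume A := by
  obtain ⟨l, u, rfl⟩ := hA
  obtain ⟨p, hp⟩ := h
  rw [Real.volume_pi_Ico, pos_iff_ne_zero, Finset.prod_ne_zero_iff]
  intro i _
  have := hp i trivial
  simp only [Set.mem_Ico] at this
  simp; linarith

lemma IsBoxFamily.measurableSet {S : Finset (Set (ι → ℝ))} (hS : IsBoxFamily S) :
    MeasurableSet (⋃₀ (S : Set (Set (ι → ℝ)))) :=
  MeasurableSet.sUnion S.countable_toSet fun A hA => (hS.box A hA).measurableSet

lemma IsBoxFamily.volume_lt_top {S : Finset (Set (ι → ℝ))} (hS : IsBoxFamily S) :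
    volume (⋃₀ (S : Set (Set (ι → ℝ)))) < ⊤ := by
  rw [Set.sUnion_eq_biUnion]
  exact measure_biUnion_lt_top S.finite_toSet fun A hA => (hS.box A hA).volume_lt_top

lemma IsBoxFamily.volume_real_pos {S : Finset (Set (ι → ℝ))} (hS : IsBoxFamily S)
    (h : S.Nonempty) : 0 < volume.real (⋃₀ (S : Set (Set (ι → ℝ)))) := by
  obtain ⟨A, hA⟩ := h
  exact ENNReal.toReal_pos (((hS.box A hA).volume_pos (hS.nonempty A hA)).trans_le
    (measure_mono (Set.subset_sUnion_of_mem hA))).ne' hS.volume_lt_top.ne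

/-- Intermediate value theorem for the distribution function of the `i`-th coordinate under the
uniform probability on `B`; it is continuous because coordinate hyperplanes are null. -/
lemma exists_coord_cut {B : Set (ι → ℝ)} (hB : volume B < ⊤) (hB0 : 0 < volume.real B)
    (i : ι) {θ : ℝ} (h0 : 0 < θ) (h1 : θ < 1) :
    ∃ b, volume.real (B ∩ {y | y i < b}) = θ * volume.real B := by
  have hB0' : volume B ≠ 0 := fun h => by simp [measureReal_def, h] at hB0
  set μ : Measure ℝ := (ProbabilityTheory.cond volume B).map (fun y => y i) with hμ
  have hm : Measurable (fun y : ι → ℝ => y i) := measurable_pi_apply i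
  have : IsProbabilityMeasure (ProbabilityTheory.cond (volume : Measure (ι → ℝ)) B) :=
    ProbabilityTheory.cond_isProbabilityMeasure_of_finite hB0' hB.ne
  have : IsProbabilityMeasure μ := Measure.isProbabilityMeasure_map hm.aemeasurable
  have hnull : ∀ b : ℝ, μ {b} = 0 := by
    intro b
    rw [hμ, Measure.map_apply hm (measurableSet_singleton b)]
    refine ProbabilityTheory.cond_absolutelyContinuous ?_
    exact Measure.pi_hyperplane (α := fun _ : ι => ℝ) (fun _ => volume) i b
  have hc : Continuous (ProbabilityTheory.cdf μ) := by
    refine continuous_iff_continuousAt.2 fun b => ?_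
    have hmono := ProbabilityTheory.monotone_cdf μ
    rw [hmono.continuousAt_iff_leftLim_eq_rightLim, StieltjesFunction.rightLim_eq]
    have := (ProbabilityTheory.cdf μ).measure_singleton b
    rw [ProbabilityTheory.measure_cdf, hnull b] at this
    have h2 := ENNReal.ofReal_eq_zero.1 this.symm
    have h3 := hmono.leftLim_le (le_refl b)
    linarith
  obtain ⟨b1, hb1⟩ := ((ProbabilityTheory.tendsto_cdf_atBot μ).eventually
    (eventually_lt_nhds h0)).exists
  obtain ⟨b2, hb2⟩ := ((ProbabilityTheory.tendsto_cdf_atTop μ).eventually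
    (eventually_gt_nhds h1)).exists
  obtain ⟨b, hb⟩ := mem_range_of_exists_le_of_exists_ge hc ⟨b1, hb1.le⟩ ⟨b2, hb2.le⟩
  refine ⟨b, ?_⟩
  have e1 : μ (Set.Iio b) = μ (Set.Iic b) := by
    refine le_antisymm (measure_mono Set.Iio_subset_Iic_self) ?_
    rw [← Set.Iio_union_right]
    exact (measure_union_le _ _).trans (by simp [hnull b])
  rw [ProbabilityTheory.cdf_eq_real, measureReal_def, ← e1, hμ, Measure.map_apply hm measurableSet_Iio,
    ProbabilityTheory.cond, Measure.smul_apply, Measure.restrict_apply (hm measurableSet_Iio), smul_eq_mul,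
    ENNReal.toReal_mul, ENNReal.toReal_inv, Set.inter_comm] at hb
  rw [measureReal_def, measureReal_def] at *
  rw [← hb]
  field_simp
  rfl

lemma HasTransport.of_cut {S S' : Finset (Set (ι → ℝ))} (hS : IsBoxFamily S)
    (hS' : IsBoxFamily S') (i : ι) (a b : ℝ)
    (hpos : 0 < volume.real (⋃₀ (S : Set (Set (ι → ℝ)))))
    {θ : ℝ} (h0 : 0 < θ) (h1 : θ < 1)
    (ha : volume.real (⋃₀ (S : Set (Set (ι → ℝ))) ∩ {y | y i < a}) =
      θ * volume.real (⋃₀ (S : Set (Set (ι → ℝ)))))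
    (hb : volume.real (⋃₀ (S' : Set (Set (ι → ℝ))) ∩ {y | y i < b}) =
      θ * volume.real (⋃₀ (S' : Set (Set (ι → ℝ)))))
    (hpos' : 0 < volume.real (⋃₀ (S' : Set (Set (ι → ℝ)))))
    (t1 : (cutFamily S {y | y i < a}).Nonempty → (cutFamily S' {y | y i < b}).Nonempty →
      HasTransport (⋃₀ (cutFamily S {y | y i < a} : Set (Set (ι → ℝ))))
      (⋃₀ (cutFamily S' {y | y i < b} : Set (Set (ι → ℝ)))))
    (t2 : (cutFamily S {y | y i < a}ᶜ).Nonempty → (cutFamily S' {y | y i < b}ᶜ).Nonempty →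
      HasTransport (⋃₀ (cutFamily S {y | y i < a}ᶜ : Set (Set (ι → ℝ))))
      (⋃₀ (cutFamily S' {y | y i < b}ᶜ : Set (Set (ι → ℝ))))) :
    HasTransport (⋃₀ (S : Set (Set (ι → ℝ)))) (⋃₀ (S' : Set (Set (ι → ℝ)))) := by
  have compl : ∀ (R : Finset (Set (ι → ℝ))) (hR : IsBoxFamily R) (c : ℝ),
      volume.real (⋃₀ (R : Set (Set (ι → ℝ))) ∩ {y | y i < c}) =
        θ * volume.real (⋃₀ (R : Set (Set (ι → ℝ)))) →
      volume.real (⋃₀ (R : Set (Set (ι → ℝ))) ∩ {y | y i < c}ᶜ) =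
        (1 - θ) * volume.real (⋃₀ (R : Set (Set (ι → ℝ)))) := by
    intro R hR c hc
    have := measureReal_inter_add_sdiff (μ := volume) (s := ⋃₀ (R : Set (Set (ι → ℝ))))
      (measurableSet_coord_lt i c) hR.volume_lt_top.ne
    rw [Set.sdiff_eq] at this
    linarith
  have ne : ∀ (R : Finset (Set (ι → ℝ))) (H : Set (ι → ℝ)),
      0 < volume.real (⋃₀ (R : Set (Set (ι → ℝ))) ∩ H) → (cutFamily R H).Nonempty := by
    intro R H h
    rw [Finset.nonempty_iff_ne_empty]
    intro he
    rw [← sUnion_cutFamily, he] at h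
    simp at h
  have ha' := compl S hS a ha
  have hb' := compl S' hS' b hb
  have h1' : 0 < 1 - θ := by linarith
  simp only [sUnion_cutFamily] at t1 t2
  refine HasTransport.combine i a b
    (t1 (ne _ _ (by rw [ha]; positivity)) (ne _ _ (by rw [hb]; positivity)))
    (t2 (ne _ _ (by rw [ha']; positivity)) (ne _ _ (by rw [hb']; positivity))) ?_ ?_
  · rw [ha, hb, mul_div_mul_left _ _ h0.ne']
  · rw [ha', hb', mul_div_mul_left _ _ h1'.ne']

/-- Cut along a hyperplane separating two of the boxes: each side loses one of them entirely, so
both cut families are strictly smaller. -/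
lemma IsBoxFamily.exists_cut {S : Finset (Set (ι → ℝ))} (hS : IsBoxFamily S) (h : 1 < S.card) :
    ∃ i a θ, 0 < θ ∧ θ < 1 ∧ volume.real (⋃₀ (S : Set (Set (ι → ℝ))) ∩ {y | y i < a}) =
      θ * volume.real (⋃₀ (S : Set (Set (ι → ℝ)))) ∧
      (cutFamily S {y | y i < a}).card < S.card ∧ (cutFamily S {y | y i < a}ᶜ).card < S.card := by
  obtain ⟨P, hP, Q, hQ, hne⟩ := Finset.one_lt_card.1 h
  obtain ⟨i, a, h⟩ := (hS.box P hP).exists_separating (hS.box Q hQ) (hS.nonempty P hP)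
    (hS.nonempty Q hQ) (hS.disjoint P hP Q hQ hne)
  wlog h' : P ⊆ {y | y i < a} ∧ Q ⊆ {y | y i < a}ᶜ generalizing P Q
  · exact this Q hQ P hP hne.symm h.symm (h.resolve_left h')
  have hpos := hS.volume_real_pos ⟨P, hP⟩
  have m1 : (cutFamily S {y | y i < a}).Nonempty := ⟨P, mem_cutFamily.2
    ⟨⟨P, hP, Set.inter_eq_left.2 h'.1⟩, hS.nonempty P hP⟩⟩
  have m2 : (cutFamily S {y | y i < a}ᶜ).Nonempty := ⟨Q, mem_cutFamily.2
    ⟨⟨Q, hQ, Set.inter_eq_left.2 h'.2⟩, hS.nonempty Q hQ⟩⟩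
  have p1 := (hS.cut (fun A hA => hA.inter_lt i a)).volume_real_pos m1
  have p2 := (hS.cut (fun A hA => hA.inter_ge i a)).volume_real_pos m2
  rw [sUnion_cutFamily] at p1 p2
  have hsum := measureReal_inter_add_sdiff (μ := volume) (s := ⋃₀ (S : Set (Set (ι → ℝ))))
      (measurableSet_coord_lt i a) hS.volume_lt_top.ne
  rw [Set.sdiff_eq] at hsum
  refine ⟨i, a, volume.real (⋃₀ (S : Set (Set (ι → ℝ))) ∩ {y | y i < a}) /
    volume.real (⋃₀ (S : Set (Set (ι → ℝ)))), by positivity, ?_, ?_, ?_, ?_⟩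
  · rw [div_lt_one hpos]; linarith
  · field_simp
  · refine card_cutFamily_lt hQ (Set.disjoint_iff_inter_eq_empty.1 ?_)
    exact Set.disjoint_left.2 fun x hx hx' => h'.2 hx hx'
  · refine card_cutFamily_lt hP (Set.disjoint_iff_inter_eq_empty.1 ?_)
    exact Set.disjoint_left.2 fun x hx hx' => hx' (h'.1 hx)

/-- Induction on the total number of boxes. The family with at least two boxes is cut along a
separating hyperplane and the other one in the same proportion: the first count drops on both sides,
the second does not grow. Two single boxes are the base case. -/
theorem IsBoxFamily.hasTransport {S S' : Finset (Set (ι → ℝ))} (hS : IsBoxFamily S)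
    (hS' : IsBoxFamily S') (hne : S.Nonempty) (hne' : S'.Nonempty) :
    HasTransport (⋃₀ (S : Set (Set (ι → ℝ)))) (⋃₀ (S' : Set (Set (ι → ℝ)))) := by
  obtain ⟨N, hN⟩ : ∃ N, S.card + S'.card ≤ N := ⟨_, le_rfl⟩
  induction N generalizing S S' with
  | zero => have := hne.card_pos; omega
  | succ N ih =>
    have hpos := hS.volume_real_pos hne
    have hpos' := hS'.volume_real_pos hne'
    by_cases h1 : 1 < S.card
    · obtain ⟨i, a, θ, hθ0, hθ1, ha, c1, c2⟩ := hS.exists_cut h1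
      obtain ⟨b, hb⟩ := exists_coord_cut hS'.volume_lt_top hpos' i hθ0 hθ1
      refine HasTransport.of_cut hS hS' i a b hpos hθ0 hθ1 ha hb hpos'
        (fun n1 n2 => ih (hS.cut fun A hA => hA.inter_lt i a) (hS'.cut fun A hA => hA.inter_lt i b)
          n1 n2 ?_)
        (fun n1 n2 => ih (hS.cut fun A hA => hA.inter_ge i a) (hS'.cut fun A hA => hA.inter_ge i b)
          n1 n2 ?_)
      · have := card_cutFamily_le S' {y | y i < b}; omega
      · have := card_cutFamily_le S' {y | y i < b}ᶜ; omega
    by_cases h2 : 1 < S'.card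
    · obtain ⟨i, b, θ, hθ0, hθ1, hb, c1, c2⟩ := hS'.exists_cut h2
      obtain ⟨a, ha⟩ := exists_coord_cut hS.volume_lt_top hpos i hθ0 hθ1
      refine HasTransport.of_cut hS hS' i a b hpos hθ0 hθ1 ha hb hpos'
        (fun n1 n2 => ih (hS.cut fun A hA => hA.inter_lt i a) (hS'.cut fun A hA => hA.inter_lt i b)
          n1 n2 ?_)
        (fun n1 n2 => ih (hS.cut fun A hA => hA.inter_ge i a) (hS'.cut fun A hA => hA.inter_ge i b)
          n1 n2 ?_)
      · have := card_cutFamily_le S {y | y i < a}; omega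
      · have := card_cutFamily_le S {y | y i < a}ᶜ; omega
    · obtain ⟨A, rfl⟩ := Finset.card_eq_one.1 (le_antisymm (not_lt.1 h1) hne.card_pos)
      obtain ⟨B, rfl⟩ := Finset.card_eq_one.1 (le_antisymm (not_lt.1 h2) hne'.card_pos)
      simp only [Finset.coe_singleton, Set.sUnion_singleton]
      have hA := Finset.mem_singleton_self A
      have hB := Finset.mem_singleton_self B
      exact HasTransport.of_boxes (hS.box A hA) (hS'.box B hB) (hS.nonempty A hA)
        (hS'.nonempty B hB)

end Cut

/-! ### Inner approximation of bounded open sets by dyadic cubes -/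

section InnerApproximation

variable {ι : Type*}

/-- The half-open dyadic cube of side `2 ^ (-k)` with index `m`. -/
def dyadicCube (k : ℕ) (m : ι → ℤ) : Set (ι → ℝ) :=
  Set.pi Set.univ (fun i => Set.Ico ((m i : ℝ) / 2 ^ k) (((m i : ℝ) + 1) / 2 ^ k))

lemma mem_dyadicCube {k : ℕ} {m : ι → ℤ} {x : ι → ℝ} :
    x ∈ dyadicCube k m ↔ ∀ i, ⌊x i * 2 ^ k⌋ = m i := by
  simp only [dyadicCube, Set.mem_pi, Set.mem_univ, true_imp_iff, Set.mem_Ico, Int.floor_eq_iff]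
  refine forall_congr' fun i => ?_
  rw [div_le_iff₀ (by positivity), lt_div_iff₀ (by positivity)]

lemma dyadicCube_succ_subset {k : ℕ} (x : ι → ℝ) :
    dyadicCube (k + 1) (fun i => ⌊x i * 2 ^ (k + 1)⌋) ⊆ dyadicCube k (fun i => ⌊x i * 2 ^ k⌋) := by
  intro y hy
  rw [mem_dyadicCube] at hy ⊢
  intro i
  -- The index of the parent cube is half the index of the child, rounded down; hence equal children
  -- have equal parents.
  have h : ∀ t : ℝ, ⌊t * 2 ^ k⌋ = ⌊t * 2 ^ (k + 1)⌋ / 2 := fun t => by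
    have := Int.floor_div_natCast (t * 2 ^ (k + 1)) 2
    rw [← show ((2 : ℕ) : ℤ) = 2 from rfl, ← this]
    congr 1; push_cast; ring
  rw [h, h, hy i]

variable [Fintype ι]

lemma IsOpen.exists_boxFamily {O : Set (ι → ℝ)} (hO : IsOpen O) (hb : Bornology.IsBounded O)
    {c : ENNReal} (hc : c < volume O) :
    ∃ S : Finset (Set (ι → ℝ)), IsBoxFamily S ∧ ⋃₀ (S : Set (Set (ι → ℝ))) ⊆ O ∧
      c < volume (⋃₀ (S : Set (Set (ι → ℝ)))) := by
  classical
  -- `A k` is the union of the dyadic cubes of side `2 ^ (-k)` contained in `O`; these sets increase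
  -- to `O`, so their volumes converge to that of `O`.
  set A : ℕ → Set (ι → ℝ) := fun k => {x | dyadicCube k (fun i => ⌊x i * 2 ^ k⌋) ⊆ O} with hA
  have self : ∀ k (x : ι → ℝ), x ∈ dyadicCube k (fun i => ⌊x i * 2 ^ k⌋) :=
    fun k x => mem_dyadicCube.2 fun i => rfl
  have hmono : Monotone A := monotone_nat_of_le_succ fun k x hx =>
    (dyadicCube_succ_subset x).trans hx
  have hU : ⋃ k, A k = O := by
    refine Set.Subset.antisymm (Set.iUnion_subset fun k x hx => hx (self k x)) fun x hx => ?_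
    obtain ⟨ε, hε, hball⟩ := Metric.isOpen_iff.1 hO x hx
    obtain ⟨k, hk⟩ := exists_pow_lt_of_lt_one hε (show (1 / 2 : ℝ) < 1 by norm_num)
    refine Set.mem_iUnion.2 ⟨k, fun y hy => hball ?_⟩
    rw [Metric.mem_ball]
    refine lt_of_le_of_lt ((dist_pi_le_iff (by positivity)).2 fun i => ?_) hk
    have h1 := hy i trivial
    have h2 := self k x i trivial
    simp only [Set.mem_Ico] at h1 h2
    rw [add_div] at h1 h2
    rw [Real.dist_eq, abs_le, one_div, inv_pow, ← one_div]
    constructor <;> linarith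
  have hlim := tendsto_measure_iUnion_atTop (μ := volume) hmono
  rw [hU] at hlim
  obtain ⟨k, hk⟩ := (hlim.eventually (eventually_gt_nhds hc)).exists
  obtain ⟨R, hR⟩ := hb.subset_closedBall 0
  have hfin : {m : ι → ℤ | dyadicCube k m ⊆ O}.Finite := by
    refine (Set.Finite.pi' (ι := ι) (t := fun _ => Set.Icc (-⌈R * 2 ^ k⌉) ⌈R * 2 ^ k⌉)
      fun _ => Set.finite_Icc _ _).subset fun m hm i => ?_
    have hx : (fun i => (m i : ℝ) / 2 ^ k) ∈ dyadicCube k m := mem_dyadicCube.2 fun i => by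
      rw [div_mul_cancel₀ _ (by positivity)]; exact Int.floor_intCast _
    have h1 := mem_closedBall_zero_iff.1 (hR (hm hx))
    have h2 := (norm_le_pi_norm _ i).trans h1
    rw [Real.norm_eq_abs, abs_le, div_le_iff₀ (by positivity), le_div_iff₀ (by positivity)] at h2
    have h3 := Int.le_ceil (R * 2 ^ k)
    constructor
    · have : ((-⌈R * 2 ^ k⌉ : ℤ) : ℝ) ≤ m i := by push_cast; linarith
      exact_mod_cast this
    · have : (m i : ℝ) ≤ (⌈R * 2 ^ k⌉ : ℤ) := by linarith
      exact_mod_cast this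
  have hS : ⋃₀ ((hfin.toFinset.image (dyadicCube k) : Finset (Set (ι → ℝ))) :
      Set (Set (ι → ℝ))) = A k := by
    ext x
    simp only [Finset.coe_image, Set.sUnion_image, Set.mem_iUnion, Set.Finite.coe_toFinset,
      Set.mem_ofPred_eq, hA, exists_prop]
    constructor
    · rintro ⟨m, hm, hx⟩
      have : (fun i => ⌊x i * 2 ^ k⌋) = m := funext (mem_dyadicCube.1 hx)
      rwa [this]
    · intro h
      exact ⟨_, h, self k x⟩
  refine ⟨hfin.toFinset.image (dyadicCube k), ⟨?_, ?_, ?_⟩, ?_, ?_⟩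
  · intro B hB
    obtain ⟨m, -, rfl⟩ := Finset.mem_image.1 hB
    exact ⟨_, _, rfl⟩
  · intro B hB
    obtain ⟨m, -, rfl⟩ := Finset.mem_image.1 hB
    refine ⟨fun i => (m i : ℝ) / 2 ^ k, mem_dyadicCube.2 fun i => ?_⟩
    rw [div_mul_cancel₀ _ (by positivity)]; exact Int.floor_intCast _
  · intro B hB B' hB' hne
    obtain ⟨m, -, rfl⟩ := Finset.mem_image.1 hB
    obtain ⟨m', -, rfl⟩ := Finset.mem_image.1 hB'
    refine Set.disjoint_left.2 fun x hx hx' => hne ?_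
    rw [show m = m' from funext fun i =>
      (mem_dyadicCube.1 hx i).symm.trans (mem_dyadicCube.1 hx' i)]
  · rw [hS, ← hU]; exact Set.subset_iUnion A k
  · rw [hS]; exact hk

end InnerApproximation

/-! ### From transport to a dimension-free volume inequality -/

section Dilation

variable {ι : Type*} [Fintype ι]

/-- Fubini on pairs `(y, s)` with `s ∈ [0, h]` whose interpolated point lies in `G`: each trajectory
contributes time at least `h - δ`, and each time contributes mass at most `ρ ^ s * |G| ≤ ρ ^ h *
|G|`. -/
lemma HasTransport.measure_le {A B G : Set (ι → ℝ)} (hT : HasTransport A B)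
    (hA : MeasurableSet A) (hG : MeasurableSet G) {h δ ρ : ℝ} (h1 : h ≤ 1) (hδ : 0 ≤ δ)
    (hρ : volume.real A / volume.real B ≤ ρ) (hρ1 : 1 ≤ ρ)
    (H : ∀ y ∈ A, ∀ x ∈ B,
      volume {s ∈ Set.Icc 0 h | (1 - s) • y + s • x ∉ G} ≤ ENNReal.ofReal δ) :
    ENNReal.ofReal (h - δ) * volume A ≤
      ENNReal.ofReal h * (ENNReal.ofReal (ρ ^ h) * volume G) := by
  obtain ⟨T, hTm, hTB, hTe⟩ := hT
  set E : Set ((ι → ℝ) × ℝ) := {p | (1 - p.2) • p.1 + p.2 • T p.1 ∈ G} with hE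
  have hEm : MeasurableSet E := by
    have : Measurable (fun p : (ι → ℝ) × ℝ => (1 - p.2) • p.1 + p.2 • T p.1) := by fun_prop
    exact this hG
  set ν := (volume.restrict A).prod ((volume : Measure ℝ).restrict (Set.Icc 0 h)) with hν
  have lower : ENNReal.ofReal (h - δ) * volume A ≤ ν E := by
    rw [hν, Measure.prod_apply hEm]
    refine le_trans ?_ (setLIntegral_mono' (g := fun y => _) hA
      (f := fun _ => ENNReal.ofReal (h - δ)) fun y hy => ?_)
    · rw [setLIntegral_const]
    · rw [Measure.restrict_apply (measurable_prodMk_left hEm)]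
      rw [ENNReal.ofReal_sub _ hδ, tsub_le_iff_right]
      have hv : volume (Set.Icc 0 h) = ENNReal.ofReal h := by simp
      rw [← hv]
      refine (measure_mono ?_).trans ((measure_union_le _ _).trans
        (add_le_add le_rfl (H y hy (T y) (hTB y hy))))
      intro s hs
      by_cases hsG : (1 - s) • y + s • T y ∈ G
      · exact Or.inl ⟨hsG, hs⟩
      · exact Or.inr ⟨hs, hsG⟩
  have upper : ν E ≤ ENNReal.ofReal h * (ENNReal.ofReal (ρ ^ h) * volume G) := by
    rw [hν, Measure.prod_apply_symm hEm]
    refine (setLIntegral_mono' (g := fun _ => ENNReal.ofReal (ρ ^ h) * volume G)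
      measurableSet_Icc fun s hs => ?_).trans ?_
    · rw [Measure.restrict_apply (measurable_prodMk_right hEm), Set.inter_comm]
      refine (hTe s ⟨hs.1, hs.2.trans h1⟩ G hG).trans ?_
      gcongr
      calc (volume.real A / volume.real B) ^ s ≤ ρ ^ s :=
            Real.rpow_le_rpow (by positivity) hρ hs.1
        _ ≤ ρ ^ h := Real.rpow_le_rpow_of_exponent_le hρ1 hs.2
    · rw [setLIntegral_const, mul_comm]; simp
  exact lower.trans upper

/-- If the segments from `O` to `U` mostly stay in `G` near their end in `U`, then the measure of
`G` is bounded from below, independently of the dimension. -/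
theorem measureReal_le_of_segments {U O G : Set (ι → ℝ)} (hU : IsOpen U) (hO : IsOpen O)
    (hUb : Bornology.IsBounded U) (hOU : O ⊆ U) (hO0 : O.Nonempty) (hG : MeasurableSet G)
    (hGf : volume G ≠ ⊤) {h δ : ℝ} (h0 : 0 < h) (h1 : h ≤ 1) (hδ0 : 0 ≤ δ)
    (hδ : δ < h)
    (H : ∀ y ∈ U, ∀ x ∈ O,
      volume {s ∈ Set.Icc 0 h | (1 - s) • y + s • x ∉ G} ≤ ENNReal.ofReal δ) :
    (h - δ) * volume.real U ≤ h * ((volume.real U / volume.real O) ^ h * volume.real G) := by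
  have hUf : volume U < ⊤ := hUb.measure_lt_top
  have hOf : volume O < ⊤ := (measure_mono hOU).trans_lt hUf
  have hOp : 0 < volume.real O := ENNReal.toReal_pos (hO.measure_pos _ hO0).ne' hOf.ne
  have hUO : volume.real O ≤ volume.real U := measureReal_mono hOU hUf.ne
  have hUp : 0 < volume.real U := hOp.trans_le hUO
  -- Box families inside `U` and `O` of volume above `a` and `b` give the estimate with `a`, `b` in
  -- place of the volumes; then `a` and `b` tend to `|U|` and `|O|` from below.
  have step : ∀ a ∈ Set.Ioo 0 (volume.real U), ∀ b ∈ Set.Ioo 0 (volume.real O),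
      (h - δ) * a ≤ h * ((volume.real U / b) ^ h * volume.real G) := by
    intro a ha b hb
    obtain ⟨S, hS, hSU, hSa⟩ := hU.exists_boxFamily hUb (c := ENNReal.ofReal a)
      ((ENNReal.ofReal_lt_iff_lt_toReal ha.1.le hUf.ne).2 ha.2)
    obtain ⟨S', hS', hSO, hSb⟩ := hO.exists_boxFamily (hUb.subset hOU) (c := ENNReal.ofReal b)
      ((ENNReal.ofReal_lt_iff_lt_toReal hb.1.le hOf.ne).2 hb.2)
    have ne : ∀ (R : Finset (Set (ι → ℝ))) (t : ENNReal),
        t < volume (⋃₀ (R : Set (Set (ι → ℝ)))) → R.Nonempty := by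
      intro R t ht
      rw [Finset.nonempty_iff_ne_empty]
      rintro rfl
      simp at ht
    have ha' : a < volume.real (⋃₀ (S : Set (Set (ι → ℝ)))) :=
      (ENNReal.ofReal_lt_iff_lt_toReal ha.1.le hS.volume_lt_top.ne).1 hSa
    have hb' : b < volume.real (⋃₀ (S' : Set (Set (ι → ℝ)))) :=
      (ENNReal.ofReal_lt_iff_lt_toReal hb.1.le hS'.volume_lt_top.ne).1 hSb
    have key := (hS.hasTransport hS' (ne _ _ hSa) (ne _ _ hSb)).measure_le hS.measurableSet hG
      (δ := δ) (ρ := volume.real U / b) h1 hδ0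
      (div_le_div₀ hUp.le (measureReal_mono hSU hUf.ne) hb.1 hb'.le)
      (by rw [one_le_div hb.1]; exact hb.2.le.trans hUO)
      (fun y hy x hx => H y (hSU hy) x (hSO hx))
    have key2 := ENNReal.toReal_mono (by finiteness) key
    simp only [ENNReal.toReal_mul] at key2
    rw [ENNReal.toReal_ofReal (by linarith), ENNReal.toReal_ofReal h0.le,
      ENNReal.toReal_ofReal (Real.rpow_nonneg (div_nonneg hUp.le hb.1.le) _)] at key2
    refine le_trans ?_ key2
    exact mul_le_mul_of_nonneg_left ha'.le (by linarith)
  have step2 : ∀ b ∈ Set.Ioo 0 (volume.real O),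
      (h - δ) * volume.real U ≤ h * ((volume.real U / b) ^ h * volume.real G) := by
    intro b hb
    have hl : Filter.Tendsto (fun a => (h - δ) * a) (nhdsWithin (volume.real U)
        (Set.Iio (volume.real U))) (nhds ((h - δ) * volume.real U)) :=
      ((continuous_const.mul continuous_id).tendsto _).mono_left nhdsWithin_le_nhds
    refine le_of_tendsto hl ?_
    filter_upwards [Ioo_mem_nhdsLT hUp] with a ha using step a ha b hb
  have hc : ContinuousAt (fun b => h * ((volume.real U / b) ^ h * volume.real G))
      (volume.real O) := by
    refine continuousAt_const.mul (ContinuousAt.mul ?_ continuousAt_const)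
    exact (continuousAt_const.div continuousAt_id hOp.ne').rpow_const
      (Or.inr h0.le)
  refine ge_of_tendsto
    (hc.tendsto.mono_left (nhdsWithin_le_nhds (s := Set.Iio (volume.real O)))) ?_
  filter_upwards [Ioo_mem_nhdsLT hOp] with b hb using step2 b hb

end Dilation

/-! ### Exponential decay of superlevel sets and reverse Hölder -/

section ReverseHolder

/-- The dimension-free constant of the reverse Hölder inequality. -/
noncomputable def reverseHolderConst (K s : ℕ) : ℝ :=
  4 * (∑' j : ℕ, (8 * ((j : ℝ) + 1)) ^ (K * s) * (1 / 2) ^ j) ^ (1 / (s : ℝ))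

lemma summable_reverseHolder (m : ℕ) :
    Summable fun j : ℕ => (8 * ((j : ℝ) + 1)) ^ m * (1 / 2) ^ j := by
  have h := summable_pow_mul_geometric_of_norm_lt_one (R := ℝ) m (r := 1 / 2) (by norm_num)
  have h2 := ((summable_nat_add_iff 1).2 h).mul_left (8 ^ m * 2)
  refine h2.congr fun j => ?_
  push_cast
  rw [mul_pow, pow_succ]
  ring

variable {n : ℕ}

/-- The distributional form of the inequality of `measureReal_le_of_segments`
in Euclidean space. -/
lemma measureReal_superlevel_le {U : Set (EuclideanSpace ℝ (Fin n))} (hU : IsOpen U)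
    (hUc : Convex ℝ U) (hUb : Bornology.IsBounded U)
    {φ : EuclideanSpace ℝ (Fin n) → ℝ} (hφ : ContinuousOn φ U) {l t : ℝ}
    (hG : volume.real {x ∈ U | l < φ x} ≤ volume.real U / 4) {j : ℕ} (hj : 1 ≤ j)
    (H : ∀ y ∈ U, ∀ x ∈ U, t < φ x →
      volume {s ∈ Set.Icc (0 : ℝ) 1 | φ ((1 - s) • y + s • x) ≤ l} ≤
        ENNReal.ofReal (1 / (2 * j))) :
    volume.real {x ∈ U | t < φ x} ≤ (1 / 2) ^ j * volume.real U := by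
  have hop : ∀ c, IsOpen {x ∈ U | c < φ x} := fun c =>
    hφ.isOpen_inter_preimage hU isOpen_Ioi
  rcases Set.eq_empty_or_nonempty {x ∈ U | t < φ x} with h0 | h0
  · rw [h0]; simp
  have hj' : (1 : ℝ) ≤ j := by exact_mod_cast hj
  have hc : Continuous (WithLp.toLp 2 : (Fin n → ℝ) → EuclideanSpace ℝ (Fin n)) :=
    PiLp.continuous_toLp 2 _
  have hvol : ∀ X : Set (EuclideanSpace ℝ (Fin n)), IsOpen X →
      volume (WithLp.toLp 2 ⁻¹' X : Set (Fin n → ℝ)) = volume X := fun X hX =>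
    (PiLp.volume_preserving_toLp (Fin n)).measure_preimage hX.measurableSet.nullMeasurableSet
  have hvolr : ∀ X : Set (EuclideanSpace ℝ (Fin n)), IsOpen X →
      volume.real (WithLp.toLp 2 ⁻¹' X : Set (Fin n → ℝ)) = volume.real X := fun X hX => by
    rw [measureReal_def, hvol X hX, measureReal_def]
  have hbdd : Bornology.IsBounded (WithLp.toLp 2 ⁻¹' U : Set (Fin n → ℝ)) := by
    refine ((PiLp.lipschitzWith_ofLp 2 (fun _ : Fin n => ℝ)).isBounded_image hUb).subset ?_
    intro x hx
    exact ⟨WithLp.toLp 2 x, hx, rfl⟩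
  have hUf : volume U < ⊤ := hUb.measure_lt_top
  have hOp : 0 < volume.real {x ∈ U | t < φ x} :=
    ENNReal.toReal_pos ((hop t).measure_pos _ h0).ne' ((measure_mono (fun x hx => hx.1)).trans_lt hUf).ne
  have hUp : 0 < volume.real U := hOp.trans_le (measureReal_mono (fun x hx => hx.1) hUf.ne)
  -- Stopping at time `1 / j` is the point: the bad time `1 / (2 * j)` is then half of the total,
  -- while the density bound is only the `j`-th root of `|U| / |O|`.
  have key := measureReal_le_of_segments (U := WithLp.toLp 2 ⁻¹' U)
    (O := WithLp.toLp 2 ⁻¹' {x ∈ U | t < φ x}) (G := WithLp.toLp 2 ⁻¹' {x ∈ U | l < φ x})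
    (hU.preimage hc) ((hop t).preimage hc) hbdd (fun x hx => hx.1)
    (by obtain ⟨x, hx⟩ := h0; exact ⟨WithLp.ofLp x, hx⟩)
    ((hop l).preimage hc).measurableSet
    (by rw [hvol _ (hop l)]; exact ((measure_mono (fun x hx => hx.1)).trans_lt hUf).ne)
    (h := 1 / j) (δ := 1 / (2 * j)) (by positivity)
    (by rw [div_le_one (by positivity)]; exact hj') (by positivity)
    (by gcongr; linarith)
    (by
      intro y hy x hx
      refine (measure_mono ?_).trans (H _ hy _ hx.1 hx.2)
      rintro s ⟨hs, hsG⟩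
      have hs1 : s ∈ Set.Icc (0 : ℝ) 1 :=
        ⟨hs.1, hs.2.trans (by rw [div_le_one (by positivity)]; exact hj')⟩
      refine ⟨hs1, ?_⟩
      by_contra hcon
      exact hsG ⟨hUc hy hx.1 (sub_nonneg.2 hs1.2) hs1.1 (by ring), not_le.1 hcon⟩)
  rw [hvolr _ hU, hvolr _ (hop t), hvolr _ (hop l)] at key
  set u := volume.real U
  set o := volume.real {x ∈ U | t < φ x}
  have h1 : (2 : ℝ) ≤ (u / o) ^ (1 / (j : ℝ)) := by
    have h2 : (u / o) ^ (1 / (j : ℝ)) * volume.real {x ∈ U | l < φ x} ≤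
        (u / o) ^ (1 / (j : ℝ)) * (u / 4) :=
      mul_le_mul_of_nonneg_left hG (Real.rpow_nonneg (by positivity) _)
    have h3 : (1 / (j : ℝ) - 1 / (2 * j)) * u = 1 / (j : ℝ) * (u / 2) := by field_simp; ring
    rw [h3] at key
    have h4 := le_of_mul_le_mul_left key (by positivity)
    have h5 : u * 2 ≤ u * (u / o) ^ (1 / (j : ℝ)) := by linarith
    exact le_of_mul_le_mul_left h5 hUp
  have h2 : (2 : ℝ) ^ j ≤ u / o := by
    calc (2 : ℝ) ^ j ≤ ((u / o) ^ (1 / (j : ℝ))) ^ j := pow_le_pow_left₀ (by norm_num) h1 j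
      _ = u / o := by
        rw [one_div, Real.rpow_inv_natCast_pow (by positivity) (by omega)]
  rw [le_div_iff₀ hOp] at h2
  rw [one_div, inv_pow, inv_mul_eq_div, le_div_iff₀ (by positivity)]
  linarith

/-- A discrete layer-cake bound with thresholds `l * (8 * j) ^ K`: the last threshold passed by `c`
contributes a term that already dominates `c ^ s`, and the constant term covers the values below the
threshold `j = 1`. -/
lemma pow_le_sum_indicator {K : ℕ} {l c : ℝ} (hl : 0 < l) (hc : 0 ≤ c) (s : ℕ) {J : ℕ}
    (hJ : c ≤ l * (8 * ((J : ℝ) + 1)) ^ K) :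
    c ^ s ≤ (l * 8 ^ K) ^ s + ∑ j ∈ Finset.Icc 1 J,
      (Set.Ioi (l * (8 * (j : ℝ)) ^ K)).indicator (fun _ => (l * (8 * ((j : ℝ) + 1)) ^ K) ^ s) c := by
  have nn : ∀ j : ℕ, 0 ≤ (Set.Ioi (l * (8 * (j : ℝ)) ^ K)).indicator
      (fun _ => (l * (8 * ((j : ℝ) + 1)) ^ K) ^ s) c := fun j =>
    Set.indicator_nonneg (fun _ _ => by positivity) _
  induction J with
  | zero =>
    simp only [Nat.cast_zero, zero_add, mul_one] at hJ
    simpa using pow_le_pow_left₀ hc hJ s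
  | succ J ih =>
    rw [Finset.sum_Icc_succ_top (by omega)]
    by_cases h : c ≤ l * (8 * ((J : ℝ) + 1)) ^ K
    · have := ih h
      have := nn (J + 1)
      linarith
    · have hm : c ∈ Set.Ioi (l * (8 * ((J + 1 : ℕ) : ℝ)) ^ K) := by
        push_cast; exact not_le.1 h
      rw [Set.indicator_of_mem hm]
      have h1 := pow_le_pow_left₀ hc hJ s
      have h2 : 0 ≤ (l * 8 ^ K) ^ s := by positivity
      have h3 := Finset.sum_nonneg (s := Finset.Icc 1 J) fun j _ => nn j
      linarith

/-- The superlevel set at `l * (8 * j) ^ K` has measure at most `2 ^ (-j) * |U|`, so the layers of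
`φ ^ s` sum to a convergent series depending on `K * s` only. -/
theorem reverse_holder {U : Set (EuclideanSpace ℝ (Fin n))} (hU : IsOpen U)
    (hUc : Convex ℝ U) (hUb : Bornology.IsBounded U) (hU0 : U.Nonempty)
    {φ : EuclideanSpace ℝ (Fin n) → ℝ} (hφ : ContinuousOn φ U) (hφ0 : ∀ x, 0 ≤ φ x)
    {M : ℝ} (hM : ∀ x ∈ U, φ x ≤ M) {K : ℕ} (hK : 1 ≤ K)
    (H : ∀ y ∈ U, ∀ x ∈ U, ∀ l : ℝ, 0 < l → ∀ j : ℕ, 1 ≤ j → l * (8 * (j : ℝ)) ^ K < φ x →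
      volume {s ∈ Set.Icc (0 : ℝ) 1 | φ ((1 - s) • y + s • x) ≤ l} ≤
        ENNReal.ofReal (1 / (2 * j))) {s : ℕ} (hs : 1 ≤ s) :
    (1 / volume.real U * ∫ x in U, φ x ^ s) ^ (1 / (s : ℝ)) ≤
      reverseHolderConst K s * (1 / volume.real U * ∫ x in U, φ x) := by
  have hUf : volume U < ⊤ := hUb.measure_lt_top
  have hUp : 0 < volume.real U := ENNReal.toReal_pos (hU.measure_pos _ hU0).ne' hUf.ne
  have hop : ∀ c, IsOpen {x ∈ U | c < φ x} := fun c =>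
    hφ.isOpen_inter_preimage hU isOpen_Ioi
  have hint : IntegrableOn φ U := by
    refine IntegrableOn.of_bound hUf (hφ.aestronglyMeasurable hU.measurableSet) M ?_
    filter_upwards [ae_restrict_mem hU.measurableSet] with x hx
    rw [Real.norm_of_nonneg (hφ0 x)]; exact hM x hx
  set u := volume.real U with hu
  set m := 1 / u * ∫ x in U, φ x with hm
  have hI0 : 0 ≤ ∫ x in U, φ x := integral_nonneg hφ0
  have hm0 : 0 ≤ m := by positivity
  have hs0 : (s : ℝ) ≠ 0 := by positivity
  rcases hm0.eq_or_lt with h0 | hmpos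
  · have hI : ∫ x in U, φ x = 0 := by
      rcases mul_eq_zero.1 h0.symm with h | h
      · exact absurd h (by positivity)
      · exact h
    have hae := (integral_eq_zero_iff_of_nonneg hφ0 hint).1 hI
    have : ∫ x in U, φ x ^ s = 0 := by
      refine integral_eq_zero_of_ae ?_
      filter_upwards [hae] with x hx
      simp only [Pi.zero_apply] at hx ⊢
      rw [hx, zero_pow (by omega)]
    rw [this, ← h0, mul_zero, mul_zero, Real.zero_rpow (by positivity)]
  -- Four times the mean, so that Markov's inequality leaves the set above `l` at most a quarter of
  -- the volume.
  set l := 4 * m with hl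
  have hlpos : 0 < l := by positivity
  have hG : volume.real {x ∈ U | l < φ x} ≤ u / 4 := by
    have h1 : l * (volume.restrict U).real {x | l ≤ φ x} ≤ ∫ x in U, φ x :=
      mul_meas_ge_le_integral_of_nonneg (Filter.Eventually.of_forall hφ0) hint l
    have h2 : volume.real {x ∈ U | l < φ x} ≤ (volume.restrict U).real {x | l ≤ φ x} := by
      have : (volume.restrict U) {x ∈ U | l < φ x} = volume {x ∈ U | l < φ x} := by
        rw [Measure.restrict_apply (hop l).measurableSet]
        congr 1; ext x; simp; tauto
      rw [measureReal_def, ← this, ← measureReal_def]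
      have : IsFiniteMeasure (volume.restrict U) := ⟨by simpa using hUf⟩
      exact measureReal_mono (fun x hx => hx.2.le)
    have h3 : ∫ x in U, φ x = m * u := by rw [hm]; field_simp
    rw [h3] at h1
    have h4 : l * volume.real {x ∈ U | l < φ x} ≤ l * (u / 4) := by
      calc l * volume.real {x ∈ U | l < φ x} ≤ _ := mul_le_mul_of_nonneg_left h2 hlpos.le
        _ ≤ m * u := h1
        _ = l * (u / 4) := by rw [hl]; ring
    exact le_of_mul_le_mul_left h4 hlpos
  have htail : ∀ j : ℕ, 1 ≤ j →
      volume.real {x ∈ U | l * (8 * (j : ℝ)) ^ K < φ x} ≤ (1 / 2) ^ j * u := by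
    intro j hj
    exact measureReal_superlevel_le hU hUc hUb hφ hG hj
      fun y hy x hx hxt => H y hy x hx l hlpos j hj hxt
  -- Boundedness of `φ` makes the layer sum finite; the final constant does not see `J`.
  obtain ⟨J, hJ⟩ : ∃ J : ℕ, M ≤ l * (8 * ((J : ℝ) + 1)) ^ K := by
    obtain ⟨J, hJ⟩ := exists_nat_ge (M / l)
    refine ⟨J, ?_⟩
    rw [div_le_iff₀ hlpos, mul_comm] at hJ
    refine hJ.trans (mul_le_mul_of_nonneg_left ?_ hlpos.le)
    calc (J : ℝ) ≤ 8 * ((J : ℝ) + 1) := by have : (0 : ℝ) ≤ J := by positivity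
                                           linarith
      _ ≤ _ := le_self_pow₀ (by have : (0 : ℝ) ≤ J := by positivity
                                linarith) (by omega)
  set S := ∑' j : ℕ, (8 * ((j : ℝ) + 1)) ^ (K * s) * (1 / 2) ^ j with hS
  have hS0 : 0 ≤ S := tsum_nonneg fun j => by positivity
  have hmain : ∫ x in U, φ x ^ s ≤ l ^ s * S * u := by
    set ψ : ℕ → EuclideanSpace ℝ (Fin n) → ℝ := fun j =>
      {x ∈ U | l * (8 * (j : ℝ)) ^ K < φ x}.indicator
        (fun _ => (l * (8 * ((j : ℝ) + 1)) ^ K) ^ s) with hψ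
    have hψi : ∀ j, IntegrableOn (ψ j) U := fun j =>
      (integrableOn_const hUf.ne).indicator (hop _).measurableSet
    have hle : ∀ x ∈ U, φ x ^ s ≤ (l * 8 ^ K) ^ s + ∑ j ∈ Finset.Icc 1 J, ψ j x := by
      intro x hx
      refine (pow_le_sum_indicator hlpos (hφ0 x) s ((hM x hx).trans hJ)).trans (le_of_eq ?_)
      congr 1
      refine Finset.sum_congr rfl fun j _ => ?_
      by_cases h : l * (8 * (j : ℝ)) ^ K < φ x
      · rw [Set.indicator_of_mem (by exact h)]
        exact (Set.indicator_of_mem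
          (show x ∈ {x ∈ U | l * (8 * (j : ℝ)) ^ K < φ x} from ⟨hx, h⟩)
          (fun _ => (l * (8 * ((j : ℝ) + 1)) ^ K) ^ s)).symm
      · rw [Set.indicator_of_notMem (by exact h)]
        exact (Set.indicator_of_notMem
          (show x ∉ {x ∈ U | l * (8 * (j : ℝ)) ^ K < φ x} from fun h' => h h'.2)
          (fun _ => (l * (8 * ((j : ℝ) + 1)) ^ K) ^ s)).symm
    have hφs : IntegrableOn (fun x => φ x ^ s) U := by
      refine IntegrableOn.of_bound hUf ((hφ.pow s).aestronglyMeasurable hU.measurableSet)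
        (M ^ s) ?_
      filter_upwards [ae_restrict_mem hU.measurableSet] with x hx
      rw [Real.norm_of_nonneg (pow_nonneg (hφ0 x) s)]
      exact pow_le_pow_left₀ (hφ0 x) (hM x hx) s
    have hC : IntegrableOn (fun _ : EuclideanSpace ℝ (Fin n) => (l * 8 ^ K) ^ s) U :=
      integrableOn_const hUf.ne
    have h1 := setIntegral_mono_on hφs (hC.add
      (integrable_finsetSum (Finset.Icc 1 J) fun j _ => hψi j)) hU.measurableSet hle
    refine h1.trans ?_
    simp only [Pi.add_apply]
    rw [integral_add hC
      (integrable_finsetSum _ fun j _ => hψi j), setIntegral_const,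
      integral_finsetSum _ fun j _ => hψi j]
    have h2 : ∀ j ∈ Finset.Icc 1 J, ∫ x in U, ψ j x ≤
        l ^ s * u * ((8 * ((j : ℝ) + 1)) ^ (K * s) * (1 / 2) ^ j) := by
      intro j hj
      rw [hψ, setIntegral_indicator (hop _).measurableSet, setIntegral_const]
      have : U ∩ {x ∈ U | l * (8 * (j : ℝ)) ^ K < φ x} = {x ∈ U | l * (8 * (j : ℝ)) ^ K < φ x} :=
        Set.inter_eq_right.2 fun x hx => hx.1
      rw [this, smul_eq_mul]
      refine (mul_le_mul_of_nonneg_right (htail j (Finset.mem_Icc.1 hj).1) (by positivity)).trans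
        (le_of_eq ?_)
      rw [mul_pow, pow_mul]
      ring
    have h3 : volume.real U • (l * 8 ^ K) ^ s =
        l ^ s * u * ((8 * (((0 : ℕ) : ℝ) + 1)) ^ (K * s) * (1 / 2) ^ 0) := by
      simp only [smul_eq_mul, Nat.cast_zero, zero_add, mul_one, pow_zero]
      rw [mul_pow, pow_mul]; ring
    rw [h3]
    refine (add_le_add le_rfl (Finset.sum_le_sum h2)).trans ?_
    rw [← Finset.mul_sum, ← mul_add, mul_right_comm (l ^ s) S u]
    refine mul_le_mul_of_nonneg_left ?_ (by positivity)
    have h4 := (summable_reverseHolder (K * s)).sum_le_tsum (Finset.range (J + 1))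
      (fun j _ => by positivity)
    refine le_trans (le_of_eq ?_) h4
    rw [Finset.range_eq_Ico, Finset.sum_eq_sum_Ico_succ_bot (by omega)]
    rfl
  have h1 : 1 / u * ∫ x in U, φ x ^ s ≤ l ^ s * S := by
    rw [one_div, inv_mul_le_iff₀ hUp]
    linarith
  have hnn : 0 ≤ 1 / u * ∫ x in U, φ x ^ s :=
    mul_nonneg (by positivity) (integral_nonneg fun x => pow_nonneg (hφ0 x) s)
  refine (Real.rpow_le_rpow hnn h1 (by positivity)).trans (le_of_eq ?_)
  rw [Real.mul_rpow (by positivity) hS0, one_div, Real.pow_rpow_inv_natCast hlpos.le (by omega),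
    reverseHolderConst, ← hS, hl, one_div]
  ring

end ReverseHolder

/-! ### The disk algebra as a Banach algebra, and its backward shift -/

section DiskAlgebra

open Metric

/-- The disk algebra: functions continuous on the closed unit disk, holomorphic in its interior. -/
noncomputable def diskAlgebra : Subalgebra ℂ C(closedBall (0 : ℂ) 1, ℂ) where
  carrier := {F | ∃ f : ℂ → ℂ, DiffContOnCl ℂ f (ball 0 1) ∧ ∀ w, F w = f w}
  mul_mem' := by
    rintro F G ⟨f, hf, hF⟩ ⟨g, hg, hG⟩
    exact ⟨fun w => f w * g w, hf.smul hg, fun w => by simp [hF, hG]⟩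
  add_mem' := by
    rintro F G ⟨f, hf, hF⟩ ⟨g, hg, hG⟩
    exact ⟨fun w => f w + g w, hf.add hg, fun w => by simp [hF, hG]⟩
  algebraMap_mem' := fun c => ⟨fun _ => c, diffContOnCl_const, fun w => by simp⟩

/-- The type of elements of the disk algebra. -/
def DiskAlg : Type := diskAlgebra

noncomputable instance : NormedCommRing DiskAlg := inferInstanceAs (NormedCommRing diskAlgebra)

noncomputable instance : NormedAlgebra ℂ DiskAlg := inferInstanceAs (NormedAlgebra ℂ diskAlgebra)

namespace DiskAlg

open Classical in
/-- The value at `w`, meaningful for `‖w‖ ≤ 1`. -/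
noncomputable def eval (F : DiskAlg) (w : ℂ) : ℂ :=
  if h : w ∈ closedBall (0 : ℂ) 1 then F.1 ⟨w, h⟩ else 0

lemma eval_of_le (F : DiskAlg) {w : ℂ} (hw : ‖w‖ ≤ 1) :
    F.eval w = F.1 ⟨w, mem_closedBall_zero_iff.2 hw⟩ := by
  rw [eval, dif_pos]

@[simp] lemma eval_add (F G : DiskAlg) (w : ℂ) : (F + G).eval w = F.eval w + G.eval w := by
  by_cases h : w ∈ closedBall (0 : ℂ) 1
  · simp only [eval, dif_pos h]; rfl
  · simp only [eval, dif_neg h, add_zero]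

@[simp] lemma eval_sub (F G : DiskAlg) (w : ℂ) : (F - G).eval w = F.eval w - G.eval w := by
  by_cases h : w ∈ closedBall (0 : ℂ) 1
  · simp only [eval, dif_pos h]; rfl
  · simp only [eval, dif_neg h, sub_zero]

@[simp] lemma eval_mul (F G : DiskAlg) (w : ℂ) : (F * G).eval w = F.eval w * G.eval w := by
  by_cases h : w ∈ closedBall (0 : ℂ) 1
  · simp only [eval, dif_pos h]; rfl
  · simp only [eval, dif_neg h, mul_zero]

@[simp] lemma eval_smul (c : ℂ) (F : DiskAlg) (w : ℂ) : (c • F).eval w = c * F.eval w := by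
  by_cases h : w ∈ closedBall (0 : ℂ) 1
  · rw [eval, eval, dif_pos h, dif_pos h]; rfl
  · rw [eval, eval, dif_neg h, dif_neg h, mul_zero]

lemma norm_eval_le (F : DiskAlg) (w : ℂ) : ‖F.eval w‖ ≤ ‖F‖ := by
  by_cases h : w ∈ closedBall (0 : ℂ) 1
  · rw [eval, dif_pos h]; exact F.1.norm_coe_le_norm _
  · rw [eval, dif_neg h, norm_zero]; exact norm_nonneg F

lemma norm_le {F : DiskAlg} {C : ℝ} (hC : 0 ≤ C) (h : ∀ w, ‖w‖ ≤ 1 → ‖F.eval w‖ ≤ C) :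
    ‖F‖ ≤ C := by
  refine (ContinuousMap.norm_le F.1 hC).2 fun w => ?_
  have hw := mem_closedBall_zero_iff.1 w.2
  have := h w hw
  rwa [eval_of_le F hw] at this

lemma ext_eval {F G : DiskAlg} (h : ∀ w, ‖w‖ ≤ 1 → F.eval w = G.eval w) : F = G := by
  refine Subtype.ext (ContinuousMap.ext fun w => ?_)
  have hw := mem_closedBall_zero_iff.1 w.2
  have := h w hw
  rwa [eval_of_le F hw, eval_of_le G hw] at this

lemma diffContOnCl (F : DiskAlg) : DiffContOnCl ℂ F.eval (ball 0 1) := by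
  obtain ⟨f, hf, hF⟩ := F.2
  have h : ∀ w ∈ closedBall (0 : ℂ) 1, F.eval w = f w := fun w hw => by
    rw [eval, dif_pos hw, hF]
  refine DiffContOnCl.mk_ball (hf.differentiableOn.congr fun w hw => h w (ball_subset_closedBall hw))
    (hf.continuousOn_ball.congr h)

/-- The element of the disk algebra given by a function. -/
noncomputable def mk (f : ℂ → ℂ) (hf : DiffContOnCl ℂ f (ball 0 1)) : DiskAlg :=
  ⟨⟨fun w => f w, continuousOn_iff_continuous_domRestrict.1 hf.continuousOn_ball⟩, f, hf, fun _ => rfl⟩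

lemma eval_mk {f : ℂ → ℂ} (hf : DiffContOnCl ℂ f (ball 0 1)) {w : ℂ} (hw : ‖w‖ ≤ 1) :
    (mk f hf).eval w = f w := by
  rw [eval_of_le _ hw]; rfl

/-- Evaluation as a continuous linear functional. -/
noncomputable def evalL (w : ℂ) : DiskAlg →L[ℂ] ℂ :=
  LinearMap.mkContinuous
    { toFun := fun F => F.eval w, map_add' := fun F G => eval_add F G w,
      map_smul' := fun c F => eval_smul c F w } 1
    (fun F => by rw [one_mul]; exact norm_eval_le F w)

lemma eq_of_mul_eval_eq {F G : DiskAlg} (h : ∀ w, ‖w‖ ≤ 1 → w * F.eval w = w * G.eval w) :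
    F = G := by
  have hne : ∀ w, ‖w‖ ≤ 1 → w ≠ 0 → F.eval w = G.eval w := fun w hw h0 =>
    mul_left_cancel₀ h0 (h w hw)
  refine ext_eval fun w hw => ?_
  rcases ne_or_eq w 0 with h0 | rfl
  · exact hne w hw h0
  have hb : ball (0 : ℂ) 1 ∈ nhds (0 : ℂ) := ball_mem_nhds _ one_pos
  have cF := (F.diffContOnCl.differentiableAt' hb).continuousAt
  have cG := (G.diffContOnCl.differentiableAt' hb).continuousAt
  refine tendsto_nhds_unique_of_eventuallyEq (cF.tendsto.mono_left nhdsWithin_le_nhds)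
    (cG.tendsto.mono_left (nhdsWithin_le_nhds (s := {0}ᶜ))) ?_
  filter_upwards [self_mem_nhdsWithin, nhdsWithin_le_nhds hb] with w h1 h2
  exact hne w (mem_ball_zero_iff.1 h2).le h1

/-- The backward shift `F ↦ (F - F 0) / w`. -/
noncomputable def shift (F : DiskAlg) : DiskAlg :=
  mk (dslope F.eval 0) (by
    have hb : ball (0 : ℂ) 1 ∈ nhds (0 : ℂ) := ball_mem_nhds _ one_pos
    refine DiffContOnCl.mk_ball
      ((Complex.differentiableOn_dslope hb).2 F.diffContOnCl.differentiableOn)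
      ((continuousOn_dslope (closedBall_mem_nhds _ one_pos)).2
        ⟨F.diffContOnCl.continuousOn_ball, F.diffContOnCl.differentiableAt' hb⟩))

lemma mul_eval_shift (F : DiskAlg) {w : ℂ} (hw : ‖w‖ ≤ 1) :
    w * (shift F).eval w = F.eval w - F.eval 0 := by
  rw [shift, eval_mk _ hw]
  simpa using sub_smul_dslope F.eval 0 w

/-- By the maximum principle it suffices to divide `F - F 0` by `w` on the circle of radius `l`.
Iteration gives Cauchy estimates with the cruder factor `(2 / l) ^ i`. -/
lemma norm_eval_shift_le (F : DiskAlg) {l s : ℝ} (hl : 0 < l) (hl1 : l ≤ 1)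
    (h : ∀ w, ‖w‖ ≤ l → ‖F.eval w‖ ≤ s) : ∀ w, ‖w‖ ≤ l → ‖(shift F).eval w‖ ≤ 2 / l * s := by
  intro w hw
  refine Complex.norm_le_of_forall_mem_frontier_norm_le (U := ball 0 l) isBounded_ball
    ((shift F).diffContOnCl.mono (ball_subset_ball hl1)) (fun z hz => ?_)
    (by rw [closure_ball _ hl.ne']; exact mem_closedBall_zero_iff.2 hw)
  rw [frontier_ball _ hl.ne', mem_sphere_zero_iff_norm] at hz
  have h1 := congrArg norm (mul_eval_shift F (hz.le.trans hl1))
  rw [norm_mul, hz] at h1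
  have h2 : ‖F.eval z - F.eval 0‖ ≤ s + s :=
    (norm_sub_le _ _).trans (add_le_add (h z hz.le) (h 0 (by simpa using hl.le)))
  rw [div_mul_eq_mul_div, le_div_iff₀ hl]
  linarith

lemma shift_add (F G : DiskAlg) : shift (F + G) = shift F + shift G :=
  eq_of_mul_eval_eq fun w hw => by
    rw [eval_add, mul_add, mul_eval_shift _ hw, mul_eval_shift _ hw, mul_eval_shift _ hw,
      eval_add, eval_add]
    ring

lemma shift_smul (c : ℂ) (F : DiskAlg) : shift (c • F) = c • shift F :=
  eq_of_mul_eval_eq fun w hw => by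
    rw [eval_smul, mul_left_comm, mul_eval_shift _ hw, mul_eval_shift _ hw, eval_smul, eval_smul]
    ring

lemma norm_shift_le (F : DiskAlg) : ‖shift F‖ ≤ 2 * ‖F‖ :=
  norm_le (by positivity) fun w hw => by
    have := norm_eval_shift_le F one_pos le_rfl (fun w _ => F.norm_eval_le w) w hw
    rwa [div_one] at this

/-- The backward shift as a continuous linear map. -/
noncomputable def shiftL : DiskAlg →L[ℂ] DiskAlg :=
  LinearMap.mkContinuous
    { toFun := shift, map_add' := shift_add, map_smul' := shift_smul } 2 norm_shift_le

lemma mul_eval_shiftL (F : DiskAlg) {w : ℂ} (hw : ‖w‖ ≤ 1) :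
    w * (shiftL F).eval w = F.eval w - F.eval 0 := mul_eval_shift F hw

/-- The Taylor coefficients at the origin. -/
noncomputable def coeffL (i : ℕ) : DiskAlg →L[ℂ] ℂ := (evalL 0).comp (shiftL ^ i)

lemma norm_eval_shiftL_pow_le (F : DiskAlg) {l s : ℝ} (hl : 0 < l) (hl1 : l ≤ 1)
    (h : ∀ w, ‖w‖ ≤ l → ‖F.eval w‖ ≤ s) (i : ℕ) :
    ∀ w, ‖w‖ ≤ l → ‖((shiftL ^ i) F).eval w‖ ≤ (2 / l) ^ i * s := by
  induction i with
  | zero => simpa using h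
  | succ i ih =>
    have := norm_eval_shift_le _ hl hl1 ih
    intro w hw
    rw [pow_succ' shiftL, pow_succ' (2 / l), mul_assoc]
    exact this w hw

lemma norm_coeffL_le (F : DiskAlg) {l s : ℝ} (hl : 0 < l) (hl1 : l ≤ 1)
    (h : ∀ w, ‖w‖ ≤ l → ‖F.eval w‖ ≤ s) (i : ℕ) : ‖coeffL i F‖ ≤ (2 / l) ^ i * s :=
  norm_eval_shiftL_pow_le F hl hl1 h i 0 (by simpa using hl.le)

lemma eval_eq_sum (F : DiskAlg) (b : ℕ) {w : ℂ} (hw : ‖w‖ ≤ 1) :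
    F.eval w = ∑ i ∈ Finset.range b, coeffL i F * w ^ i + w ^ b * ((shiftL ^ b) F).eval w := by
  induction b with
  | zero => simp
  | succ b ih =>
    rw [Finset.sum_range_succ, ih]
    have h1 := mul_eval_shiftL ((shiftL ^ b) F) hw
    have h2 : (shiftL ^ (b + 1)) F = shiftL ((shiftL ^ b) F) := by rw [pow_succ']; rfl
    have h3 : coeffL b F = ((shiftL ^ b) F).eval 0 := rfl
    rw [h2, h3, pow_succ, mul_assoc (w ^ b), h1]
    ring

lemma shiftL_pow_eq {F Q : DiskAlg} {b : ℕ} (h : ∀ w, ‖w‖ ≤ 1 → F.eval w = w ^ b * Q.eval w) :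
    (shiftL ^ b) F = Q := by
  induction b generalizing F Q with
  | zero => exact ext_eval fun w hw => by simpa using h w hw
  | succ b ih =>
    set X : DiskAlg := mk (fun w => w) differentiable_id.diffContOnCl with hX
    have hX' : ∀ w, ‖w‖ ≤ 1 → X.eval w = w := fun w hw => eval_mk _ hw
    have h1 : (shiftL ^ b) F = X * Q := ih fun w hw => by
      rw [h w hw, eval_mul, hX' w hw, pow_succ, mul_assoc]
    have h2 : (shiftL ^ (b + 1)) F = shiftL ((shiftL ^ b) F) := by rw [pow_succ']; rfl
    rw [h2, h1]
    refine eq_of_mul_eval_eq fun w hw => ?_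
    rw [mul_eval_shiftL _ hw, eval_mul, eval_mul, hX' w hw, hX' 0 (by simp)]
    ring

open Classical in
-- Uniform limits of holomorphic functions are holomorphic. The resulting completeness is needed for
-- limits of difference quotients and for openness of the invertible operators.
lemma isClosed_diskAlgebra : IsClosed (diskAlgebra : Set C(closedBall (0 : ℂ) 1, ℂ)) := by
  refine isClosed_of_closure_subset fun F hF => ?_
  obtain ⟨u, hu, hlim⟩ := mem_closure_iff_seq_limit.1 hF
  set v : ℕ → DiskAlg := fun k => ⟨u k, hu k⟩ with hv
  set f : ℂ → ℂ := fun w => if h : w ∈ closedBall (0 : ℂ) 1 then F ⟨w, h⟩ else 0 with hf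
  have hfw : ∀ w (h : w ∈ closedBall (0 : ℂ) 1), f w = F ⟨w, h⟩ := fun w h => by
    rw [hf]; simp only [h, dif_pos]
  have hunif : TendstoUniformlyOn (fun k => (v k).eval) f Filter.atTop (closedBall 0 1) := by
    rw [Metric.tendstoUniformlyOn_iff]
    intro ε hε
    filter_upwards [Metric.tendsto_nhds.1 hlim ε hε] with k hk w hw
    rw [hfw w hw, eval, dif_pos hw, dist_comm]
    exact (ContinuousMap.dist_apply_le_dist (f := u k) (g := F) ⟨w, hw⟩).trans_lt hk
  refine ⟨f, DiffContOnCl.mk_ball ?_ ?_, fun w => (hfw w w.2).symm⟩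
  · exact ((hunif.mono ball_subset_closedBall).tendstoLocallyUniformlyOn).differentiableOn
      (Filter.Eventually.of_forall fun k => (v k).diffContOnCl.differentiableOn) isOpen_ball
  · exact hunif.continuousOn (Filter.Frequently.of_forall fun k => (v k).diffContOnCl.continuousOn_ball)

instance : CompleteSpace DiskAlg := isClosed_diskAlgebra.completeSpace_coe

end DiskAlg

end DiskAlgebra

/-! ### Holomorphy along complex lines, with values in the disk algebra -/

section LineHolomorphic

open Metric

variable {E G H : Type*} [NormedAddCommGroup E] [NormedSpace ℂ E] [NormedAddCommGroup G]
  [NormedSpace ℂ G] [NormedAddCommGroup H] [NormedSpace ℂ H]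

/-- `f` is holomorphic along every complex line, at the points of `s`. -/
def LineHolomorphicOn (f : E → G) (s : Set E) : Prop :=
  ∀ x ∈ s, ∀ h : E, DifferentiableAt ℂ (fun t : ℂ => f (x + t • h)) 0

lemma LineHolomorphicOn.differentiableAt_line {f : E → G} {s : Set E} (hf : LineHolomorphicOn f s)
    {x h : E} {t₀ : ℂ} (hx : x + t₀ • h ∈ s) :
    DifferentiableAt ℂ (fun t : ℂ => f (x + t • h)) t₀ := by
  have h1 := hf _ hx h
  have h2 : DifferentiableAt ℂ (fun t : ℂ => t - t₀) t₀ := by fun_prop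
  rw [← sub_self t₀] at h1
  refine (DifferentiableAt.comp (f := fun t : ℂ => t - t₀) t₀ h1 h2).congr_of_eventuallyEq
    (Filter.Eventually.of_forall fun t => ?_)
  simp only [Function.comp_apply, sub_smul]
  congr 1
  module

lemma LineHolomorphicOn.clm_comp {f : E → G} {s : Set E} (hf : LineHolomorphicOn f s)
    (L : G →L[ℂ] H) : LineHolomorphicOn (fun x => L (f x)) s := fun x hx h =>
  L.differentiableAt.comp 0 (hf x hx h)

/-- The Schwarz lemma applied twice, to `φ` and to its slope. What matters is that the Lipschitz
constant depends on `δ` and `M` alone. -/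
lemma dist_dslope_le {φ : ℂ → ℂ} {δ M : ℝ} (hδ : 0 < δ) (hφ : DifferentiableOn ℂ φ (ball 0 δ))
    (hM : ∀ t ∈ ball (0 : ℂ) δ, ‖φ t‖ ≤ M) {t t' : ℂ} (ht : t ∈ ball (0 : ℂ) (δ / 4))
    (ht' : t' ∈ ball (0 : ℂ) (δ / 4)) :
    dist (dslope φ 0 t) (dslope φ 0 t') ≤ (2 * (2 * M / δ)) / (δ / 2) * dist t t' := by
  have h0 : (0 : ℂ) ∈ ball (0 : ℂ) δ := mem_ball_self hδ
  have hb : ∀ z ∈ ball (0 : ℂ) δ, ‖dslope φ 0 z‖ ≤ 2 * M / δ := fun z hz =>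
    Complex.norm_dslope_le_div_of_mapsTo_ball hφ (fun w hw => by
      rw [mem_closedBall, dist_eq_norm]
      exact (norm_sub_le _ _).trans (by linarith [hM w hw, hM 0 h0])) hz
  have hd : DifferentiableOn ℂ (dslope φ 0) (ball 0 δ) :=
    (Complex.differentiableOn_dslope (ball_mem_nhds _ hδ)).2 hφ
  have hsub : ball t' (δ / 2) ⊆ ball 0 δ := ball_subset_ball' (by
    rw [mem_ball] at ht'; linarith)
  refine Complex.dist_le_div_mul_dist_of_mapsTo_ball (hd.mono hsub) (fun w hw => ?_) ?_
  · rw [mem_closedBall, dist_eq_norm]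
    exact (norm_sub_le _ _).trans
      (by linarith [hb w (hsub hw), hb t' (hsub (mem_ball_self (by positivity)))])
  · rw [mem_ball] at *
    have := dist_triangle_right t t' 0
    linarith

/-- Pointwise holomorphy in `w` upgrades to norm holomorphy: the difference quotients are Lipschitz
uniformly in `w`, hence Cauchy in the sup norm, and the disk algebra is complete. -/
lemma DiskAlg.differentiableAt_of_eval {Φ : ℂ → DiskAlg} {δ M : ℝ} (hδ : 0 < δ)
    (hΦ : ∀ w, ‖w‖ ≤ 1 → DifferentiableOn ℂ (fun t => (Φ t).eval w) (ball 0 δ))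
    (hM : ∀ t ∈ ball (0 : ℂ) δ, ‖Φ t‖ ≤ M) : DifferentiableAt ℂ Φ 0 := by
  have hM0 : 0 ≤ M := (norm_nonneg (Φ 0)).trans (hM 0 (mem_ball_self hδ))
  have hslope : ∀ t : ℂ, t ≠ 0 → ∀ w, (slope Φ 0 t).eval w = dslope (fun t => (Φ t).eval w) 0 t := by
    intro t ht w
    rw [dslope_of_ne _ ht, slope_def_module, slope_def_module, eval_smul, eval_sub, smul_eq_mul]
  have hlip : LipschitzOnWith (Real.toNNReal ((2 * (2 * M / δ)) / (δ / 2))) (slope Φ 0)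
      (ball 0 (δ / 4) \ {0}) := by
    refine LipschitzOnWith.of_dist_le_mul fun t ht t' ht' => ?_
    rw [Real.coe_toNNReal _ (by positivity), dist_eq_norm]
    refine norm_le (by positivity) fun w hw => ?_
    rw [eval_sub, hslope t ht.2, hslope t' ht'.2, ← dist_eq_norm]
    exact dist_dslope_le hδ (hΦ w hw) (fun t ht => ((Φ t).norm_eval_le w).trans (hM t ht)) ht.1 ht'.1
  have hc : Cauchy (Filter.map (slope Φ 0) (nhdsWithin (0 : ℂ) {0}ᶜ)) := by
    refine (cauchy_nhds.mono nhdsWithin_le_nhds).map_of_le hlip.uniformContinuousOn ?_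
    rw [Filter.le_principal_iff, Set.sdiff_eq, Set.inter_comm]
    exact inter_mem_nhdsWithin _ (ball_mem_nhds _ (by positivity))
  obtain ⟨d, hd⟩ := CompleteSpace.complete hc
  exact (hasDerivAt_iff_tendsto_slope.2 hd).differentiableAt

open Classical in
/-- The function `w ↦ F (y + w • e)` as an element of the disk algebra. -/
noncomputable def diskCurry (F : E → ℂ) (e y : E) : DiskAlg :=
  if h : DiffContOnCl ℂ (fun w : ℂ => F (y + w • e)) (ball 0 1) then DiskAlg.mk _ h else 0

variable {F : E → ℂ} {δ M : ℝ} {e : E}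

lemma add_smul_mem_ball (he : ‖e‖ < δ / 2) {y : E} (hy : y ∈ ball (0 : E) (δ / 2)) {w : ℂ}
    (hw : ‖w‖ ≤ 1) : y + w • e ∈ ball (0 : E) δ := by
  rw [mem_ball_zero_iff] at *
  have h1 : ‖w • e‖ ≤ ‖e‖ := by
    rw [norm_smul]; exact mul_le_of_le_one_left (norm_nonneg _) hw
  linarith [norm_add_le y (w • e)]

lemma LineHolomorphicOn.diffContOnCl_line (hF : LineHolomorphicOn F (ball 0 δ))
    (he : ‖e‖ < δ / 2) {y : E} (hy : y ∈ ball (0 : E) (δ / 2)) :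
    DiffContOnCl ℂ (fun w : ℂ => F (y + w • e)) (ball 0 1) := by
  refine DifferentiableOn.diffContOnCl fun w hw => ?_
  rw [closure_ball _ one_ne_zero, mem_closedBall_zero_iff] at hw
  exact (hF.differentiableAt_line (add_smul_mem_ball he hy hw)).differentiableWithinAt

lemma LineHolomorphicOn.eval_diskCurry (hF : LineHolomorphicOn F (ball 0 δ))
    (he : ‖e‖ < δ / 2) {y : E} (hy : y ∈ ball (0 : E) (δ / 2)) {w : ℂ} (hw : ‖w‖ ≤ 1) :
    (diskCurry F e y).eval w = F (y + w • e) := by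
  rw [diskCurry, dif_pos (hF.diffContOnCl_line he hy), DiskAlg.eval_mk _ hw]

lemma LineHolomorphicOn.norm_diskCurry_le (hF : LineHolomorphicOn F (ball 0 δ))
    (hM : ∀ x ∈ ball (0 : E) δ, ‖F x‖ ≤ M) (he : ‖e‖ < δ / 2) {y : E}
    (hy : y ∈ ball (0 : E) (δ / 2)) : ‖diskCurry F e y‖ ≤ M := by
  have h0 : 0 ≤ M := (norm_nonneg _).trans (hM y (by
    simpa using add_smul_mem_ball he hy (w := 0) (by simp)))
  refine DiskAlg.norm_le h0 fun w hw => ?_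
  rw [hF.eval_diskCurry he hy hw]
  exact hM _ (add_smul_mem_ball he hy hw)

lemma LineHolomorphicOn.curry (hF : LineHolomorphicOn F (ball 0 δ))
    (hM : ∀ x ∈ ball (0 : E) δ, ‖F x‖ ≤ M) (he : ‖e‖ < δ / 2) :
    LineHolomorphicOn (diskCurry F e) (ball 0 (δ / 2)) := by
  intro y hy h
  have hc : Continuous fun t : ℂ => y + t • h := by fun_prop
  obtain ⟨r, hr, hsub⟩ := Metric.isOpen_iff.1 (isOpen_ball.preimage hc) (0 : ℂ)
    (show y + (0 : ℂ) • h ∈ ball (0 : E) (δ / 2) by simpa using hy)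
  refine DiskAlg.differentiableAt_of_eval hr (fun w hw t ht => ?_)
    (fun t ht => hF.norm_diskCurry_le hM he (hsub ht))
  have h1 : DifferentiableAt ℂ (fun t : ℂ => F ((y + w • e) + t • h)) t := by
    refine hF.differentiableAt_line ?_
    have := add_smul_mem_ball he (hsub ht) hw
    convert this using 1
    module
  refine (h1.congr_of_eventuallyEq ?_).differentiableWithinAt
  filter_upwards [isOpen_ball.mem_nhds ht] with t' ht'
  rw [hF.eval_diskCurry he (hsub ht') hw]
  congr 1
  module

/-- The Schwarz lemma on the line through `x` and `x + y`, over the disk of radius `δ / (2 * ‖y‖)`: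
boundedness turns holomorphy along lines into a Lipschitz bound. -/
lemma LineHolomorphicOn.dist_le (hF : LineHolomorphicOn F (ball 0 δ))
    (hM : ∀ x ∈ ball (0 : E) δ, ‖F x‖ ≤ M) {x y : E} (hx : x ∈ ball (0 : E) (δ / 2))
    (hy : ‖y‖ < δ / 2) : ‖F (x + y) - F x‖ ≤ 4 * M / δ * ‖y‖ := by
  rcases eq_or_ne y 0 with rfl | hy0
  · simp
  have hyn : 0 < ‖y‖ := norm_pos_iff.2 hy0
  rw [mem_ball_zero_iff] at hx
  have hδ : 0 < δ := by linarith [norm_nonneg y]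
  have hmem : ∀ t ∈ ball (0 : ℂ) (δ / 2 / ‖y‖), x + t • y ∈ ball (0 : E) δ := by
    intro t ht
    rw [mem_ball_zero_iff, lt_div_iff₀ hyn, ← norm_smul] at ht
    rw [mem_ball_zero_iff]
    linarith [norm_add_le x (t • y)]
  have h0 : x ∈ ball (0 : E) δ := by rw [mem_ball_zero_iff]; linarith
  have := Complex.dist_le_div_mul_dist_of_mapsTo_ball (f := fun t : ℂ => F (x + t • y)) (c := 0)
    (z := 1) (R₁ := δ / 2 / ‖y‖) (R₂ := 2 * M)
    (fun t ht => (hF.differentiableAt_line (hmem t ht)).differentiableWithinAt)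
    (fun t ht => by
      rw [mem_closedBall, dist_eq_norm]
      refine (norm_sub_le _ _).trans ?_
      have h1 := hM _ (hmem t ht)
      have h2 := hM _ h0
      simp only [zero_smul, add_zero]
      linarith)
    (by rw [mem_ball_zero_iff, lt_div_iff₀ hyn]; simpa using hy)
  simp only [one_smul, zero_smul, add_zero, dist_eq_norm, sub_zero, norm_one, mul_one] at this
  refine this.trans (le_of_eq ?_)
  field_simp
  ring

end LineHolomorphic

/-! ### Weierstrass division by inverting an operator -/

section Division

open Metric

variable {E : Type*} [NormedAddCommGroup E] [NormedSpace ℂ E]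

/-- The operator `q ↦ (g q - Taylor polynomial of degree < b) / w ^ b`, linear in `g`. -/
noncomputable def divOp (b : ℕ) : DiskAlg →L[ℂ] (DiskAlg →L[ℂ] DiskAlg) :=
  (ContinuousLinearMap.compL ℂ DiskAlg DiskAlg DiskAlg (DiskAlg.shiftL ^ b)).comp
    (ContinuousLinearMap.mul ℂ DiskAlg)

lemma divOp_apply (b : ℕ) (g q : DiskAlg) : divOp b g q = (DiskAlg.shiftL ^ b) (g * q) := rfl

/-- Multiplying by `w ^ b * h` and shifting back `b` times is multiplication by the unit `h`. -/
lemma isUnit_divOp {b : ℕ} {g h : DiskAlg} (hh : IsUnit h)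
    (hg : ∀ w, ‖w‖ ≤ 1 → g.eval w = w ^ b * h.eval w) : IsUnit (divOp b g) := by
  have e : ∀ q, divOp b g q = h * q := fun q => by
    rw [divOp_apply]
    refine DiskAlg.shiftL_pow_eq fun w hw => ?_
    rw [DiskAlg.eval_mul, DiskAlg.eval_mul, hg w hw, mul_assoc]
  obtain ⟨k, hk⟩ := hh.exists_right_inv
  refine ⟨⟨divOp b g, ContinuousLinearMap.mul ℂ DiskAlg k, ?_, ?_⟩, rfl⟩
  · ext1 q
    show divOp b g (k * q) = q
    rw [e, ← mul_assoc, hk, one_mul]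
  · ext1 q
    show k * divOp b g q = q
    rw [e, ← mul_assoc, mul_comm k, hk, one_mul]

/-- Weierstrass division with parameters, by a function that is regular in the direction `e`. -/
theorem LineHolomorphicOn.exists_division {D : E → ℂ} {δ M₁ : ℝ} (hδ : 0 < δ)
    (hD : LineHolomorphicOn D (ball 0 δ)) (hDM : ∀ x ∈ ball (0 : E) δ, ‖D x‖ ≤ M₁)
    {e : E} (he : ‖e‖ < δ / 2) {b : ℕ} {h : DiskAlg} (hh : IsUnit h)
    (hDe : ∀ w : ℂ, ‖w‖ ≤ 1 → D (w • e) = w ^ b * h.eval w) (M : ℝ) :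
    ∃ ε > 0, ∃ C, 0 ≤ C ∧ ∀ F : E → ℂ, LineHolomorphicOn F (ball 0 δ) →
      (∀ x ∈ ball (0 : E) δ, ‖F x‖ ≤ M) → ∃ (u : E → ℂ → ℂ) (r : E → Fin b → ℂ),
        LineHolomorphicOn r (ball 0 ε) ∧ ∀ y ∈ ball (0 : E) ε, ‖r y‖ ≤ C ∧
          ∀ w, ‖w‖ ≤ 1 → ‖u y w‖ ≤ C ∧
            F (y + w • e) = D (y + w • e) * u y w + ∑ l, r y l * w ^ (l : ℕ) := by
  have h0 : (0 : E) ∈ ball (0 : E) (δ / 2) := mem_ball_self (by positivity)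
  have hM₁ : 0 ≤ M₁ := (norm_nonneg _).trans (hDM 0 (mem_ball_self hδ))
  -- At `y = 0` this operator is multiplication by the unit `h`; it depends continuously on `y`, so
  -- it stays invertible, with bounded inverse, near `0`.
  set T : E → (DiskAlg →L[ℂ] DiskAlg) := fun y => divOp b (diskCurry D e y) with hT
  have hT0 : IsUnit (T 0) := isUnit_divOp hh fun w hw => by
    rw [hD.eval_diskCurry he h0 hw, zero_add, hDe w hw]
  have hcurry : ContinuousAt (diskCurry D e) 0 := by
    refine Metric.continuousAt_iff.2 fun η hη => ?_
    have hK : 0 ≤ 4 * M₁ / δ := by positivity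
    refine ⟨min (δ / 2) (η / (4 * M₁ / δ + 1)), by positivity, fun {y} hy => ?_⟩
    rw [dist_zero_right, lt_min_iff] at hy
    have hy2 := (lt_div_iff₀ (by positivity)).1 hy.2
    rw [dist_eq_norm]
    refine lt_of_le_of_lt (DiskAlg.norm_le (C := 4 * M₁ / δ * ‖y‖) (by positivity) fun w hw => ?_)
      (by linarith [norm_nonneg y])
    rw [DiskAlg.eval_sub, hD.eval_diskCurry he (mem_ball_zero_iff.2 hy.1) hw,
      hD.eval_diskCurry he h0 hw, zero_add, add_comm y]
    refine hD.dist_le hDM ?_ hy.1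
    rw [mem_ball_zero_iff, norm_smul]
    exact (mul_le_of_le_one_left (norm_nonneg _) hw).trans_lt he
  have hTc : ContinuousAt T 0 := (divOp b).continuous.continuousAt.comp hcurry
  have hinv : ContinuousAt (fun y => Ring.inverse (T y)) 0 := by
    obtain ⟨U, hU⟩ := hT0
    have := NormedRing.inverse_continuousAt U
    rw [hU] at this
    exact ContinuousAt.comp (g := Ring.inverse) (f := T) this hTc
  set K := ‖Ring.inverse (T 0)‖ + 1 with hK
  have hev : ∀ᶠ y in nhds (0 : E), IsUnit (T y) ∧ ‖Ring.inverse (T y)‖ ≤ K ∧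
      y ∈ ball (0 : E) (δ / 2) := by
    have h1 : ∀ᶠ y in nhds (0 : E), IsUnit (T y) := hTc (Units.isOpen.mem_nhds hT0)
    have h2 : ∀ᶠ y in nhds (0 : E), ‖Ring.inverse (T y)‖ < K :=
      hinv.norm.eventually_lt continuousAt_const (lt_add_one _)
    filter_upwards [h1, h2, isOpen_ball.mem_nhds h0] with y hy1 hy2 hy3
    exact ⟨hy1, hy2.le, hy3⟩
  obtain ⟨ε, hε, hball⟩ := Metric.eventually_nhds_iff_ball.1 hev
  set A : ℝ := ‖(DiskAlg.shiftL ^ b : DiskAlg →L[ℂ] DiskAlg)‖ with hA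
  set Cq : ℝ := K * (A * |M|) with hCq
  have hCq0 : 0 ≤ Cq := by positivity
  -- Neither `ε` nor this constant depends on `F`: the division is later applied to an infinite
  -- family at once.
  refine ⟨ε, hε, max Cq (2 ^ b * (|M| + M₁ * Cq)), le_max_of_le_left hCq0, fun F hF hFM => ?_⟩
  -- The quotient is chosen so that `F - D * q` is killed by the `b`-th power of the shift, that is,
  -- is a polynomial of degree less than `b` in `w`.
  set q : E → DiskAlg := fun y =>
    Ring.inverse (T y) ((DiskAlg.shiftL ^ b) (diskCurry F e y)) with hq
  set R : E → DiskAlg := fun y => diskCurry F e y - diskCurry D e y * q y with hR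
  have hFn : ∀ y ∈ ball (0 : E) ε, ‖diskCurry F e y‖ ≤ |M| := fun y hy =>
    (hF.norm_diskCurry_le hFM he (hball y hy).2.2).trans (le_abs_self M)
  have hqn : ∀ y ∈ ball (0 : E) ε, ‖q y‖ ≤ Cq := by
    intro y hy
    refine (ContinuousLinearMap.le_opNorm _ _).trans ?_
    refine mul_le_mul (hball y hy).2.1 ?_ (norm_nonneg _) (by positivity)
    exact (ContinuousLinearMap.le_opNorm _ _).trans
      (mul_le_mul_of_nonneg_left (hFn y hy) (norm_nonneg _))
  have hRn : ∀ y ∈ ball (0 : E) ε, ‖R y‖ ≤ |M| + M₁ * Cq := by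
    intro y hy
    refine (norm_sub_le _ _).trans (add_le_add (hFn y hy) ((norm_mul_le _ _).trans ?_))
    exact mul_le_mul (hD.norm_diskCurry_le hDM he (hball y hy).2.2) (hqn y hy) (norm_nonneg _) hM₁
  have hRs : ∀ y ∈ ball (0 : E) ε, (DiskAlg.shiftL ^ b) (R y) = 0 := by
    intro y hy
    have h1 : T y (q y) = (DiskAlg.shiftL ^ b) (diskCurry F e y) := by
      have := Ring.mul_inverse_cancel _ (hball y hy).1
      exact congrArg (fun L : DiskAlg →L[ℂ] DiskAlg =>
        L ((DiskAlg.shiftL ^ b) (diskCurry F e y))) this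
    rw [hR, map_sub, ← h1, hT, divOp_apply, sub_self]
  have hRl : LineHolomorphicOn R (ball 0 ε) := by
    intro y hy v
    have hc1 := hF.curry hFM he y (hball y hy).2.2 v
    have hc2 := hD.curry hDM he y (hball y hy).2.2 v
    have hT1 : DifferentiableAt ℂ (fun t : ℂ => T (y + t • v)) 0 :=
      (divOp b).differentiableAt.comp (0 : ℂ) hc2
    have hU : IsUnit (T (y + (0 : ℂ) • v)) := by simpa using (hball y hy).1
    have hT2 : DifferentiableAt ℂ (fun t : ℂ => Ring.inverse (T (y + t • v))) 0 :=
      DifferentiableAt.comp (g := Ring.inverse) (f := fun t : ℂ => T (y + t • v)) 0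
        (differentiableAt_inverse hU) hT1
    have hq1 : DifferentiableAt ℂ (fun t : ℂ => q (y + t • v)) 0 :=
      hT2.clm_apply ((DiskAlg.shiftL ^ b).differentiableAt.comp (0 : ℂ) hc1)
    exact hc1.sub (hc2.mul hq1)
  refine ⟨fun y w => (q y).eval w, fun y l => DiskAlg.coeffL l (R y), ?_, fun y hy => ⟨?_, ?_⟩⟩
  · intro y hy v
    exact differentiableAt_pi.2 fun l => (hRl.clm_comp (DiskAlg.coeffL l)) y hy v
  · refine (pi_norm_le_iff_of_nonneg (le_max_of_le_left hCq0)).2 fun l => le_max_of_le_right ?_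
    refine (DiskAlg.norm_coeffL_le (R y) one_pos le_rfl
      (fun w _ => ((R y).norm_eval_le w).trans (hRn y hy)) l).trans ?_
    rw [div_one]
    refine mul_le_mul_of_nonneg_right (pow_le_pow_right₀ one_le_two l.2.le) (by positivity)
  · intro w hw
    refine ⟨((q y).norm_eval_le w).trans ((hqn y hy).trans (le_max_left _ _)), ?_⟩
    have h1 := DiskAlg.eval_eq_sum (R y) b hw
    have hz : (0 : DiskAlg).eval w = 0 := by
      have := DiskAlg.norm_eval_le 0 w
      rw [norm_zero] at this
      exact norm_le_zero_iff.1 this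
    rw [hRs y hy, hz, mul_zero, add_zero, hR, DiskAlg.eval_sub, DiskAlg.eval_mul,
      hF.eval_diskCurry he (hball y hy).2.2 hw, hD.eval_diskCurry he (hball y hy).2.2 hw,
      Finset.sum_range] at h1
    rw [← h1]
    ring

lemma LineHolomorphicOn.analyticOnNhd_line {D : E → ℂ} {δ : ℝ}
    (hD : LineHolomorphicOn D (ball 0 δ)) (x v : E) :
    AnalyticOnNhd ℂ (fun t : ℂ => D (x + t • v)) {t : ℂ | x + t • v ∈ ball (0 : E) δ} := by
  have hc : Continuous fun t : ℂ => x + t • v := by fun_prop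
  refine DifferentiableOn.analyticOnNhd (fun t ht => ?_) (isOpen_ball.preimage hc)
  exact (hD.differentiableAt_line ht).differentiableWithinAt

lemma isPreconnected_line_ball (x v : E) (δ : ℝ) :
    IsPreconnected {t : ℂ | x + t • v ∈ ball (0 : E) δ} := by
  have : Convex ℝ {t : ℂ | x + t • v ∈ ball (0 : E) δ} := by
    intro s hs t ht a c ha hc hac
    have h1 := convex_ball (0 : E) δ hs ht ha hc hac
    have h2 : x + (a • s + c • t) • v = a • (x + s • v) + c • (x + t • v) := by
      rw [smul_add, smul_add, add_add_add_comm, ← add_smul a c x, hac, one_smul, add_smul,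
        smul_assoc, smul_assoc]
    show x + (a • s + c • t) • v ∈ ball (0 : E) δ
    rw [h2]
    exact h1
  exact this.isPreconnected

/-- The identity theorem on the slice of the ball by a complex line, which is convex and thus
connected. -/
lemma LineHolomorphicOn.eventually_ne_zero {D : E → ℂ} {δ : ℝ}
    (hD : LineHolomorphicOn D (ball 0 δ)) {x v : E} (hx : x ∈ ball (0 : E) δ)
    (hv : x + v ∈ ball (0 : E) δ) (hne : D (x + v) ≠ 0) :
    ∀ᶠ t in nhdsWithin (0 : ℂ) {0}ᶜ, D (x + t • v) ≠ 0 := by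
  have ha := hD.analyticOnNhd_line x v
  have h0 : (0 : ℂ) ∈ {t : ℂ | x + t • v ∈ ball (0 : E) δ} := by simpa using hx
  have h1 : (1 : ℂ) ∈ {t : ℂ | x + t • v ∈ ball (0 : E) δ} := by simpa using hv
  rcases (ha 0 h0).eventually_eq_zero_or_eventually_ne_zero with h | h
  · have := ha.eqOn_zero_of_preconnected_of_eventuallyEq_zero (isPreconnected_line_ball x v δ) h0 h
    exact absurd (by simpa using this h1) hne
  · exact h

/-- A function that does not vanish identically is regular in some direction. -/
theorem LineHolomorphicOn.exists_regular_direction {D : E → ℂ} {δ : ℝ} (hδ : 0 < δ)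
    (hD : LineHolomorphicOn D (ball 0 δ)) {x : E} (hx : x ∈ ball (0 : E) δ) (hx0 : x ≠ 0)
    (hne : D x ≠ 0) : ∃ e : E, e ≠ 0 ∧ ‖e‖ < δ / 2 ∧ ∃ (b : ℕ) (h : DiskAlg), IsUnit h ∧
      ∀ w : ℂ, ‖w‖ ≤ 1 → D (w • e) = w ^ b * h.eval w := by
  have h0 : (0 : E) ∈ ball (0 : E) δ := mem_ball_self hδ
  have hnev : ¬ ∀ᶠ t in nhds (0 : ℂ), D ((0 : E) + t • x) = 0 := by
    intro h
    have h1 := hD.eventually_ne_zero h0 (by simpa using hx) (by simpa using hne)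
    obtain ⟨t, ht⟩ := ((h.filter_mono nhdsWithin_le_nhds).and h1).exists
    exact ht.2 ht.1
  obtain ⟨b, g, hg, hg0, hgeq⟩ :=
    (AnalyticAt.exists_eventuallyEq_pow_smul_nonzero_iff
      (hD.analyticOnNhd_line 0 x 0 (by simpa using h0))).2 hnev
  have hev : ∀ᶠ t in nhds (0 : ℂ), D (t • x) = t ^ b * g t ∧ g t ≠ 0 ∧ DifferentiableAt ℂ g t := by
    filter_upwards [hgeq, hg.continuousAt.eventually_ne hg0, hg.eventually_analyticAt]
      with t h1 h2 h3
    refine ⟨by simpa using h1, h2, h3.differentiableAt⟩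
  obtain ⟨η, hη, hball⟩ := Metric.eventually_nhds_iff_ball.1 hev
  have hxn : 0 < ‖x‖ := norm_pos_iff.2 hx0
  -- Scaling `x` by `τ` makes `‖e‖ < δ / 2` and keeps the closed unit disk in the region where the
  -- cofactor `g` is holomorphic without zeros.
  set τ : ℝ := min (η / 2) (δ / 4 / ‖x‖) with hτ
  have hτ0 : 0 < τ := by positivity
  have hτc : (τ : ℂ) ≠ 0 := by exact_mod_cast hτ0.ne'
  have hτn : ‖(τ : ℂ)‖ = τ := by rw [Complex.norm_real, Real.norm_of_nonneg hτ0.le]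
  have hmem : ∀ w : ℂ, ‖w‖ ≤ 1 → w * τ ∈ ball (0 : ℂ) η := by
    intro w hw
    rw [mem_ball_zero_iff, norm_mul, hτn]
    have h1 : τ ≤ η / 2 := min_le_left _ _
    have h2 : ‖w‖ * τ ≤ τ := mul_le_of_le_one_left hτ0.le hw
    linarith
  have hcl : ∀ w ∈ closure (ball (0 : ℂ) 1), ‖w‖ ≤ 1 := fun w hw => by
    rwa [closure_ball _ one_ne_zero, mem_closedBall_zero_iff] at hw
  have hdiff : DiffContOnCl ℂ (fun w : ℂ => (τ : ℂ) ^ b * g (w * τ)) (ball 0 1) := by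
    refine DifferentiableOn.diffContOnCl fun w hw => DifferentiableAt.differentiableWithinAt ?_
    have h1 := (hball _ (hmem w (hcl w hw))).2.2
    exact (differentiableAt_const _).mul
      (DifferentiableAt.comp (f := fun w : ℂ => w * τ) w h1 (by fun_prop))
  have hnz : ∀ w : ℂ, ‖w‖ ≤ 1 → (τ : ℂ) ^ b * g (w * τ) ≠ 0 := fun w hw =>
    mul_ne_zero (pow_ne_zero _ hτc) (hball _ (hmem w hw)).2.1
  have hone : ∀ w : ℂ, ‖w‖ ≤ 1 → (1 : DiskAlg).eval w = 1 := fun w hw => by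
    rw [DiskAlg.eval_of_le _ hw]; rfl
  refine ⟨(τ : ℂ) • x, smul_ne_zero hτc hx0, ?_, b, DiskAlg.mk _ hdiff,
    .of_mul_eq_one (DiskAlg.mk _ (hdiff.inv fun w hw => hnz w (hcl w hw)))
      (DiskAlg.ext_eval fun w hw => ?_), fun w hw => ?_⟩
  · rw [norm_smul, hτn]
    have h1 : τ ≤ δ / 4 / ‖x‖ := min_le_right _ _
    rw [le_div_iff₀ hxn] at h1
    linarith
  · rw [DiskAlg.eval_mul, DiskAlg.eval_mk _ hw, DiskAlg.eval_mk _ hw, hone w hw]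
    exact mul_inv_cancel₀ (hnz w hw)
  · rw [DiskAlg.eval_mk _ hw, smul_smul, (hball _ (hmem w hw)).1, mul_pow]
    ring

end Division

/-! ### Domination of an infinite holomorphic family by finitely many members -/

section Domination

open Metric

/-- A finite subfamily which is a basis of the span of the whole family at a point of maximal rank,
and hence at all points where a certain determinant does not vanish. -/
lemma exists_maximal_rank_subfamily {E G ι : Type} [NormedAddCommGroup G]
    [NormedSpace ℂ G] [FiniteDimensional ℂ G] (F : ι → E → G) {s : Set E} (hs : s.Nonempty) :
    ∃ x₀ ∈ s, ∃ (q : ℕ) (k : Fin q → ι) (π : G →L[ℂ] (Fin q → ℂ)),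
      (Matrix.of fun a j => π (F (k j) x₀) a).det = 1 ∧
      ∀ x ∈ s, (Matrix.of fun a j => π (F (k j) x) a).det ≠ 0 → ∀ i,
        F i x = ∑ j, ((Matrix.of fun a j => π (F (k j) x) a)⁻¹.mulVec (π (F i x))) j •
          F (k j) x := by
  classical
  set rk : E → ℕ := fun x => Module.finrank ℂ (Submodule.span ℂ (Set.range fun i => F i x)) with hrk
  have hbd : BddAbove (rk '' s) := ⟨Module.finrank ℂ G, by
    rintro _ ⟨x, -, rfl⟩; exact Submodule.finrank_le _⟩
  obtain ⟨x₀, hx₀, hmax⟩ := Nat.sSup_mem (hs.image rk) hbd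
  obtain ⟨κ, a, -, hspan, hli⟩ := exists_linearIndependent' ℂ (fun i => F i x₀)
  have : Finite κ := hli.finite
  obtain ⟨q, ⟨eq⟩⟩ := Finite.exists_equiv_fin κ
  set k : Fin q → ι := a ∘ eq.symm with hk
  have hli' : LinearIndependent ℂ (fun j => F (k j) x₀) := hli.comp _ eq.symm.injective
  have hspan' : Submodule.span ℂ (Set.range fun j => F (k j) x₀) =
      Submodule.span ℂ (Set.range fun i => F i x₀) := by
    rw [← hspan, ← eq.symm.surjective.range_comp]
    rfl
  have hq : rk x₀ = q := by
    rw [hrk]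
    simp only
    rw [← hspan', finrank_span_eq_card hli', Fintype.card_fin]
  -- `g` maps the chosen vectors at `x₀` to the standard basis, so the determinant is `1` there;
  -- wherever it is nonzero, the chosen vectors are independent.
  obtain ⟨g, hg⟩ := LinearMap.exists_leftInverse_of_injective
    (Fintype.linearCombination ℂ (fun j => F (k j) x₀))
    (LinearMap.ker_eq_bot.2 (linearIndependent_iff_injective_fintypeLinearCombination.1 hli'))
  have hgj : ∀ j, g (F (k j) x₀) = Pi.single j 1 := fun j => by
    have := LinearMap.congr_fun hg (Pi.single j 1)
    simpa [Fintype.linearCombination_apply_single] using this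
  refine ⟨x₀, hx₀, q, k, LinearMap.toContinuousLinearMap g, ?_, fun x hx hdet i => ?_⟩
  · have : (Matrix.of fun a j => (LinearMap.toContinuousLinearMap g) (F (k j) x₀) a) = 1 := by
      ext a j
      simp [hgj, Matrix.one_apply, Pi.single_apply]
    rw [this, Matrix.det_one]
  · set π := LinearMap.toContinuousLinearMap g
    set N : Matrix (Fin q) (Fin q) ℂ := Matrix.of fun a j => π (F (k j) x) a with hN
    have hU : IsUnit N.det := isUnit_iff_ne_zero.2 hdet
    have hπ : ∀ c : Fin q → ℂ, π (∑ j, c j • F (k j) x) = N.mulVec c := by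
      intro c
      ext a
      simp [hN, Matrix.mulVec, dotProduct, mul_comm]
    have hlix : LinearIndependent ℂ (fun j => F (k j) x) := by
      rw [Fintype.linearIndependent_iff]
      intro c hc
      have h1 := hπ c
      rw [hc, map_zero] at h1
      have h2 : N⁻¹.mulVec (N.mulVec c) = c := by
        rw [Matrix.mulVec_mulVec, Matrix.nonsing_inv_mul _ hU, Matrix.one_mulVec]
      rw [← h1, Matrix.mulVec_zero] at h2
      intro j
      rw [← h2]; rfl
    have hle : Submodule.span ℂ (Set.range fun j => F (k j) x) ≤
        Submodule.span ℂ (Set.range fun i => F i x) := by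
      refine Submodule.span_mono ?_
      rintro _ ⟨j, rfl⟩
      exact ⟨k j, rfl⟩
    -- The rank at `x` cannot exceed the maximal rank `q`, so `q` independent vectors span.
    have heq := Submodule.eq_of_le_of_finrank_le hle (by
      rw [finrank_span_eq_card hlix, Fintype.card_fin, ← hq, hmax]
      exact le_csSup hbd ⟨x, hx, rfl⟩)
    have hmem : F i x ∈ Submodule.span ℂ (Set.range fun j => F (k j) x) := by
      rw [heq]; exact Submodule.subset_span ⟨i, rfl⟩
    obtain ⟨c, hc⟩ := (Submodule.mem_span_range_iff_exists_fun ℂ).1 hmem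
    have h1 := hπ c
    rw [hc] at h1
    rw [h1, Matrix.mulVec_mulVec, Matrix.nonsing_inv_mul _ hU, Matrix.one_mulVec, hc]

lemma Matrix.norm_det_le_of_norm_le {q : ℕ} {A : Matrix (Fin q) (Fin q) ℂ} {x : ℝ}
    (h : ∀ i j, ‖A i j‖ ≤ x) : ‖A.det‖ ≤ q.factorial * x ^ q := by
  have := Matrix.det_le (A := A) (abv := NormedField.toAbsoluteValue ℂ) (x := x) h
  rw [nsmul_eq_mul, Fintype.card_fin] at this
  exact this

lemma Matrix.norm_adjugate_le_of_norm_le {q : ℕ} {A : Matrix (Fin q) (Fin q) ℂ} {x : ℝ}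
    (hx : 1 ≤ x) (h : ∀ i j, ‖A i j‖ ≤ x) (i j : Fin q) :
    ‖A.adjugate i j‖ ≤ q.factorial * x ^ q := by
  rw [Matrix.adjugate_apply]
  refine Matrix.norm_det_le_of_norm_le fun a b => ?_
  rw [Matrix.updateRow_apply]
  split_ifs
  · rw [Pi.single_apply]
    split_ifs
    · simpa using hx
    · simp; linarith
  · exact h a b

lemma LineHolomorphicOn.det {E G : Type} [NormedAddCommGroup E] [NormedSpace ℂ E]
    [NormedAddCommGroup G] [NormedSpace ℂ G] {q : ℕ} {F : Fin q → E → G} {s : Set E}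
    (hF : ∀ j, LineHolomorphicOn (F j) s) (π : G →L[ℂ] (Fin q → ℂ)) :
    LineHolomorphicOn (fun x => (Matrix.of fun a j => π (F j x) a).det) s := by
  intro x hx v
  simp only [Matrix.det_apply, Matrix.of_apply]
  refine DifferentiableAt.fun_sum fun σ _ => DifferentiableAt.const_smul ?_ _
  refine DifferentiableAt.fun_finsetProd fun j _ => ?_
  exact (differentiableAt_pi.1 (((hF j).clm_comp π) x hx v)) (σ j)

/-- The core estimate of the induction step, at a single point where the determinant is nonzero. -/
lemma norm_le_of_division {G ι : Type} [AddCommGroup G] [Module ℂ G]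
    {q b : ℕ} {f : ι → G} {k : Fin q → ι} {p : ι → Fin q → ℂ}
    {N : Matrix (Fin q) (Fin q) ℂ} (hN : N.det ≠ 0)
    (hf : ∀ i, f i = ∑ j, (N⁻¹.mulVec (p i)) j • f (k j))
    {CA C₁ C₂ : ℝ} (hCA0 : 0 ≤ CA) (hC₂ : 0 ≤ C₂)
    (hCA : ∀ i j, ‖N.adjugate i j‖ ≤ CA) {u : ι → Fin q → ℂ}
    (hu : ∀ i a, ‖u i a‖ ≤ C₁) {r : ι → Fin q → Fin b → ℂ} {w : ℂ}
    (hdiv : ∀ i a, p i a = N.det * u i a + ∑ l, r i a l * w ^ (l : ℕ)) {S' : Finset ι}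
    (hdom : ∀ i, ∀ ξ : (Fin q → Fin b → ℂ) →L[ℂ] ℂ, ‖ξ (r i)‖ ≤ C₂ * ∑ j ∈ S', ‖ξ (r j)‖)
    (ξ : G →ₗ[ℂ] ℂ) (i : ι) :
    ‖ξ (f i)‖ ≤ (1 + C₂ * S'.card) * (q * CA * C₁) * ∑ j, ‖ξ (f (k j))‖ +
      C₂ * ∑ j ∈ S', ‖ξ (f j)‖ := by
  set X : ℝ := ∑ j, ‖ξ (f (k j))‖ with hX
  have hX0 : 0 ≤ X := Finset.sum_nonneg fun j _ => norm_nonneg _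
  -- `η` is `ξ` expressed in the coordinates of the chosen basis. It has a pole where the
  -- determinant vanishes, but `N.det * η` is bounded by Cramer's rule.
  set η : Fin q → ℂ := fun a => ∑ j, N⁻¹ j a * ξ (f (k j)) with hη
  have h1 : ∀ i, ξ (f i) = ∑ a, η a * p i a := by
    intro i
    conv_lhs => rw [hf i, map_sum]
    simp only [map_smul, smul_eq_mul, Matrix.mulVec, dotProduct, hη, Finset.sum_mul]
    rw [Finset.sum_comm]
    exact Finset.sum_congr rfl fun a _ => Finset.sum_congr rfl fun j _ => by ring
  have h2 : ∀ a, ‖N.det * η a‖ ≤ CA * X := by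
    intro a
    have : N.det * η a = ∑ j, N.adjugate j a * ξ (f (k j)) := by
      rw [hη, Finset.mul_sum]
      refine Finset.sum_congr rfl fun j _ => ?_
      rw [Matrix.inv_def, Matrix.smul_apply, smul_eq_mul, Ring.inverse_eq_inv', ← mul_assoc,
        ← mul_assoc, mul_inv_cancel₀ hN, one_mul]
    rw [this, hX, Finset.mul_sum]
    refine (norm_sum_le _ _).trans (Finset.sum_le_sum fun j _ => ?_)
    rw [norm_mul]
    exact mul_le_mul_of_nonneg_right (hCA j a) (norm_nonneg _)
  -- The functional on remainder coefficients induced by `ξ`. It depends on the point, so the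
  -- induction hypothesis must hold for all functionals.
  set L : (Fin q → Fin b → ℂ) →L[ℂ] ℂ := LinearMap.toContinuousLinearMap
    { toFun := fun y => ∑ a, η a * ∑ l, y a l * w ^ (l : ℕ)
      map_add' := fun y z => by
        simp only [Pi.add_apply, add_mul, Finset.sum_add_distrib, mul_add]
      map_smul' := fun c y => by
        simp only [Pi.smul_apply, smul_eq_mul, RingHom.id_apply, Finset.mul_sum]
        exact Finset.sum_congr rfl fun a _ => Finset.sum_congr rfl fun l _ => by ring } with hL
  have hLr : ∀ i, L (r i) = ∑ a, η a * ∑ l, r i a l * w ^ (l : ℕ) := fun i => rfl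
  -- The difference is the quotient part of the division; its factor `N.det` cancels the pole of
  -- `η`.
  have h3 : ∀ i, ‖ξ (f i) - L (r i)‖ ≤ q * CA * C₁ * X := by
    intro i
    have : ξ (f i) - L (r i) = ∑ a, (N.det * η a) * u i a := by
      rw [h1, hLr, ← Finset.sum_sub_distrib]
      refine Finset.sum_congr rfl fun a _ => ?_
      rw [hdiv]; ring
    rw [this]
    calc ‖∑ a, (N.det * η a) * u i a‖ ≤ ∑ _a : Fin q, CA * X * C₁ := by
          refine (norm_sum_le _ _).trans (Finset.sum_le_sum fun a _ => ?_)
          rw [norm_mul]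
          exact mul_le_mul (h2 a) (hu i a) (norm_nonneg _) (by positivity)
      _ = q * CA * C₁ * X := by simp; ring
  have h4 : ∀ i, ‖L (r i)‖ ≤ ‖ξ (f i)‖ + q * CA * C₁ * X := fun i => by
    have := norm_sub_norm_le (L (r i)) (ξ (f i))
    rw [norm_sub_rev] at this
    linarith [h3 i]
  have h5 : ∑ j ∈ S', ‖L (r j)‖ ≤ ∑ j ∈ S', ‖ξ (f j)‖ + S'.card * (q * CA * C₁ * X) := by
    refine (Finset.sum_le_sum fun j _ => h4 j).trans (le_of_eq ?_)
    rw [Finset.sum_add_distrib, Finset.sum_const, nsmul_eq_mul]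
  have h6 := norm_sub_norm_le (ξ (f i)) (L (r i))
  have h7 := (hdom i L).trans (mul_le_mul_of_nonneg_left h5 hC₂)
  have := h3 i
  linarith

lemma sum_fin_le_card_mul {ι : Type} {q : ℕ} {k : Fin q → ι} {S : Finset ι} (hS : ∀ j, k j ∈ S)
    {c : ι → ℝ} (hc : ∀ i, 0 ≤ c i) : ∑ j, c (k j) ≤ q * ∑ i ∈ S, c i := by
  calc ∑ j, c (k j) ≤ ∑ _j : Fin q, ∑ i ∈ S, c i :=
        Finset.sum_le_sum fun j _ => Finset.single_le_sum (fun i _ => hc i) (hS j)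
    _ = q * ∑ i ∈ S, c i := by simp

/-- A bounded family of holomorphic maps on a ball is, near the center, pointwise dominated by a
finite subfamily. -/
theorem exists_finite_dominating {ι : Type} (m : ℕ) :
    ∀ (E : Type) [NormedAddCommGroup E] [NormedSpace ℂ E] [FiniteDimensional ℂ E]
      (_ : Module.finrank ℂ E = m) (G : Type) [NormedAddCommGroup G] [NormedSpace ℂ G]
      [FiniteDimensional ℂ G] (F : ι → E → G) (δ M : ℝ) (_ : 0 < δ)
      (_ : ∀ i, LineHolomorphicOn (F i) (ball 0 δ))
      (_ : ∀ i, ∀ x ∈ ball (0 : E) δ, ‖F i x‖ ≤ M),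
      ∃ (S : Finset ι) (C ε : ℝ), 0 < ε ∧ 0 ≤ C ∧ ∀ x ∈ ball (0 : E) ε, ∀ i,
        ∀ ξ : G →L[ℂ] ℂ, ‖ξ (F i x)‖ ≤ C * ∑ j ∈ S, ‖ξ (F j x)‖ := by
  classical
  -- The induction passes to a hyperplane `E'` and to the space of remainder coefficients, so domain
  -- and target both vary.
  induction m with
  | zero =>
    intro E _ _ _ hE G _ _ _ F δ M hδ hF hM
    have hsub : Subsingleton E := Module.finrank_zero_iff.1 hE
    obtain ⟨x₀, hx₀, q, k, π, hdet, hspan⟩ := exists_maximal_rank_subfamily F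
      (s := ball (0 : E) δ) ⟨0, mem_ball_self hδ⟩
    set N : Matrix (Fin q) (Fin q) ℂ := Matrix.of fun a j => π (F (k j) x₀) a with hN
    have hN0 : N.det ≠ 0 := by rw [hdet]; exact one_ne_zero
    obtain ⟨c, hc⟩ : ∃ c, ∀ j a, ‖N⁻¹ j a‖ ≤ c := by
      obtain ⟨c, hc⟩ := (Set.finite_range fun p : Fin q × Fin q => ‖N⁻¹ p.1 p.2‖).bddAbove
      exact ⟨c, fun j a => hc ⟨(j, a), rfl⟩⟩
    refine ⟨Finset.univ.image k, q * (|c| * (‖π‖ * |M|)) * q, 1, one_pos, by positivity,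
      fun x _ i ξ => ?_⟩
    obtain rfl : x = x₀ := Subsingleton.elim _ _
    have h1 : ∀ j, ‖(N⁻¹.mulVec (π (F i x))) j‖ ≤ q * (|c| * (‖π‖ * |M|)) := by
      intro j
      calc ‖(N⁻¹.mulVec (π (F i x))) j‖ ≤ ∑ _a : Fin q, |c| * (‖π‖ * |M|) := by
            rw [Matrix.mulVec, dotProduct]
            refine (norm_sum_le _ _).trans (Finset.sum_le_sum fun a _ => ?_)
            rw [norm_mul]
            refine mul_le_mul ((hc j a).trans (le_abs_self c)) ?_ (norm_nonneg _) (abs_nonneg _)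
            refine (norm_le_pi_norm _ a).trans ((π.le_opNorm _).trans ?_)
            exact mul_le_mul_of_nonneg_left ((hM i x hx₀).trans (le_abs_self M)) (norm_nonneg _)
        _ = _ := by simp
    rw [mul_assoc]
    refine le_trans ?_ (mul_le_mul_of_nonneg_left
      (sum_fin_le_card_mul (k := k) (S := Finset.univ.image k) (by simp)
      (fun i => norm_nonneg (ξ (F i x)))) (by positivity))
    conv_lhs => rw [hspan x hx₀ hN0 i, map_sum]
    rw [Finset.mul_sum]
    refine (norm_sum_le _ _).trans (Finset.sum_le_sum fun j _ => ?_)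
    rw [map_smul, norm_smul]
    exact mul_le_mul_of_nonneg_right (h1 j) (norm_nonneg _)
  | succ m ih =>
    intro E _ _ _ hE G _ _ _ F δ M hδ hF hM
    obtain ⟨x₀, hx₀, q, k, π, hdet, hspan⟩ := exists_maximal_rank_subfamily F
      (s := ball (0 : E) δ) ⟨0, mem_ball_self hδ⟩
    set D : E → ℂ := fun x => (Matrix.of fun a j => π (F (k j) x) a).det with hDdef
    have hD : LineHolomorphicOn D (ball 0 δ) := LineHolomorphicOn.det (fun j => hF (k j)) π
    set M₁ : ℝ := max 1 (‖π‖ * |M|) with hM₁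
    have hπF : ∀ i a, ∀ x ∈ ball (0 : E) δ, ‖π (F i x) a‖ ≤ M₁ := by
      intro i a x hx
      refine (norm_le_pi_norm _ a).trans ((π.le_opNorm _).trans (le_max_of_le_right ?_))
      exact mul_le_mul_of_nonneg_left ((hM i x hx).trans (le_abs_self M)) (norm_nonneg _)
    set CA : ℝ := q.factorial * M₁ ^ q with hCA
    have hM₁1 : 1 ≤ M₁ := le_max_left _ _
    have hCA0 : 0 ≤ CA := by positivity
    have hDM : ∀ x ∈ ball (0 : E) δ, ‖D x‖ ≤ CA := fun x hx =>
      Matrix.norm_det_le_of_norm_le fun a j => hπF (k j) a x hx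
    have hadj : ∀ x ∈ ball (0 : E) δ, ∀ a j,
        ‖(Matrix.of fun a j => π (F (k j) x) a).adjugate a j‖ ≤ CA := fun x hx =>
      Matrix.norm_adjugate_le_of_norm_le hM₁1 fun a j => hπF (k j) a x hx
    -- A nonzero point is needed to define a direction; if `x₀ = 0`, move off it slightly by
    -- continuity along a line.
    obtain ⟨x₁, hx₁, hx₁0, hDx₁⟩ : ∃ x ∈ ball (0 : E) δ, x ≠ 0 ∧ D x ≠ 0 := by
      have hDx₀ : D x₀ ≠ 0 := by rw [hDdef]; simp only; rw [hdet]; exact one_ne_zero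
      rcases ne_or_eq x₀ 0 with h | rfl
      · exact ⟨x₀, hx₀, h, hDx₀⟩
      · have : Nontrivial E := Module.nontrivial_of_finrank_pos (R := ℂ) (by omega)
        obtain ⟨v, hv⟩ := exists_ne (0 : E)
        have hc : Continuous fun t : ℂ => (0 : E) + t • v := by fun_prop
        have h1 : ∀ᶠ t in nhds (0 : ℂ), (0 : E) + t • v ∈ ball (0 : E) δ :=
          (isOpen_ball.preimage hc).mem_nhds (by simpa using hδ)
        have h2 : ∀ᶠ t in nhds (0 : ℂ), D ((0 : E) + t • v) ≠ 0 :=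
          (hD 0 hx₀ v).continuousAt.eventually_ne (by simpa using hDx₀)
        obtain ⟨t, ⟨ht1, ht2⟩, ht3⟩ := ((h1.and h2).filter_mono nhdsWithin_le_nhds |>.and
          (self_mem_nhdsWithin (s := {(0 : ℂ)}ᶜ))).exists
        exact ⟨_, ht1, by rw [zero_add]; exact smul_ne_zero ht3 hv, ht2⟩
    obtain ⟨e, he0, heδ, b, h, hh, hDe⟩ := hD.exists_regular_direction hδ hx₁ hx₁0 hDx₁
    obtain ⟨ε₁, hε₁, C₁, hC₁, hdiv⟩ := hD.exists_division hδ hDM heδ hh hDe M₁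
    have hcomp : ∀ i a, LineHolomorphicOn (fun x => π (F i x) a) (ball 0 δ) := fun i a =>
      (hF i).clm_comp ((ContinuousLinearMap.proj a).comp π)
    choose u r hr hur using fun i a => hdiv (fun x => π (F i x) a) (hcomp i a) (hπF i a)
    -- Since `ψ e = 1`, each `x` is `y + ψ x • e` with `y` in the kernel of `ψ`, where the
    -- remainders are functions of one variable fewer.
    obtain ⟨ψ, hψ⟩ := SeparatingDual.exists_eq_one (R := ℂ) he0
    set E' := LinearMap.ker (ψ : E →ₗ[ℂ] ℂ) with hE'
    have hfr : Module.finrank ℂ E' = m := by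
      have h1 : (ψ : E →ₗ[ℂ] ℂ) ≠ 0 := by
        intro h0
        have := LinearMap.congr_fun h0 e
        rw [ContinuousLinearMap.coe_coe, hψ] at this
        exact one_ne_zero this
      have := Module.Dual.finrank_ker_add_one_of_ne_zero (f := (ψ : E →ₗ[ℂ] ℂ)) h1
      exact Nat.add_right_cancel (this.trans hE)
    obtain ⟨S', C₂, ε₂, hε₂, hC₂, hdom⟩ := ih E' hfr (Fin q → Fin b → ℂ)
      (fun i y a => r i a (y : E)) ε₁ C₁ hε₁
      (fun i y hy v => differentiableAt_pi.2 fun a => by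
        have := hr i a (y : E) (by simpa using hy) (v : E)
        simpa using this)
      (fun i y hy => (pi_norm_le_iff_of_nonneg hC₁).2 fun a =>
        (hur i a (y : E) (by simpa using hy)).1)
    set P : ℝ := 1 + ‖ψ‖ * ‖e‖ + ‖ψ‖ with hP
    have hP1 : 0 < P := by positivity
    set ε : ℝ := min (min ε₁ ε₂) (min 1 δ) / P with hε
    have hε0 : 0 < ε := by positivity
    have hsmall : ∀ x ∈ ball (0 : E) ε, ‖ψ x‖ ≤ 1 ∧ x ∈ ball (0 : E) δ ∧
        x - ψ x • e ∈ ball (0 : E) (min ε₁ ε₂) := by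
      intro x hx
      rw [mem_ball_zero_iff, hε, lt_div_iff₀ hP1, hP] at hx
      have h1 : ‖ψ x‖ ≤ ‖ψ‖ * ‖x‖ := ψ.le_opNorm x
      have h2 : ‖x - ψ x • e‖ ≤ ‖x‖ + ‖ψ‖ * ‖x‖ * ‖e‖ := by
        refine (norm_sub_le _ _).trans (add_le_add le_rfl ?_)
        rw [norm_smul]
        exact mul_le_mul_of_nonneg_right h1 (norm_nonneg _)
      have h3 : 0 ≤ ‖ψ‖ * ‖x‖ * ‖e‖ := by positivity
      have h4 : 0 ≤ ‖ψ‖ * ‖x‖ := by positivity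
      have h5 := (lt_min_iff.1 hx).1
      have h6 := (lt_min_iff.1 (lt_min_iff.1 hx).2)
      have h7 := norm_nonneg x
      refine ⟨by linarith [h6.1], ?_, ?_⟩
      · rw [mem_ball_zero_iff]; linarith [h6.2]
      · rw [mem_ball_zero_iff]; linarith
    set S : Finset ι := S' ∪ Finset.univ.image k with hS
    set B : ℝ := (1 + C₂ * S'.card) * (q * CA * C₁) with hB
    have hB0 : 0 ≤ B := by positivity
    have main : ∀ x ∈ ball (0 : E) ε, D x ≠ 0 → ∀ i, ∀ ξ : G →L[ℂ] ℂ,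
        ‖ξ (F i x)‖ ≤ (B * q + C₂) * ∑ j ∈ S, ‖ξ (F j x)‖ := by
      intro x hx hDx i ξ
      obtain ⟨hw, hxδ, hy⟩ := hsmall x hx
      set w := ψ x
      set y := x - w • e with hydef
      have hxy : y + w • e = x := sub_add_cancel _ _
      have hyE : y ∈ E' := by
        rw [hE', LinearMap.mem_ker, ContinuousLinearMap.coe_coe, hydef, map_sub, map_smul, hψ,
          smul_eq_mul, mul_one, sub_self]
      have hy1 : y ∈ ball (0 : E) ε₁ := ball_subset_ball (min_le_left _ _) hy
      have hy2 : (⟨y, hyE⟩ : E') ∈ ball (0 : E') ε₂ := by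
        rw [mem_ball_zero_iff]
        exact (mem_ball_zero_iff.1 hy).trans_le (min_le_right _ _)
      have key := norm_le_of_division (f := fun i => F i x) (k := k) (p := fun i => π (F i x))
        (N := Matrix.of fun a j => π (F (k j) x) a) hDx (hspan x hxδ hDx) hCA0 hC₂
        (hadj x hxδ) (u := fun i a => u i a y w) (fun i a => ((hur i a y hy1).2 w hw).1)
        (r := fun i a => r i a y) (w := w)
        (fun i a => by
          have := ((hur i a y hy1).2 w hw).2
          rw [hxy] at this
          exact this)
        (S' := S') (fun i ξ => hdom ⟨y, hyE⟩ hy2 i ξ) (ξ : G →ₗ[ℂ] ℂ) i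
      simp only [ContinuousLinearMap.coe_coe] at key
      refine key.trans ?_
      rw [add_mul (B * q) C₂, mul_assoc B]
      refine add_le_add (mul_le_mul_of_nonneg_left ?_ hB0) (mul_le_mul_of_nonneg_left ?_ hC₂)
      · exact sum_fin_le_card_mul (S := S) (fun j => Finset.mem_union_right _ (by simp))
          (c := fun i => ‖ξ (F i x)‖) (fun _ => norm_nonneg _)
      · exact Finset.sum_le_sum_of_subset_of_nonneg Finset.subset_union_left
          fun _ _ _ => norm_nonneg _
    -- The zeros of `D` are handled by continuity: points approaching `x` along the line towards
    -- `x₁` avoid them.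
    refine ⟨S, B * q + C₂, ε, hε0, by positivity, fun x hx i ξ => ?_⟩
    have hxδ := (hsmall x hx).2.1
    have hv : x + (x₁ - x) ∈ ball (0 : E) δ := by rwa [add_sub_cancel]
    have h1 := hD.eventually_ne_zero hxδ hv (by rwa [add_sub_cancel])
    have hc : Continuous fun t : ℂ => x + t • (x₁ - x) := by fun_prop
    have h2 : ∀ᶠ t in nhds (0 : ℂ), x + t • (x₁ - x) ∈ ball (0 : E) ε :=
      (isOpen_ball.preimage hc).mem_nhds (by simpa using hx)
    have hlim : ∀ i, Filter.Tendsto (fun t : ℂ => ‖ξ (F i (x + t • (x₁ - x)))‖)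
        (nhdsWithin 0 {0}ᶜ) (nhds ‖ξ (F i x)‖) := by
      intro i
      have h3 := (((hF i).clm_comp ξ) x hxδ (x₁ - x)).continuousAt.norm.tendsto
      simp only [zero_smul, add_zero] at h3
      exact h3.mono_left nhdsWithin_le_nhds
    refine le_of_tendsto_of_tendsto (hlim i)
      ((tendsto_finsetSum S fun j _ => hlim j).const_mul (B * q + C₂)) ?_
    filter_upwards [h1, nhdsWithin_le_nhds h2] with t ht1 ht2
    exact main _ ht2 ht1 i ξ

end Domination

/-! ### Uniform polynomial growth on complex lines -/

section Growth

open Metric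

/-- The coefficients are at most `2 ^ i * Y`, so at `‖z‖ ≤ 1 / 4` the Taylor series is dominated by
`Y * ∑ 2 ^ (-i)`; the Taylor remainder after `b` terms is at most `2 ^ (-b) * ‖Φ‖`. -/
lemma DiskAlg.norm_eval_le_of_coeff {Φ : DiskAlg} {Y : ℝ}
    (hY : ∀ i, (1 / 2) ^ i * ‖DiskAlg.coeffL i Φ‖ ≤ Y) {z : ℂ} (hz : ‖z‖ ≤ 1 / 4) :
    ‖Φ.eval z‖ ≤ 2 * Y := by
  have hz1 : ‖z‖ ≤ 1 := hz.trans (by norm_num)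
  have hY0 : 0 ≤ Y := (by positivity : (0 : ℝ) ≤ _).trans (hY 0)
  have key : ∀ b : ℕ, ‖Φ.eval z‖ ≤ 2 * Y + (1 / 2) ^ b * ‖Φ‖ := by
    intro b
    rw [Φ.eval_eq_sum b hz1]
    refine (norm_add_le _ _).trans (add_le_add ?_ ?_)
    · calc ‖∑ i ∈ Finset.range b, DiskAlg.coeffL i Φ * z ^ i‖
          ≤ ∑ i ∈ Finset.range b, (1 / 2) ^ i * Y := by
            refine (norm_sum_le _ _).trans (Finset.sum_le_sum fun i _ => ?_)
            rw [norm_mul, norm_pow]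
            calc ‖DiskAlg.coeffL i Φ‖ * ‖z‖ ^ i ≤ ‖DiskAlg.coeffL i Φ‖ * (1 / 4) ^ i :=
                  mul_le_mul_of_nonneg_left (pow_le_pow_left₀ (norm_nonneg _) hz i) (norm_nonneg _)
              _ = (1 / 2) ^ i * ((1 / 2) ^ i * ‖DiskAlg.coeffL i Φ‖) := by
                  rw [← mul_assoc, ← mul_pow, mul_comm]; norm_num
              _ ≤ _ := mul_le_mul_of_nonneg_left (hY i) (by positivity)
        _ = (∑ i ∈ Finset.range b, (1 / 2 : ℝ) ^ i) * Y := by rw [Finset.sum_mul]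
        _ ≤ 2 * Y := mul_le_mul_of_nonneg_right (sum_geometric_two_le b) hY0
    · rw [norm_mul, norm_pow]
      have h1 := DiskAlg.norm_eval_shiftL_pow_le Φ one_pos le_rfl
        (fun w _ => Φ.norm_eval_le w) b z hz1
      rw [div_one] at h1
      calc ‖z‖ ^ b * _ ≤ (1 / 4) ^ b * (2 ^ b * ‖Φ‖) :=
            mul_le_mul (pow_le_pow_left₀ (norm_nonneg _) hz b) h1 (norm_nonneg _) (by positivity)
        _ = (1 / 2) ^ b * ‖Φ‖ := by rw [← mul_assoc, ← mul_pow]; norm_num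
  have hlim : Filter.Tendsto (fun b : ℕ => 2 * Y + (1 / 2 : ℝ) ^ b * ‖Φ‖) Filter.atTop
      (nhds (2 * Y + 0 * ‖Φ‖)) :=
    tendsto_const_nhds.add ((tendsto_pow_atTop_nhds_zero_of_lt_one (by norm_num)
      (by norm_num)).mul_const _)
  rw [zero_mul, add_zero] at hlim
  exact ge_of_tendsto hlim (Filter.Eventually.of_forall key)

variable {V : Type} [NormedAddCommGroup V] [NormedSpace ℂ V]

/-- Uniform polynomial growth of the restrictions of `f` to the complex lines through the
points of `s`. -/
def HasUniformGrowth (f : V → ℂ) (s : Set V) (R C : ℝ) (N : ℕ) : Prop :=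
  ∀ x ∈ s, ∀ v : V, ‖v‖ = 1 → ∀ l : ℝ, 0 < l → l ≤ R → ∀ B : ℝ,
    (∀ z : ℂ, ‖z‖ ≤ l → ‖f (x + z • v)‖ ≤ B) →
    ∀ z : ℂ, ‖z‖ ≤ R → ‖f (x + z • v)‖ ≤ C * (1 / l) ^ N * B

lemma HasUniformGrowth.weaken {f : V → ℂ} {s t : Set V} {R R' C C' : ℝ} {N N' : ℕ}
    (h : HasUniformGrowth f s R C N) (hts : t ⊆ s) (hR : R' ≤ R) (hR1 : R ≤ 1) (hC0 : 0 ≤ C)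
    (hC : C ≤ C') (hN : N ≤ N') : HasUniformGrowth f t R' C' N' := by
  intro x hx v hv l hl hlR B hB z hz
  have hB0 : 0 ≤ B := (norm_nonneg _).trans (hB 0 (by simpa using hl.le))
  refine (h x (hts hx) v hv l hl (hlR.trans hR) B hB z (hz.trans hR)).trans ?_
  have h1 : 1 ≤ 1 / l := by rw [le_div_iff₀ hl]; linarith
  gcongr
  exact hC0.trans hC

variable [FiniteDimensional ℂ V]

/-- Near the center, the restrictions to all small disks of a bounded holomorphic function grow
at most polynomially, uniformly. -/
lemma exists_growth_of_small_disks {f : V → ℂ} {ρ M : ℝ} (hρ : 0 < ρ) {x₀ : V}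
    (hf : DifferentiableOn ℂ f (ball x₀ (2 * ρ))) (hM : ∀ x ∈ ball x₀ (2 * ρ), ‖f x‖ ≤ M) :
    ∃ ε > 0, ∃ C, 0 ≤ C ∧ ∃ N : ℕ, ∀ y v : V, ‖y‖ < ε → ‖v‖ < ε → ∀ l : ℝ, 0 < l → l ≤ 1 →
      ∀ B, (∀ z : ℂ, ‖z‖ ≤ l → ‖f (x₀ + y + z • v)‖ ≤ B) →
      ∀ z : ℂ, ‖z‖ ≤ 1 / 4 → ‖f (x₀ + y + z • v)‖ ≤ C * (1 / l) ^ N * B := by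
  classical
  have hmem : ∀ p ∈ ball (0 : V × V) ρ, ∀ z : ℂ, ‖z‖ ≤ 1 →
      x₀ + p.1 + z • p.2 ∈ ball x₀ (2 * ρ) := by
    intro p hp z hz
    rw [mem_ball_zero_iff, Prod.norm_def, max_lt_iff] at hp
    rw [mem_ball, dist_eq_norm, add_assoc, add_sub_cancel_left]
    have h1 : ‖z • p.2‖ ≤ ‖p.2‖ := by
      rw [norm_smul]; exact mul_le_of_le_one_left (norm_nonneg _) hz
    linarith [norm_add_le p.1 (z • p.2), hp.1, hp.2]
  have hd : ∀ p ∈ ball (0 : V × V) ρ,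
      DiffContOnCl ℂ (fun z : ℂ => f (x₀ + p.1 + z • p.2)) (ball 0 1) := by
    intro p hp
    refine DifferentiableOn.diffContOnCl fun z hz => DifferentiableAt.differentiableWithinAt ?_
    rw [closure_ball _ one_ne_zero, mem_closedBall_zero_iff] at hz
    exact DifferentiableAt.comp (f := fun z : ℂ => x₀ + p.1 + z • p.2) z
      (hf.differentiableAt (isOpen_ball.mem_nhds (hmem p hp z hz))) (by fun_prop)
  set Φ : V × V → DiskAlg := fun p =>
    if h : DiffContOnCl ℂ (fun z : ℂ => f (x₀ + p.1 + z • p.2)) (ball 0 1) then DiskAlg.mk _ h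
    else 0 with hΦ
  have hev : ∀ p ∈ ball (0 : V × V) ρ, ∀ z : ℂ, ‖z‖ ≤ 1 →
      (Φ p).eval z = f (x₀ + p.1 + z • p.2) := by
    intro p hp z hz
    rw [hΦ]
    simp only
    rw [dif_pos (hd p hp), DiskAlg.eval_mk _ hz]
  have hM0 : 0 ≤ M := (norm_nonneg _).trans (hM x₀ (mem_ball_self (by positivity)))
  have hn : ∀ p ∈ ball (0 : V × V) ρ, ‖Φ p‖ ≤ M := fun p hp =>
    DiskAlg.norm_le hM0 fun z hz => by
      rw [hev p hp z hz]; exact hM _ (hmem p hp z hz)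
  have hl : LineHolomorphicOn Φ (ball 0 ρ) := by
    intro p hp h
    have hc : Continuous fun t : ℂ => p + t • h := by fun_prop
    obtain ⟨η, hη, hsub⟩ := Metric.isOpen_iff.1 (isOpen_ball.preimage hc) (0 : ℂ)
      (show p + (0 : ℂ) • h ∈ ball (0 : V × V) ρ by simpa using hp)
    refine DiskAlg.differentiableAt_of_eval hη (fun z hz t ht => ?_)
      (fun t ht => hn _ (hsub ht))
    have h1 : DifferentiableAt ℂ
        (fun t : ℂ => f (x₀ + (p + t • h).1 + z • (p + t • h).2)) t :=
      DifferentiableAt.comp (f := fun t : ℂ => x₀ + (p + t • h).1 + z • (p + t • h).2) t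
        (hf.differentiableAt (isOpen_ball.mem_nhds (hmem _ (hsub ht) z hz))) (by fun_prop)
    refine (h1.congr_of_eventuallyEq ?_).differentiableWithinAt
    filter_upwards [isOpen_ball.mem_nhds ht] with t' ht'
    exact hev _ (hsub ht') z hz
  -- The weight `(1 / 2) ^ i` offsets the factor `2 ^ i` of the shift estimate, so the whole family
  -- of coefficients is bounded by `M`.
  obtain ⟨S, C, ε, hε, hC, hdom⟩ := exists_finite_dominating (ι := ℕ) _ (V × V) rfl ℂ
    (fun i p => ((1 / 2 : ℂ) ^ i) * DiskAlg.coeffL i (Φ p)) ρ M hρ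
    (fun i p hp h => (differentiableAt_const _).mul ((hl.clm_comp (DiskAlg.coeffL i)) p hp h))
    (fun i p hp => by
      have h1 := DiskAlg.norm_coeffL_le (Φ p) one_pos le_rfl
        (fun w _ => ((Φ p).norm_eval_le w).trans (hn p hp)) i
      rw [norm_mul, norm_pow]
      refine (mul_le_mul_of_nonneg_left h1 (by positivity)).trans (le_of_eq ?_)
      rw [← mul_assoc, ← mul_pow]
      norm_num)
  -- The growth exponent is the largest index among the finitely many dominating coefficients.
  refine ⟨min ε ρ, by positivity, 2 * (C * S.card), by positivity, S.sup id,
    fun y v hy hv l hl0 hl1 B hB z hz => ?_⟩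
  have hB0 : 0 ≤ B := (norm_nonneg _).trans (hB 0 (by simpa using hl0.le))
  have hpε : (y, v) ∈ ball (0 : V × V) ε := by
    rw [mem_ball_zero_iff, Prod.norm_def, max_lt_iff]
    exact ⟨hy.trans_le (min_le_left _ _), hv.trans_le (min_le_left _ _)⟩
  have hpρ : (y, v) ∈ ball (0 : V × V) ρ := by
    rw [mem_ball_zero_iff, Prod.norm_def, max_lt_iff]
    exact ⟨hy.trans_le (min_le_right _ _), hv.trans_le (min_le_right _ _)⟩
  have hcoef : ∀ j, ‖((1 / 2 : ℂ) ^ j) * DiskAlg.coeffL j (Φ (y, v))‖ ≤ (1 / l) ^ j * B := by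
    intro j
    have h1 := DiskAlg.norm_coeffL_le (Φ (y, v)) hl0 hl1 (s := B) (fun w hw => by
      rw [hev _ hpρ w (hw.trans hl1)]; exact hB w hw) j
    rw [norm_mul, norm_pow]
    refine (mul_le_mul_of_nonneg_left h1 (by positivity)).trans (le_of_eq ?_)
    rw [← mul_assoc, ← mul_pow]
    congr 2
    norm_num
    field_simp
  have h1l : 1 ≤ 1 / l := by rw [le_div_iff₀ hl0]; linarith
  have hsum : ∑ j ∈ S, ‖((1 / 2 : ℂ) ^ j) * DiskAlg.coeffL j (Φ (y, v))‖ ≤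
      S.card * ((1 / l) ^ (S.sup id) * B) := by
    rw [← nsmul_eq_mul]
    refine Finset.sum_le_card_nsmul _ _ _ fun j hj => (hcoef j).trans ?_
    refine mul_le_mul_of_nonneg_right (pow_le_pow_right₀ h1l ?_) hB0
    exact Finset.le_sup (f := id) hj
  have hY : ∀ i, (1 / 2) ^ i * ‖DiskAlg.coeffL i (Φ (y, v))‖ ≤
      C * (S.card * ((1 / l) ^ (S.sup id) * B)) := by
    intro i
    have h2 := hdom (y, v) hpε i (ContinuousLinearMap.id ℂ ℂ)
    simp only [ContinuousLinearMap.id_apply] at h2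
    have h3 : ‖((1 / 2 : ℂ) ^ i) * DiskAlg.coeffL i (Φ (y, v))‖ =
        (1 / 2) ^ i * ‖DiskAlg.coeffL i (Φ (y, v))‖ := by
      rw [norm_mul, norm_pow]; norm_num
    rw [← h3]
    exact h2.trans (mul_le_mul_of_nonneg_left hsum hC)
  have h4 := DiskAlg.norm_eval_le_of_coeff hY hz
  rw [hev _ hpρ z (hz.trans (by norm_num))] at h4
  refine h4.trans (le_of_eq ?_)
  ring

/-- The restrictions of a holomorphic function to complex lines through the unit ball have
uniform polynomial growth. -/
theorem exists_uniform_growth {f : V → ℂ} {r : ℝ} (hr : 1 < r)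
    (hf : DifferentiableOn ℂ f (ball 0 r)) :
    ∃ R C : ℝ, ∃ N : ℕ, 0 < R ∧ R ≤ 1 ∧ R ≤ (r - 1) / 2 ∧ 0 ≤ C ∧
      HasUniformGrowth f (closedBall 0 1) R C N := by
  have hprop : ProperSpace V := FiniteDimensional.proper ℂ V
  refine IsCompact.induction_on (p := fun s => ∃ R C : ℝ, ∃ N : ℕ, 0 < R ∧ R ≤ 1 ∧
    R ≤ (r - 1) / 2 ∧ 0 ≤ C ∧ HasUniformGrowth f s R C N) (isCompact_closedBall (0 : V) 1)
    ⟨min 1 ((r - 1) / 2), 0, 0, lt_min one_pos (by linarith), min_le_left _ _, min_le_right _ _,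
      le_rfl, fun x hx => absurd hx (Set.notMem_empty x)⟩ ?_ ?_ ?_
  · rintro s t hst ⟨R, C, N, h1, h2, h3, h4, h5⟩
    exact ⟨R, C, N, h1, h2, h3, h4, h5.weaken hst le_rfl h2 h4 le_rfl le_rfl⟩
  · rintro s t ⟨R, C, N, h1, h2, h3, h4, h5⟩ ⟨R', C', N', h1', h2', h3', h4', h5'⟩
    refine ⟨min R R', max C C', max N N', lt_min h1 h1', (min_le_left _ _).trans h2,
      (min_le_left _ _).trans h3, le_max_of_le_left h4, ?_⟩
    have g := h5.weaken subset_rfl (min_le_left R R') h2 h4 (le_max_left C C') (le_max_left N N')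
    have g' := h5'.weaken subset_rfl (min_le_right R R') h2' h4' (le_max_right C C')
      (le_max_right N N')
    rintro x (hx | hx)
    · exact g x hx
    · exact g' x hx
  · intro x₀ hx₀
    rw [mem_closedBall_zero_iff] at hx₀
    set ρ := (r - 1) / 4 with hρ
    have hρ0 : 0 < ρ := by rw [hρ]; linarith
    have hsub : closedBall x₀ (2 * ρ) ⊆ ball 0 r := by
      intro x hx
      rw [mem_closedBall, dist_eq_norm] at hx
      rw [mem_ball_zero_iff]
      have := norm_add_le (x - x₀) x₀
      rw [sub_add_cancel] at this
      rw [hρ] at hx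
      linarith
    obtain ⟨M, hM⟩ := (isCompact_closedBall x₀ (2 * ρ)).exists_bound_of_continuousOn
      (hf.continuousOn.mono hsub)
    obtain ⟨ε, hε, C, hC, N, hgrow⟩ := exists_growth_of_small_disks hρ0
      (hf.mono (ball_subset_closedBall.trans hsub)) (fun x hx => hM x (ball_subset_closedBall hx))
    -- The local estimate wants short direction vectors: the unit vector `v` is replaced by `η • v`,
    -- and the disk of radius `1 / 4` becomes the one of radius `η / 4`.
    set η := min (min ε 1) (r - 1) / 2 with hη
    have hη0 : 0 < η := by
      have : 0 < r - 1 := by linarith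
      positivity
    have hηε : η < ε := by
      have : min (min ε 1) (r - 1) ≤ ε := (min_le_left _ _).trans (min_le_left _ _)
      linarith
    have hη1 : η ≤ 1 / 2 := by
      have : min (min ε 1) (r - 1) ≤ 1 := (min_le_left _ _).trans (min_le_right _ _)
      linarith
    have hηr : η ≤ (r - 1) / 2 := by
      have : min (min ε 1) (r - 1) ≤ r - 1 := min_le_right _ _
      linarith
    refine ⟨ball x₀ ε, mem_nhdsWithin_of_mem_nhds (ball_mem_nhds _ hε), η / 4, C, N,
      by positivity, by linarith, by linarith, hC, ?_⟩
    intro x hx v hv l hl hlR B hB z hz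
    have hB0 : 0 ≤ B := (norm_nonneg _).trans (hB 0 (by simpa using hl.le))
    have hηc : (η : ℂ) ≠ 0 := by exact_mod_cast hη0.ne'
    have hηn : ‖(η : ℂ)‖ = η := by rw [Complex.norm_real, Real.norm_of_nonneg hη0.le]
    have e : ∀ z : ℂ, x₀ + (x - x₀) + z • ((η : ℂ) • v) = x + (z * η) • v := fun z => by
      rw [add_sub_cancel, smul_smul]
    have key := hgrow (x - x₀) ((η : ℂ) • v) (by rwa [← dist_eq_norm])
      (by rw [norm_smul, hv, hηn, mul_one]; exact hηε) (l / η) (by positivity)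
      (by rw [div_le_one hη0]; linarith) B
      (fun z hz => by
        rw [e]
        refine hB _ ?_
        rwa [norm_mul, hηn, ← le_div_iff₀ hη0]) (z / η)
      (by rw [norm_div, hηn, div_le_iff₀ hη0]; linarith)
    rw [e, div_mul_cancel₀ _ hηc] at key
    refine key.trans ?_
    have h1 : 1 / (l / η) ≤ 1 / l := by
      rw [one_div_div]
      gcongr
      linarith
    gcongr

end Growth

/-! ### A one-variable Remez inequality at small scale -/

section Remez

open Metric

/-- Newton interpolation of a holomorphic function with an estimate of the remainder. -/
lemma exists_newton_interpolation {g : ℂ → ℂ} {R A : ℝ} (hR : 0 < R)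
    (hg : DiffContOnCl ℂ g (ball 0 R)) (hA : ∀ z, ‖z‖ ≤ R → ‖g z‖ ≤ A) {x : ℕ → ℂ}
    (hx : ∀ i, ‖x i‖ ≤ R / 2) (k : ℕ) :
    ∃ (p : Polynomial ℂ) (h : ℂ → ℂ), p.degree < k ∧ DiffContOnCl ℂ h (ball 0 R) ∧
      ∀ z, ‖z‖ ≤ R → ‖h z‖ ≤ A * (4 / R) ^ k ∧
        g z = p.eval z + (∏ i ∈ Finset.range k, (z - x i)) * h z := by
  induction k with
  | zero => exact ⟨0, g, by simp, hg, fun z hz => ⟨by simpa using hA z hz, by simp⟩⟩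
  | succ k ih =>
    obtain ⟨p, h, hp, hh, hgh⟩ := ih
    have hxk : x k ∈ ball (0 : ℂ) R := by
      rw [mem_ball_zero_iff]; linarith [hx k]
    have hb : ball (0 : ℂ) R ∈ nhds (x k) := isOpen_ball.mem_nhds hxk
    have hb' : closedBall (0 : ℂ) R ∈ nhds (x k) :=
      Filter.mem_of_superset hb ball_subset_closedBall
    have hd : DiffContOnCl ℂ (dslope h (x k)) (ball 0 R) := DiffContOnCl.mk_ball
      ((Complex.differentiableOn_dslope hb).2 hh.differentiableOn)
      ((continuousOn_dslope hb').2 ⟨hh.continuousOn_ball, hh.differentiableAt' hb⟩)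
    have hs : ∀ z, (z - x k) * dslope h (x k) z = h z - h (x k) := fun z => by
      simpa using sub_smul_dslope h (x k) z
    refine ⟨p + Polynomial.C (h (x k)) * ∏ i ∈ Finset.range k, (Polynomial.X - Polynomial.C (x i)),
      dslope h (x k), ?_, hd, fun z hz => ⟨?_, ?_⟩⟩
    · refine (Polynomial.degree_add_le _ _).trans_lt (max_lt (hp.trans (by exact_mod_cast k.lt_succ_self)) ?_)
      rw [← Polynomial.smul_eq_C_mul]
      refine (Polynomial.degree_smul_le _ _).trans_lt ?_
      rw [Polynomial.degree_prod]
      simp only [Polynomial.degree_X_sub_C, Finset.sum_const, Finset.card_range, nsmul_eq_mul,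
        mul_one]
      exact_mod_cast k.lt_succ_self
    · refine Complex.norm_le_of_forall_mem_frontier_norm_le (U := ball 0 R) isBounded_ball hd
        (fun w hw => ?_) (by rw [closure_ball _ hR.ne']; exact mem_closedBall_zero_iff.2 hz)
      rw [frontier_ball _ hR.ne', mem_sphere_zero_iff_norm] at hw
      -- On the boundary circle the nodes are at distance at least `R / 2`, so each divided
      -- difference costs a factor `4 / R`.
      have h1 : R / 2 ≤ ‖w - x k‖ := by
        have := norm_sub_norm_le w (x k)
        linarith [hx k]
      have h2 := congrArg norm (hs w)
      rw [norm_mul] at h2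
      have h3 : ‖h w - h (x k)‖ ≤ A * (4 / R) ^ k + A * (4 / R) ^ k :=
        (norm_sub_le _ _).trans (add_le_add (hgh w hw.le).1
          (hgh _ (mem_ball_zero_iff.1 hxk).le).1)
      have h4 : R / 2 * ‖dslope h (x k) w‖ ≤ A * (4 / R) ^ k + A * (4 / R) ^ k :=
        (mul_le_mul_of_nonneg_right h1 (norm_nonneg _)).trans (h2.le.trans h3)
      rw [pow_succ, ← mul_assoc, mul_div_assoc', le_div_iff₀ hR]
      linarith
    · rw [(hgh z hz).2, Finset.prod_range_succ, mul_assoc, hs]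
      simp [Polynomial.eval_prod]
      ring

/-- A set of measure at least `μ` contains well separated points. -/
lemma exists_separated_points {W : Set ℝ} {μ δ : ℝ} (hW : ENNReal.ofReal μ ≤ volume W) {k : ℕ}
    (hμ : 0 < μ) (hk : k * (2 * δ) < μ) (hδ : 0 < δ) :
    ∃ t : ℕ → ℝ, (∀ i, t i ∈ W) ∧
      ∀ i ≤ k, ∀ j ≤ k, i ≠ j → δ ≤ |t i - t j| := by
  induction k with
  | zero =>
    have : W.Nonempty := by
      rw [Set.nonempty_iff_ne_empty]
      rintro rfl
      simp at hW
      linarith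
    obtain ⟨t, ht⟩ := this
    exact ⟨fun _ => t, fun _ => ht, fun i hi j hj hij => by omega⟩
  | succ k ih =>
    push_cast at hk
    obtain ⟨t, htW, ht⟩ := ih (by linarith)
    -- Otherwise `W` is covered by `k + 1` intervals of length `2 * δ`, too short for its measure.
    obtain ⟨y, hyW, hy⟩ : ∃ y ∈ W, ∀ i ≤ k, δ ≤ |y - t i| := by
      by_contra hcon
      push Not at hcon
      have hsub : W ⊆ ⋃ i ∈ Finset.range (k + 1), ball (t i) δ := fun y hy => by
        obtain ⟨i, hi, hlt⟩ := hcon y hy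
        exact Set.mem_biUnion (Finset.mem_coe.2 (Finset.mem_range.2 (Nat.lt_succ_of_le hi)))
          (by rwa [mem_ball, Real.dist_eq])
      have h1 := hW.trans ((measure_mono hsub).trans (measure_biUnion_finset_le _ _))
      simp only [Real.volume_ball, Finset.sum_const, Finset.card_range, nsmul_eq_mul] at h1
      rw [← ENNReal.ofReal_natCast, ← ENNReal.ofReal_mul (by positivity),
        ENNReal.ofReal_le_ofReal_iff (by positivity)] at h1
      push_cast at h1
      linarith
    refine ⟨fun i => if i ≤ k then t i else y, fun i => ?_, fun i hi j hj hij => ?_⟩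
    · dsimp only; split_ifs
      · exact htW i
      · exact hyW
    · dsimp only
      split_ifs with h1 h2 h2
      · exact ht i h1 j h2 hij
      · rw [abs_sub_comm]; exact hy i h1
      · exact hy j h2
      · omega

/-- Lagrange interpolation at `N + 1` nodes: each basis polynomial is a product of `N` ratios, each
at most `2 * l / δ`. -/
lemma norm_eval_le_of_separated {p : Polynomial ℂ} {N : ℕ} (hp : p.degree < (N + 1 : ℕ))
    {t : ℕ → ℝ} {l δ B : ℝ} (hδ : 0 < δ) (ht : ∀ i, |t i| ≤ l)
    (hsep : ∀ i ≤ N, ∀ j ≤ N, i ≠ j → δ ≤ |t i - t j|)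
    (hB : ∀ i ≤ N, ‖p.eval (t i : ℂ)‖ ≤ B) {z : ℂ} (hz : ‖z‖ ≤ l) :
    ‖p.eval z‖ ≤ (N + 1) * (2 * l / δ) ^ N * B := by
  classical
  set s := Finset.range (N + 1) with hs
  have hmem : ∀ i, i ∈ s ↔ i ≤ N := fun i => by rw [hs, Finset.mem_range]; omega
  have hl : 0 ≤ l := (norm_nonneg z).trans hz
  have hnt : ∀ i, ‖(t i : ℂ)‖ ≤ l := fun i => by
    rw [Complex.norm_real]; exact ht i
  have hinj : Set.InjOn (fun i => (t i : ℂ)) s := by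
    intro i hi j hj hij
    by_contra hne
    have := hsep i ((hmem i).1 hi) j ((hmem j).1 hj) hne
    have h2 : t i = t j := Complex.ofReal_injective hij
    rw [h2, sub_self, abs_zero] at this
    linarith
  have hint := Lagrange.eq_interpolate_of_eval_eq (s := s) (v := fun i => (t i : ℂ))
    (fun i => p.eval (t i : ℂ)) hinj (f := p) (by rw [hs, Finset.card_range]; exact hp)
    (fun i _ => rfl)
  have hB0 : 0 ≤ B := (norm_nonneg _).trans (hB 0 (Nat.zero_le _))
  rw [hint, Lagrange.interpolate_apply, Polynomial.eval_finsetSum]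
  calc ‖∑ i ∈ s, _‖ ≤ ∑ _i ∈ s, B * (2 * l / δ) ^ N := by
        refine (norm_sum_le _ _).trans (Finset.sum_le_sum fun i hi => ?_)
        rw [Polynomial.eval_mul, Polynomial.eval_C, norm_mul]
        refine mul_le_mul (hB i ((hmem i).1 hi)) ?_ (norm_nonneg _) hB0
        rw [Lagrange.basis, Polynomial.eval_prod, norm_prod]
        calc ∏ j ∈ s.erase i, _ ≤ ∏ _j ∈ s.erase i, (2 * l / δ) := by
              refine Finset.prod_le_prod (fun _ _ => norm_nonneg _) fun j hj => ?_
              rw [Finset.mem_erase] at hj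
              rw [Lagrange.basisDivisor]
              simp only [Polynomial.eval_mul, Polynomial.eval_C, Polynomial.eval_sub,
                Polynomial.eval_X, norm_mul, norm_inv]
              rw [inv_mul_eq_div]
              refine div_le_div₀ (by positivity) ?_ hδ ?_
              · exact (norm_sub_le _ _).trans (by linarith [hnt j])
              · have := hsep i ((hmem i).1 hi) j ((hmem j).1 hj.2) (Ne.symm hj.1)
                rwa [← Complex.ofReal_sub, Complex.norm_real]
          _ = (2 * l / δ) ^ N := by
              rw [Finset.prod_const, Finset.card_erase_of_mem hi, hs, Finset.card_range]
              rfl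
    _ = (N + 1) * (2 * l / δ) ^ N * B := by
        rw [Finset.sum_const, hs, Finset.card_range, nsmul_eq_mul]; push_cast; ring

/-- A Remez-type inequality on short intervals for holomorphic functions of controlled growth. -/
theorem norm_le_of_growth {g : ℂ → ℂ} {R C : ℝ} {N : ℕ} (hR : 0 < R)
    (hg : DiffContOnCl ℂ g (ball 0 R))
    (hgrow : ∀ l : ℝ, 0 < l → l ≤ R → ∀ B, (∀ z, ‖z‖ ≤ l → ‖g z‖ ≤ B) →
      ∀ z, ‖z‖ ≤ R → ‖g z‖ ≤ C * (1 / l) ^ N * B)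
    {l : ℝ} (hl : 0 < l) (hlR : l ≤ R / 2) (hlC : C * (8 / R) ^ (N + 1) * l ≤ 1 / 2)
    {W : Set ℝ} {μ B : ℝ} (hμ : 0 < μ) (hW : ENNReal.ofReal μ ≤ volume W)
    (hWl : ∀ t ∈ W, |t| ≤ l) (hB : ∀ t ∈ W, ‖g (t : ℂ)‖ ≤ B) {z : ℂ} (hz : ‖z‖ ≤ l) :
    ‖g z‖ ≤ 2 * (N + 1) * (4 * (N + 2)) ^ N * (l / μ) ^ N * B := by
  have hN : (0 : ℝ) < N + 2 := by positivity
  set δ := μ / (2 * (N + 2)) with hδdef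
  have hδ : 0 < δ := by positivity
  obtain ⟨t, htW, hsep⟩ := exists_separated_points (k := N) (δ := δ) hW hμ (by
    rw [hδdef]; field_simp; linarith) hδ
  have hcont : ContinuousOn g (closedBall 0 l) := hg.continuousOn_ball.mono
    (closedBall_subset_closedBall (by linarith))
  obtain ⟨z₀, hz₀, hmax⟩ := (isCompact_closedBall (0 : ℂ) l).exists_isMaxOn
    ⟨0, mem_closedBall_self hl.le⟩ hcont.norm
  rw [mem_closedBall_zero_iff] at hz₀
  have hs : ∀ z, ‖z‖ ≤ l → ‖g z‖ ≤ ‖g z₀‖ := fun z hz => hmax (mem_closedBall_zero_iff.2 hz)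
  set s := ‖g z₀‖ with hsdef
  have hnt : ∀ i, ‖(t i : ℂ)‖ ≤ l := fun i => by
    rw [Complex.norm_real]; exact hWl _ (htW i)
  obtain ⟨p, h, hp, -, hgh⟩ := exists_newton_interpolation hR hg
    (hgrow l hl (by linarith) s hs) (x := fun i => (t i : ℂ)) (fun i => (hnt i).trans hlR) (N + 1)
  have hpt : ∀ i ≤ N, p.eval (t i : ℂ) = g (t i) := by
    intro i hi
    have h1 := (hgh (t i) ((hnt i).trans (by linarith))).2
    rw [Finset.prod_eq_zero (i := i) (Finset.mem_range.2 (by omega)) (sub_self _), zero_mul,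
      add_zero] at h1
    exact h1.symm
  have h1 := norm_eval_le_of_separated hp hδ (fun i => hWl _ (htW i)) hsep
    (fun i hi => by rw [hpt i hi]; exact hB _ (htW i)) hz₀
  -- The nodal product has order `l ^ (N + 1)` and the growth hypothesis loses `l ^ (-N)`. One
  -- factor `l` survives, so for small `l` the remainder is at most half the maximum `s` and is
  -- absorbed.
  have h2 : ‖(∏ i ∈ Finset.range (N + 1), (z₀ - t i)) * h z₀‖ ≤ s / 2 := by
    rw [norm_mul, norm_prod]
    have h3 : ∏ i ∈ Finset.range (N + 1), ‖z₀ - t i‖ ≤ (2 * l) ^ (N + 1) := by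
      calc _ ≤ ∏ _i ∈ Finset.range (N + 1), (2 * l) :=
            Finset.prod_le_prod (fun _ _ => norm_nonneg _) fun i _ =>
              (norm_sub_le _ _).trans (by linarith [hnt i])
        _ = _ := by simp
    calc _ ≤ (2 * l) ^ (N + 1) * (C * (1 / l) ^ N * s * (4 / R) ^ (N + 1)) :=
          mul_le_mul h3 (hgh z₀ (by linarith)).1 (norm_nonneg _) (by positivity)
      _ = C * (8 / R) ^ (N + 1) * l * s := by
          have e1 : (8 / R : ℝ) ^ (N + 1) = 2 ^ (N + 1) * (4 / R) ^ (N + 1) := by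
            rw [← mul_pow]; congr 1; ring
          have e2 : l ^ (N + 1) * (1 / l) ^ N = l := by
            rw [pow_succ, mul_right_comm, ← mul_pow, mul_one_div_cancel hl.ne', one_pow, one_mul]
          rw [e1, mul_pow]
          linear_combination (2 ^ (N + 1) * C * s * (4 / R) ^ (N + 1)) * e2
      _ ≤ 1 / 2 * s := mul_le_mul_of_nonneg_right hlC (norm_nonneg _)
      _ = s / 2 := by ring
  have h3 : s ≤ (N + 1) * (2 * l / δ) ^ N * B + s / 2 := by
    rw [hsdef]
    conv_lhs => rw [(hgh z₀ (by linarith)).2]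
    exact (norm_add_le _ _).trans (add_le_add h1 h2)
  have h4 : (2 * l / δ) ^ N = (4 * (N + 2)) ^ N * (l / μ) ^ N := by
    rw [← mul_pow, hδdef]; congr 1; field_simp; ring
  rw [h4] at h3
  refine (hs z hz).trans ?_
  linarith

end Remez

/-! ### Remez inequality on all intervals of lines in the unit ball -/

section LineRemez

open Metric

/-- Pigeonhole over `P` consecutive intervals of length `l` covering `[c - 2, c + 2]`; a closed ball
about any point of such an interval contains it. -/
lemma exists_piece_of_measure {W : Set ℝ} {c l μ : ℝ} (hl : 0 < l) (hμ : 0 < μ) {P : ℕ}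
    (hP : 4 ≤ P * l) (hPpos : 0 < P) (hW : ENNReal.ofReal μ ≤ volume W)
    (hWc : ∀ t ∈ W, |t - c| ≤ 2) :
    ∃ t₀ ∈ W, ENNReal.ofReal (μ / P) ≤ volume (W ∩ closedBall t₀ l) := by
  set piece : ℕ → Set ℝ := fun i => Set.Icc (c - 2 + i * l) (c - 2 + (i + 1) * l) with hpiece
  have hcov : W ⊆ ⋃ i ∈ Finset.range P, W ∩ piece i := by
    intro t ht
    have h1 := abs_le.1 (hWc t ht)
    have hP' : (0 : ℝ) < P := by exact_mod_cast hPpos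
    have hnn : 0 ≤ (t - (c - 2)) / l := div_nonneg (by linarith) hl.le
    have a1 := Nat.floor_le hnn
    have a2 := Nat.lt_floor_add_one ((t - (c - 2)) / l)
    rw [le_div_iff₀ hl] at a1
    rw [div_lt_iff₀ hl] at a2
    by_cases hlt : ⌊(t - (c - 2)) / l⌋₊ < P
    · refine Set.mem_biUnion (Finset.mem_coe.2 (Finset.mem_range.2 hlt)) ⟨ht, ?_, ?_⟩ <;> linarith
    · have h2 : (P : ℝ) ≤ ⌊(t - (c - 2)) / l⌋₊ := by exact_mod_cast not_lt.1 hlt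
      have h3 := mul_le_mul_of_nonneg_right h2 hl.le
      -- Only the right endpoint can fall past the last index; it belongs to the closed last piece.
      refine Set.mem_biUnion (Finset.mem_coe.2 (Finset.mem_range.2 (show P - 1 < P by omega)))
        ⟨ht, ?_, ?_⟩
      · rw [Nat.cast_sub (by omega)]; push_cast; linarith
      · rw [Nat.cast_sub (by omega)]; push_cast; linarith
  obtain ⟨i, hi⟩ : ∃ i, ENNReal.ofReal (μ / P) ≤ volume (W ∩ piece i) := by
    by_contra hcon
    push Not at hcon
    have h1 : volume W ≤ ∑ i ∈ Finset.range P, volume (W ∩ piece i) :=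
      (measure_mono hcov).trans (measure_biUnion_finset_le _ _)
    have h2 : ∑ i ∈ Finset.range P, volume (W ∩ piece i) <
        ∑ _i ∈ Finset.range P, ENNReal.ofReal (μ / P) :=
      ENNReal.sum_lt_sum_of_nonempty (Finset.nonempty_range_iff.2 hPpos.ne') fun i _ => hcon i
    rw [Finset.sum_const, Finset.card_range, nsmul_eq_mul, ← ENNReal.ofReal_natCast,
      ← ENNReal.ofReal_mul (by positivity), mul_div_cancel₀ _ (by positivity)] at h2
    exact absurd (hW.trans h1) (not_le.2 h2)
  have hne : (W ∩ piece i).Nonempty := by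
    rw [Set.nonempty_iff_ne_empty]
    intro he
    rw [he, measure_empty, nonpos_iff_eq_zero, ENNReal.ofReal_eq_zero] at hi
    have : 0 < μ / P := by positivity
    linarith
  obtain ⟨t₀, ht₀, ht₀p⟩ := hne
  refine ⟨t₀, ht₀, hi.trans (measure_mono fun t ht => ⟨ht.1, ?_⟩)⟩
  have h1 := ht.2
  simp only [hpiece, Set.mem_Icc] at h1 ht₀p
  rw [mem_closedBall, Real.dist_eq, abs_le]
  constructor <;> linarith

variable {V : Type} [NormedAddCommGroup V] [NormedSpace ℂ V] [FiniteDimensional ℂ V]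

/-- Uniform Remez inequality on real intervals of complex lines. -/
theorem exists_line_remez {f : V → ℂ} {r : ℝ} (hr : 1 < r)
    (hf : DifferentiableOn ℂ f (ball 0 r)) :
    ∃ (K : ℝ) (N : ℕ), 0 ≤ K ∧ ∀ x v : V, ‖v‖ = 1 → ∀ J W : Set ℝ, J.OrdConnected →
      (∀ t ∈ J, x + (t : ℂ) • v ∈ ball (0 : V) 1) → W ⊆ J → 0 < volume W →
      ∀ B, (∀ t ∈ W, ‖f (x + (t : ℂ) • v)‖ ≤ B) →
      ∀ t ∈ J, ‖f (x + (t : ℂ) • v)‖ ≤ K * (volume.real J / volume.real W) ^ N * B := by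
  obtain ⟨R, C, N, hR0, hR1, hRr, hC, hgrow⟩ := exists_uniform_growth hr hf
  -- The largest scale allowed by `norm_le_of_growth`; the second term makes the interpolation
  -- remainder at most half the maximum.
  set l₀ := min (R / 2) (1 / (2 * (C * (8 / R) ^ (N + 1) + 1))) with hl₀
  have hl₀0 : 0 < l₀ := by positivity
  have hl₀R : l₀ ≤ R / 2 := min_le_left _ _
  have hl₀C : ∀ l, 0 < l → l ≤ l₀ → C * (8 / R) ^ (N + 1) * l ≤ 1 / 2 := by
    intro l hl hll
    have h1 : l ≤ 1 / (2 * (C * (8 / R) ^ (N + 1) + 1)) := hll.trans (min_le_right _ _)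
    rw [le_div_iff₀ (by positivity)] at h1
    linarith
  set K₁ : ℝ := 2 * (N + 1) * (4 * (N + 2)) ^ N with hK₁
  obtain ⟨P, hP⟩ := exists_nat_ge (4 / l₀)
  have hP4 : 4 ≤ P * l₀ := by rwa [div_le_iff₀ hl₀0] at hP
  have hPpos : 0 < P := by
    rcases Nat.eq_zero_or_pos P with h | h
    · rw [h] at hP4; norm_num at hP4
    · exact h
  set A : ℝ := max 1 (C * (1 / l₀) ^ N) with hA
  have hA1 : 1 ≤ A := le_max_left _ _
  set K₂ : ℝ := A ^ P * (K₁ * P ^ N) with hK₂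
  refine ⟨max K₁ K₂, N, le_max_of_le_left (by positivity), ?_⟩
  intro x v hv J W hJ hJb hWJ hW0 B hB
  have hpt : ∀ (t : ℝ) (z : ℂ), (x + (t : ℂ) • v) + z • v = x + ((t : ℂ) + z) • v := fun t z => by
    rw [add_smul, add_assoc]
  have hdist : ∀ s ∈ J, ∀ t ∈ J, |s - t| ≤ 2 := by
    intro s hs t ht
    have h1 := mem_ball_zero_iff.1 (hJb s hs)
    have h2 := mem_ball_zero_iff.1 (hJb t ht)
    have h3 : (x + (s : ℂ) • v) - (x + (t : ℂ) • v) = ((s - t : ℝ) : ℂ) • v := by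
      push_cast; rw [sub_smul]; abel
    have h4 := norm_sub_le (x + (s : ℂ) • v) (x + (t : ℂ) • v)
    rw [h3, norm_smul, hv, mul_one, Complex.norm_real, Real.norm_eq_abs] at h4
    linarith
  have hWne : W.Nonempty := by
    rw [Set.nonempty_iff_ne_empty]; rintro rfl; simp at hW0
  obtain ⟨c, hcW⟩ := hWne
  have hB0 : 0 ≤ B := (norm_nonneg _).trans (hB c hcW)
  have hJfin : volume J < ⊤ := by
    refine (measure_mono (t := closedBall c 2) fun t ht => ?_).trans_lt measure_closedBall_lt_top
    rw [mem_closedBall, Real.dist_eq]; exact hdist t ht c (hWJ hcW)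
  have hWfin : volume W < ⊤ := (measure_mono hWJ).trans_lt hJfin
  set L := volume.real J with hL
  set μ := volume.real W with hμdef
  have hμ : 0 < μ := ENNReal.toReal_pos hW0.ne' hWfin.ne
  have hμL : μ ≤ L := measureReal_mono hWJ hJfin.ne
  have hL0 : 0 < L := hμ.trans_le hμL
  have hWμ : ENNReal.ofReal μ ≤ volume W := by
    rw [hμdef, measureReal_def, ENNReal.ofReal_toReal hWfin.ne]
  have hdistL : ∀ s ∈ J, ∀ t ∈ J, |s - t| ≤ L := by
    have aux : ∀ s ∈ J, ∀ t ∈ J, t - s ≤ L := by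
      intro s hs t ht
      rcases le_total s t with h | h
      · have h1 := measureReal_mono (μ := volume) (hJ.out hs ht) hJfin.ne
        rwa [Real.volume_real_Icc_of_le h] at h1
      · linarith
    intro s hs t ht
    exact abs_le.2 ⟨by linarith [aux s hs t ht], aux t ht s hs⟩
  have hclosed : ∀ t ∈ J, x + (t : ℂ) • v ∈ closedBall (0 : V) 1 := fun t ht =>
    ball_subset_closedBall (hJb t ht)
  -- the one-variable inequality around a point of the interval
  have short : ∀ t₀ ∈ J, ∀ l, 0 < l → l ≤ l₀ → ∀ μ', 0 < μ' →
      ENNReal.ofReal μ' ≤ volume (W ∩ closedBall t₀ l) →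
      ∀ z : ℂ, ‖z‖ ≤ l → ‖f (x + (t₀ : ℂ) • v + z • v)‖ ≤ K₁ * (l / μ') ^ N * B := by
    intro t₀ ht₀ l hl hll μ' hμ' hWμ' z hz
    have hdiff : DiffContOnCl ℂ (fun z : ℂ => f (x + (t₀ : ℂ) • v + z • v)) (ball 0 R) := by
      refine DifferentiableOn.diffContOnCl fun z hz => DifferentiableAt.differentiableWithinAt ?_
      rw [closure_ball _ hR0.ne', mem_closedBall_zero_iff] at hz
      refine DifferentiableAt.comp (f := fun z : ℂ => x + (t₀ : ℂ) • v + z • v) z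
        (hf.differentiableAt (isOpen_ball.mem_nhds ?_)) (by fun_prop)
      have h1 := mem_ball_zero_iff.1 (hJb t₀ ht₀)
      have h2 := norm_add_le (x + (t₀ : ℂ) • v) (z • v)
      rw [norm_smul, hv, mul_one] at h2
      rw [mem_ball_zero_iff]
      linarith
    refine norm_le_of_growth hR0 hdiff
      (fun l hl hlR B hB z hz => hgrow _ (hclosed t₀ ht₀) v hv l hl hlR B hB z hz) hl
      (hll.trans hl₀R) (hl₀C l hl hll) (W := (fun s => t₀ + s) ⁻¹' (W ∩ closedBall t₀ l)) hμ'
      (by rwa [measure_preimage_add]) (fun s hs => ?_) (fun s hs => ?_) hz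
    · have := hs.2
      rwa [mem_closedBall, Real.dist_eq, add_sub_cancel_left] at this
    · have := hB _ hs.1
      rw [Complex.ofReal_add] at this
      simp only [hpt]
      exact this
  have hratio : 0 ≤ (L / μ) ^ N * B := by positivity
  intro t ht
  rcases le_or_gt L l₀ with hLl | hLl
  · have h1 := short t ht L hL0 hLl μ hμ
      (hWμ.trans (measure_mono fun s hs => ⟨hs, by
        rw [mem_closedBall, Real.dist_eq]; exact hdistL s (hWJ hs) t ht⟩)) 0 (by simpa using hL0.le)
    rw [zero_smul, add_zero, mul_assoc] at h1
    rw [mul_assoc]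
    exact h1.trans (mul_le_mul_of_nonneg_right (le_max_left _ _) hratio)
  · obtain ⟨t₀, ht₀W, ht₀⟩ := exists_piece_of_measure (c := c) hl₀0 hμ hP4 hPpos hWμ
      (fun t ht => hdist t (hWJ ht) c (hWJ hcW))
    have hP' : (0 : ℝ) < P := by exact_mod_cast hPpos
    have ht₀J := hWJ ht₀W
    have hbase := short t₀ ht₀J l₀ hl₀0 le_rfl (μ / P) (by positivity) ht₀
    set B₁ := K₁ * (l₀ / (μ / P)) ^ N * B with hB₁
    have hB₁0 : 0 ≤ B₁ := by positivity
    -- Longer intervals: propagate the bound from the rich piece by disks of radius `l₀` centered on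
    -- `J`. Since `2 * l₀ ≤ R`, the growth estimate at one center covers the next disk, at the cost
    -- of a factor `A`.
    have chain : ∀ k : ℕ, ∀ t ∈ J, |t - t₀| ≤ k * l₀ →
        ∀ z : ℂ, ‖z‖ ≤ l₀ → ‖f (x + (t : ℂ) • v + z • v)‖ ≤ A ^ k * B₁ := by
      intro k
      induction k with
      | zero =>
        intro t ht htk z hz
        have : t = t₀ := by
          rw [Nat.cast_zero, zero_mul] at htk
          exact sub_eq_zero.1 (abs_nonpos_iff.1 htk)
        subst this
        simpa using hbase z hz
      | succ k ih =>
        intro t ht htk z hz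
        obtain ⟨t', ht'J, h1, h2⟩ : ∃ t' ∈ J, |t' - t₀| ≤ k * l₀ ∧ |t - t'| ≤ l₀ := by
          push_cast at htk
          have hk : 0 ≤ (k : ℝ) * l₀ := by positivity
          rw [abs_le] at htk
          rcases le_total t t₀ with h | h
          · refine ⟨min t₀ (t + l₀), hJ.out ht ht₀J ⟨le_min h (by linarith), min_le_left _ _⟩, ?_, ?_⟩
            · rw [abs_le]
              have := le_min (show t₀ - k * l₀ ≤ t₀ by linarith)
                (show t₀ - k * l₀ ≤ t + l₀ by linarith)
              have := min_le_left t₀ (t + l₀)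
              constructor <;> linarith
            · rw [abs_le]
              have := min_le_right t₀ (t + l₀)
              have := le_min h (show t ≤ t + l₀ by linarith)
              constructor <;> linarith
          · refine ⟨max t₀ (t - l₀), hJ.out ht₀J ht ⟨le_max_left _ _, max_le h (by linarith)⟩, ?_, ?_⟩
            · rw [abs_le]
              have := max_le (show t₀ ≤ t₀ + k * l₀ by linarith)
                (show t - l₀ ≤ t₀ + k * l₀ by linarith)
              have := le_max_left t₀ (t - l₀)
              constructor <;> linarith
            · rw [abs_le]
              have := le_max_right t₀ (t - l₀)
              have := max_le h (show t - l₀ ≤ t by linarith)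
              constructor <;> linarith
        have h3 := hgrow _ (hclosed t' ht'J) v hv l₀ hl₀0 (by linarith) _ (ih t' ht'J h1)
          (((t - t' : ℝ) : ℂ) + z) (by
            refine (norm_add_le _ _).trans ?_
            rw [Complex.norm_real, Real.norm_eq_abs]
            linarith)
        rw [hpt] at h3 ⊢
        have h4 : (t' : ℂ) + (((t - t' : ℝ) : ℂ) + z) = t + z := by push_cast; ring
        rw [h4] at h3
        refine h3.trans ?_
        rw [pow_succ', mul_assoc A]
        exact mul_le_mul_of_nonneg_right (le_max_right _ _) (by positivity)
    have h1 := chain P t ht ((hdist t ht t₀ ht₀J).trans (by linarith)) 0 (by simpa using hl₀0.le)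
    rw [zero_smul, add_zero] at h1
    have h2 : B₁ ≤ K₁ * P ^ N * ((L / μ) ^ N * B) := by
      have : l₀ / (μ / P) ≤ P * (L / μ) := by
        rw [div_div_eq_mul_div, mul_div_assoc', mul_comm (P : ℝ)]
        gcongr
      calc B₁ ≤ K₁ * (P * (L / μ)) ^ N * B := by
            rw [hB₁]; gcongr
        _ = _ := by rw [mul_pow]; ring
    rw [mul_assoc]
    calc ‖f (x + (t : ℂ) • v)‖ ≤ A ^ P * B₁ := h1
      _ ≤ A ^ P * (K₁ * P ^ N * ((L / μ) ^ N * B)) := mul_le_mul_of_nonneg_left h2 (by positivity)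
      _ = K₂ * ((L / μ) ^ N * B) := by rw [hK₂]; ring
      _ ≤ _ := mul_le_mul_of_nonneg_right (le_max_right _ _) hratio

end LineRemez

/-! ### Finiteness of the Chebyshev degree -/

section Main

variable {n : ℕ}

lemma real_smul_eq_complex_smul (t : ℝ) (v : EuclideanSpace ℂ (Fin n)) : t • v = (t : ℂ) • v := by
  ext i; simp

lemma bddAbove_norm_image {r : ℝ} (hr : 1 < r) {f : EuclideanSpace ℂ (Fin n) → ℂ}
    (hf : DifferentiableOn ℂ f (Metric.ball (0 : EuclideanSpace ℂ (Fin n)) r)) :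
    ∃ M, ∀ x ∈ Metric.ball (0 : EuclideanSpace ℂ (Fin n)) 1, ‖f x‖ ≤ M := by
  obtain ⟨M, hM⟩ := (isCompact_closedBall (0 : EuclideanSpace ℂ (Fin n)) 1).exists_bound_of_continuousOn
    (hf.continuousOn.mono (Metric.closedBall_subset_ball hr))
  exact ⟨M, fun x hx => hM x (Metric.ball_subset_closedBall hx)⟩

theorem chebyshevExponents_nonempty {r : ℝ} (hr : 1 < r) {f : EuclideanSpace ℂ (Fin n) → ℂ}
    (hf : DifferentiableOn ℂ f (Metric.ball (0 : EuclideanSpace ℂ (Fin n)) r)) :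
    (chebyshevExponents f).Nonempty := by
  obtain ⟨M, hM⟩ := bddAbove_norm_image hr hf
  obtain ⟨K, N, hK, hrem⟩ := exists_line_remez hr hf
  obtain ⟨m, hm⟩ := pow_unbounded_of_one_lt K (show (1 : ℝ) < 4 by norm_num)
  -- In the exponent `2 * p`, `4 ^ (2 * p)` absorbs `K` and the power of `|J| / |W| ≥ 1` exceeds the
  -- `N`-th; the `+ 1` keeps the exponent positive.
  set p := max m N + 1 with hp
  refine ⟨((2 * p : ℕ) : ℝ), by positivity, ?_⟩
  intro x _ v hv J W hJ hJb hWJ _ hW0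
  simp only [real_smul_eq_complex_smul] at hJb ⊢
  rw [Real.rpow_natCast]
  have hWne : W.Nonempty := by
    rw [Set.nonempty_iff_ne_empty]; rintro rfl; simp at hW0
  have hbdd : BddAbove ((fun t : ℝ => ‖f (x + (t : ℂ) • v)‖) '' W) :=
    ⟨M, by rintro _ ⟨t, ht, rfl⟩; exact hM _ (hJb t (hWJ ht))⟩
  refine csSup_le ((hWne.mono hWJ).image _) ?_
  rintro _ ⟨t, ht, rfl⟩
  have key := hrem x v hv J W hJ hJb hWJ hW0 _ (fun s hs => le_csSup hbdd ⟨s, hs, rfl⟩) t ht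
  refine key.trans (mul_le_mul_of_nonneg_right ?_ ?_)
  · rcases le_or_gt 1 (volume.real J / volume.real W) with h1 | h1
    · have h4 : (4 : ℝ) ^ m ≤ 4 ^ p := pow_le_pow_right₀ (by norm_num) (by omega)
      have h5 : (volume.real J / volume.real W) ^ N ≤ (volume.real J / volume.real W) ^ (2 * p) :=
        pow_le_pow_right₀ h1 (by omega)
      have h6 : (4 : ℝ) ^ p ≤ 4 ^ (2 * p) := pow_le_pow_right₀ (by norm_num) (by omega)
      rw [mul_div_assoc, mul_pow]
      exact mul_le_mul (hm.le.trans (h4.trans h6)) h5 (by positivity) (by positivity)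
    · exfalso
      have hJfin : volume J < ⊤ := by
        obtain ⟨c, hc⟩ := hWne
        refine (measure_mono (t := Metric.closedBall c 2) fun s hs => ?_).trans_lt
          measure_closedBall_lt_top
        have a1 := mem_ball_zero_iff.1 (hJb s hs)
        have a2 := mem_ball_zero_iff.1 (hJb c (hWJ hc))
        have a3 : (x + (s : ℂ) • v) - (x + (c : ℂ) • v) = ((s - c : ℝ) : ℂ) • v := by
          push_cast; rw [sub_smul]; abel
        have a4 := norm_sub_le (x + (s : ℂ) • v) (x + (c : ℂ) • v)
        rw [a3, norm_smul, hv, mul_one, Complex.norm_real] at a4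
        rw [Metric.mem_closedBall, dist_eq_norm]
        linarith
      have hWpos : 0 < volume.real W :=
        ENNReal.toReal_pos hW0.ne' ((measure_mono hWJ).trans_lt hJfin).ne
      rw [div_lt_one hWpos] at h1
      exact absurd (measureReal_mono hWJ hJfin.ne) (not_le.2 h1)
  · obtain ⟨s, hs⟩ := hWne
    exact (norm_nonneg _).trans (le_csSup hbdd ⟨s, hs, rfl⟩)

end Main

/-! ### From Chebyshev exponents to sublevel sets on segments -/

section Main

open Metric

variable {n : ℕ}

lemma realToComplex_add (x y : EuclideanSpace ℝ (Fin n)) :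
    realToComplex (x + y) = realToComplex x + realToComplex y := by
  ext i; simp [realToComplex]

lemma realToComplex_smul (t : ℝ) (x : EuclideanSpace ℝ (Fin n)) :
    realToComplex (t • x) = t • realToComplex x := by
  ext i; simp [realToComplex]

lemma norm_realToComplex (x : EuclideanSpace ℝ (Fin n)) : ‖realToComplex x‖ = ‖x‖ := by
  simp [EuclideanSpace.norm_eq, realToComplex]

lemma continuous_realToComplex :
    Continuous (realToComplex : EuclideanSpace ℝ (Fin n) → EuclideanSpace ℂ (Fin n)) := by
  unfold realToComplex
  fun_prop

lemma IsChebyshevExponent.mono {f : EuclideanSpace ℂ (Fin n) → ℂ} {d e : ℝ}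
    (h : IsChebyshevExponent f d) (hde : d ≤ e) : IsChebyshevExponent f e := by
  intro x hx v hv J W hJ hJb hWJ hW hW0
  refine (h x hx v hv J W hJ hJb hWJ hW hW0).trans (mul_le_mul_of_nonneg_right ?_
    (Real.sSup_nonneg (by rintro _ ⟨t, -, rfl⟩; exact norm_nonneg _)))
  have hJfin : volume J < ⊤ := by
    refine (measure_mono (t := closedBall 0 2) fun t ht => ?_).trans_lt measure_closedBall_lt_top
    have h1 := mem_ball_zero_iff.1 (hJb t ht)
    have h2 := mem_ball_zero_iff.1 hx
    have h3 := norm_sub_le (x + t • v) x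
    rw [add_sub_cancel_left, norm_smul, hv, mul_one] at h3
    rw [mem_closedBall_zero_iff]
    linarith
  have hμ : 0 < volume.real W := ENNReal.toReal_pos hW0.ne' ((measure_mono hWJ).trans_lt hJfin).ne
  have hμL : volume.real W ≤ volume.real J := measureReal_mono hWJ hJfin.ne
  refine Real.rpow_le_rpow_of_exponent_le ?_ hde
  rw [le_div_iff₀ hμ]
  linarith

/-- The `+ 1` puts the integer strictly above the infimum, so an admissible exponent lies below it
whether or not the infimum is attained; admissibility passes upwards because `4 * |J| / |W| ≥ 1`. -/
lemma isChebyshevExponent_ceil_add_one {f : EuclideanSpace ℂ (Fin n) → ℂ}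
    (h : (chebyshevExponents f).Nonempty) :
    IsChebyshevExponent f ((chebyshevDegreeCeil f + 1 : ℕ) : ℝ) := by
  obtain ⟨d, hd, hlt⟩ := exists_lt_of_csInf_lt h
    (show sInf (chebyshevExponents f) < ((chebyshevDegreeCeil f + 1 : ℕ) : ℝ) by
      push_cast
      exact (Nat.le_ceil (chebyshevDegree f)).trans_lt (lt_add_one _))
  exact hd.2.mono hlt.le

/-- Small sublevel sets on segments, from the Chebyshev inequality on the segment. -/
lemma IsChebyshevExponent.volume_segment_le {f : EuclideanSpace ℂ (Fin n) → ℂ} {K : ℕ}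
    (h : IsChebyshevExponent f (K : ℝ))
    (hf : ContinuousOn f (ball (0 : EuclideanSpace ℂ (Fin n)) 1)) {M : ℝ}
    (hM : ∀ x ∈ ball (0 : EuclideanSpace ℂ (Fin n)) 1, ‖f x‖ ≤ M)
    {x y : EuclideanSpace ℂ (Fin n)} (hx : x ∈ ball (0 : EuclideanSpace ℂ (Fin n)) 1)
    (hy : y ∈ ball (0 : EuclideanSpace ℂ (Fin n)) 1) {l : ℝ} (hl : 0 < l) {j : ℕ} (hj : 1 ≤ j)
    (hlt : l * (8 * (j : ℝ)) ^ K < ‖f x‖) :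
    volume {s ∈ Set.Icc (0 : ℝ) 1 | ‖f ((1 - s) • y + s • x)‖ ≤ l} ≤
      ENNReal.ofReal (1 / (2 * j)) := by
  have hj1 : (1 : ℝ) ≤ j := by exact_mod_cast hj
  have hlx : l < ‖f x‖ :=
    (le_mul_of_one_le_right hl.le (one_le_pow₀ (by linarith))).trans_lt hlt
  rcases eq_or_ne x y with rfl | hne
  · have : {s ∈ Set.Icc (0 : ℝ) 1 | ‖f ((1 - s) • x + s • x)‖ ≤ l} = ∅ := by
      refine Set.eq_empty_of_forall_notMem fun s hs => hlx.not_ge ?_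
      have := hs.2
      rwa [← add_smul, sub_add_cancel, one_smul] at this
    rw [this, measure_empty]
    exact zero_le
  set a := ‖x - y‖ with ha
  have ha0 : 0 < a := norm_pos_iff.2 (sub_ne_zero.2 hne)
  set v := a⁻¹ • (x - y) with hv
  have hv1 : ‖v‖ = 1 := by
    rw [hv, norm_smul, norm_inv, Real.norm_of_nonneg ha0.le, ← ha, inv_mul_cancel₀ ha0.ne']
  have hpt : ∀ s : ℝ, y + (s * a) • v = (1 - s) • y + s • x := fun s => by
    rw [hv, smul_smul, mul_assoc, mul_inv_cancel₀ ha0.ne', mul_one]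
    module
  set J := Set.Icc (0 : ℝ) a with hJ
  have hJb : ∀ t ∈ J, y + t • v ∈ ball (0 : EuclideanSpace ℂ (Fin n)) 1 := by
    intro t ht
    have h1 := hpt (t / a)
    rw [div_mul_cancel₀ _ ha0.ne'] at h1
    rw [h1]
    have h2 : t / a ≤ 1 := (div_le_one ha0).2 ht.2
    exact convex_ball (0 : EuclideanSpace ℂ (Fin n)) 1 hy hx (by linarith)
      (div_nonneg ht.1 ha0.le) (by ring)
  set g : ℝ → ℝ := fun t => ‖f (y + t • v)‖ with hg
  have hgc : ContinuousOn g J :=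
    (hf.comp (f := fun t : ℝ => y + t • v) (by fun_prop) hJb).norm
  set W := J ∩ g ⁻¹' Set.Iic l with hW
  have hWm : MeasurableSet W :=
    (hgc.preimage_isClosed_of_isClosed isClosed_Icc isClosed_Iic).measurableSet
  have hWfin : volume W ≠ ⊤ :=
    ((measure_mono Set.inter_subset_left).trans_lt measure_Icc_lt_top).ne
  have hset : {s ∈ Set.Icc (0 : ℝ) 1 | ‖f ((1 - s) • y + s • x)‖ ≤ l} = (fun s => s * a) ⁻¹' W := by
    ext s
    simp only [hW, hJ, hg, Set.mem_ofPred_eq, Set.mem_Icc, Set.mem_preimage, Set.mem_inter_iff,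
      Set.mem_Iic, hpt, mul_nonneg_iff_of_pos_right ha0, mul_le_iff_le_one_left ha0]
  rw [hset, Real.volume_preimage_mul_right ha0.ne', abs_of_pos (inv_pos.2 ha0)]
  suffices hle : volume.real W ≤ a / (2 * j) by
    rw [← ENNReal.ofReal_toReal hWfin, ← ENNReal.ofReal_mul (inv_pos.2 ha0).le]
    refine ENNReal.ofReal_le_ofReal ?_
    calc a⁻¹ * volume.real W ≤ a⁻¹ * (a / (2 * j)) := by gcongr
      _ = 1 / (2 * j) := by field_simp
  rcases eq_or_ne (volume W) 0 with h0 | h0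
  · rw [measureReal_def, h0, ENNReal.toReal_zero]
    positivity
  have hμ : 0 < volume.real W := ENNReal.toReal_pos h0 hWfin
  -- With `W` the sublevel set, `‖f x‖ ≤ (4 * a / |W|) ^ K * l`; compared with the lower bound on
  -- `‖f x‖` this forces `8 * j < 4 * a / |W|`.
  have hmain := h y hy v hv1 J W Set.ordConnected_Icc hJb Set.inter_subset_left hWm
    (pos_iff_ne_zero.2 h0)
  have hxJ : ‖f x‖ ≤ sSup (g '' J) := by
    refine le_csSup ⟨M, ?_⟩ ⟨a, ⟨ha0.le, le_rfl⟩, ?_⟩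
    · rintro _ ⟨t, ht, rfl⟩
      exact hM _ (hJb t ht)
    · have := hpt 1
      rw [one_mul] at this
      simp [hg, this]
  have hWl : sSup (g '' W) ≤ l := by
    refine Real.sSup_le ?_ hl.le
    rintro _ ⟨t, ht, rfl⟩
    exact ht.2
  rw [Real.rpow_natCast] at hmain
  have hJr : volume.real J = a := by
    rw [hJ, Real.volume_real_Icc_of_le ha0.le, sub_zero]
  rw [hJr] at hmain
  have h1 : l * (8 * (j : ℝ)) ^ K < l * (4 * a / volume.real W) ^ K := by
    rw [mul_comm l ((4 * a / _) ^ K)]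
    exact hlt.trans_le (hxJ.trans (hmain.trans (mul_le_mul_of_nonneg_left hWl (by positivity))))
  have h2 := lt_of_pow_lt_pow_left₀ K (by positivity) (lt_of_mul_lt_mul_left h1 hl.le)
  rw [lt_div_iff₀ hμ] at h2
  rw [le_div_iff₀ (by positivity)]
  linarith

end Main

/-! ### Conclusion -/

theorem mainTheorem6 :
    ∃ c : ℕ → ℕ → ℝ,
      ∀ (n : ℕ) (_hn : 1 ≤ n) (r : ℝ) (_hr : 1 < r)
        (f : EuclideanSpace ℂ (Fin n) → ℂ)
        (_hf : DifferentiableOn ℂ f (Metric.ball (0 : EuclideanSpace ℂ (Fin n)) r)),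
        (chebyshevExponents f).Nonempty ∧
        ∀ (V : Set (EuclideanSpace ℝ (Fin n))) (_hVconv : Convex ℝ V)
          (_hVint : (interior V).Nonempty)
          (_hVball : V ⊆ Metric.ball (0 : EuclideanSpace ℝ (Fin n)) 1)
          (s : ℕ) (_hs : 1 ≤ s),
          (1 / volume.real V * ∫ x in V, ‖f (realToComplex x)‖ ^ s) ^ (1 / (s : ℝ)) ≤
            c (chebyshevDegreeCeil f) s *
              (1 / volume.real V * ∫ x in V, ‖f (realToComplex x)‖) := by
  refine ⟨fun k s => reverseHolderConst (k + 1) s, fun n _ r hr f hf => ?_⟩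
  have hne := chebyshevExponents_nonempty hr hf
  refine ⟨hne, fun V hV hVi hVb s hs => ?_⟩
  obtain ⟨M, hM⟩ := bddAbove_norm_image hr hf
  have hfc := hf.continuousOn.mono (Metric.ball_subset_ball hr.le)
  have hUb : ∀ x ∈ interior V, realToComplex x ∈ Metric.ball (0 : EuclideanSpace ℂ (Fin n)) 1 := by
    intro x hx
    rw [mem_ball_zero_iff, norm_realToComplex]
    exact mem_ball_zero_iff.1 (hVb (interior_subset hx))
  -- The frontier of a convex set is null, so `V` may be replaced by its interior, as the inner
  -- approximation by boxes needs an open set.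
  have hae : V =ᵐ[volume] interior V :=
    (interior_ae_eq_of_null_frontier (hV.addHaar_frontier volume)).symm
  rw [measureReal_congr hae, setIntegral_congr_set hae, setIntegral_congr_set hae]
  refine reverse_holder (φ := fun x => ‖f (realToComplex x)‖) isOpen_interior hV.interior
    (Metric.isBounded_ball.subset (interior_subset.trans hVb)) hVi
    (hfc.comp continuous_realToComplex.continuousOn hUb).norm (fun _ => norm_nonneg _)
    (fun x hx => hM _ (hUb x hx)) (Nat.le_add_left 1 _) (fun y hy x hx l hl j hj hlt => ?_) hs
  simp only [realToComplex_add, realToComplex_smul]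
  exact (isChebyshevExponent_ceil_add_one hne).volume_segment_le hfc hM (hUb x hx) (hUb y hy)
    hl hj hlt
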